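/- Let $(M,g)$ be a smooth (Hausdorff) pseudo-Riemannian manifold of dimension $n=k+m$ with $k,m\ge 1$, let $i:\Sigma\to M$ be an embedded submanifold of dimension $k$ on which the pullback metric $i^*g$ is nondegenerate, and let $p\in\Sigma$. Indices $\alpha,\beta$ run over $1,\dots,k$, indices $\alpha',\beta'$ over $k+1,\dots,n$, and repeated indices are summed. Let $h=(h_{ij})$ be the matrix of a nondegenerate quadratic form on $\mathbb R^n=\mathbb R^k\oplus\mathbb R^{m}$ for which $\mathbb R^k\perp\mathbb R^{m}$. A pair of frames $\{e_\alpha\}$ of $T_p\Sigma$ and $\{e_{\alpha'}\}$ of the normal space $N_p\Sigma$ is called *adapted* if $g(e_\alpha,e_\beta)=h_{\alpha\beta}$ and $g(e_{\alpha'},e_{\beta'})=h_{\alpha'\beta'}$. Given adapted frames, extend each $e_{\alpha'}$ to a smooth section of the normal bundle $N\Sigma$ near $p$ that is parallel, for the induced connection $\overline\nabla=(\nabla)^\perp$ on $N\Sigma$, along the radial geodesics $t\mapsto \exp^{i^*g}_p(t\,x^\alpha e_\alpha)$ of $\Sigma$. The *submanifold geodesic normal coordinate system* corresponding to the frames is the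 coordinate system $(x,u)$ near $p$ in which, for all $(x,u)\in\mathbb R^k\times\mathbb R^{m}$ near $0$, the point with coordinates $(x,u)$ is $$\exp^g_{y}\bigl(u^{\alpha'}e_{\alpha'}(y)\bigr),\qquad y=\exp^{i^*g}_p(x^\alpha e_\alpha).$$ Let $(x,u)=(x^1,\dots,x^k,u^{k+1},\dots,u^{n})$ be a smooth coordinate system of $M$ near $p$ in which $\Sigma=\{u=0\}$ and $p=\{x=0,u=0\}$. Write $g_{ij}(x,u)$ for the components of $g$ in these coordinates, and $g_{ij,l}$ for their partial derivatives. Let $e_\alpha\in T_p\Sigma$ $(1\le\alpha\le k)$ and $e_{\alpha'}\in T_pM$ $(k+1\le\alpha'\le n)$ be vectors. Then $\{e_\alpha\},\{e_{\alpha'}\}$ are adapted frames and $(x,u)$ is, near $p$, the submanifold geodesic normal coordinate system corresponding to them, if and only if $\partial_\alpha(p)=e_\alpha$, $\partial_{\alpha'}(p)=e_{\alpha'}$ and the following four identities hold for all $(x,u)$ near $(0,0)$: - (A) $g_{\alpha\beta}(x,0)\,x^\beta=h_{\alpha\beta}\,x^\beta$ for all $\alpha$; - (B) $g_{\alpha'\beta'}(x,u)\,u^{\beta'}=h_{\alpha'\beta'}\,u^{\beta'}$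 for all $\alpha'$; - (C) $g_{\alpha\alpha',\beta'}(x,0)\,x^\alpha=0$ for all $\alpha',\beta'$; - (D) $g_{\alpha\alpha'}(x,u)\,u^{\alpha'}=0$ for all $\alpha$. -/

import Mathlib

open scoped Manifold ContDiff Topology
open Set Filter

noncomputable section

namespace SubmanifoldNormal

/-! ### Pseudo-Riemannian metrics

Manifolds are without boundary, modelled on a normed space `E`; `S` will be the submanifold and `M`
the ambient manifold. -/

section Metric

variable {E F E' : Type*}
  [NormedAddCommGroup E] [NormedSpace ℝ E]
  [NormedAddCommGroup F] [NormedSpace ℝ F]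
  [NormedAddCommGroup E'] [NormedSpace ℝ E']
  {M : Type*} [TopologicalSpace M] [ChartedSpace E M]
  {S : Type*} [TopologicalSpace S] [ChartedSpace E' S]

/-- A field of (continuous) bilinear forms on the tangent spaces of `M`. -/
abbrev BilinField (E : Type*) [NormedAddCommGroup E] [NormedSpace ℝ E]
    (M : Type*) [TopologicalSpace M] [ChartedSpace E M] : Type _ :=
  (q : M) → TangentSpace 𝓘(ℝ, E) q →L[ℝ] TangentSpace 𝓘(ℝ, E) q →L[ℝ] ℝ

/-- Every one of the bilinear forms is nondegenerate. -/
def IsNondegenerate (g : BilinField E M) : Prop :=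
  ∀ q v, (∀ w, g q v w = 0) → v = 0

/-- `g` is a smooth pseudo-Riemannian metric on `M` (of any signature). -/
structure IsPseudoRiemannianMetric [IsManifold 𝓘(ℝ, E) ∞ M] (g : BilinField E M) : Prop where
  symm : ∀ q v w, g q v w = g q w v
  nondegenerate : IsNondegenerate g
  contMDiff : ContMDiff 𝓘(ℝ, E) (𝓘(ℝ, E).prod 𝓘(ℝ, E →L[ℝ] E →L[ℝ] ℝ)) ∞
    (fun q ↦ Bundle.TotalSpace.mk' (E →L[ℝ] E →L[ℝ] ℝ)
      (E := fun q : M ↦ TangentSpace 𝓘(ℝ, E) q →L[ℝ] TangentSpace 𝓘(ℝ, E) q →L[ℝ] ℝ) q (g q))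

/-- The pullback `ι^* g`: `(ι^* g)(v, w) = g(dι v, dι w)`. -/
def pullback (ι : S → M) (g : BilinField E M) : BilinField E' S := fun y ↦
  ContinuousLinearMap.bilinearComp (E := E) (F := E) (E' := E') (F' := E') (g (ι y))
    (mfderiv 𝓘(ℝ, E') 𝓘(ℝ, E) ι y) (mfderiv 𝓘(ℝ, E') 𝓘(ℝ, E) ι y)

/-- `ι : S → M` is a smooth embedding; its image is then an embedded submanifold of `M`. -/
structure IsEmbeddedSubmanifold (ι : S → M) : Prop where
  contMDiff : ContMDiff 𝓘(ℝ, E') 𝓘(ℝ, E) ∞ ι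
  injective_mfderiv : ∀ y, Function.Injective (mfderiv 𝓘(ℝ, E') 𝓘(ℝ, E) ι y)
  isEmbedding : Topology.IsEmbedding ι

/-- `φ` is a smooth coordinate system, with values in `F`, on the open set `φ.source` of `M`. -/
structure IsCoordinateSystem (φ : OpenPartialHomeomorph M F) : Prop where
  contMDiffOn : ContMDiffOn 𝓘(ℝ, E) 𝓘(ℝ, F) ∞ φ φ.source
  contMDiffOn_symm : ContMDiffOn 𝓘(ℝ, F) 𝓘(ℝ, E) ∞ φ.symm φ.target

/-! ### Levi-Civita covariant derivative along a curve, geodesics, exponential map -/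

/-- The metric written in the coordinates `φ`: a function of `z ∈ F` with values in the bilinear
forms on `F`. -/
def metricInCoords (g : BilinField E M) (φ : OpenPartialHomeomorph M F) (z : F) :
    F →L[ℝ] F →L[ℝ] ℝ :=
  ContinuousLinearMap.bilinearComp (E := E) (F := E) (E' := F) (F' := F) (g (φ.symm z))
    (mfderiv 𝓘(ℝ, F) 𝓘(ℝ, E) φ.symm z) (mfderiv 𝓘(ℝ, F) 𝓘(ℝ, E) φ.symm z)

/-- The Christoffel symbols of the metric `G` on an open set of `F`: `Γ(a, b)` is the vector with
`G(Γ(a, b), w) = ½ ((∂_a G)(b, w) + (∂_b G)(a, w) - (∂_w G)(a, b))` for all `w`, that is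
`Γ^k_{ij} = ½ g^{kl} (∂_i g_{jl} + ∂_j g_{il} - ∂_l g_{ij})`. -/
def christoffel (G : F → F →L[ℝ] F →L[ℝ] ℝ) (z a b : F) : F :=
  (G z).inverse ((1 / 2 : ℝ) •
    (fderiv ℝ G z a b + fderiv ℝ G z b a - ((fderiv ℝ G z).flip a).flip b))

/-- The components, in the coordinates `φ`, of the covariant derivative along the curve `c` of the
vector field `V` along `c`, at time `t`: `dV/dt + Γ(dc/dt, V)`. -/
def covDerivInCoords (g : BilinField E M) (φ : OpenPartialHomeomorph M F) (c : ℝ → M)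
    (V : (s : ℝ) → TangentSpace 𝓘(ℝ, E) (c s)) (t : ℝ) : F :=
  let V' : ℝ → F := fun s ↦ mfderiv 𝓘(ℝ, E) 𝓘(ℝ, F) φ (c s) (V s)
  deriv V' t + christoffel (metricInCoords g φ) (φ (c t)) (deriv (fun s ↦ φ (c s)) t) (V' t)

/-- The Levi-Civita covariant derivative `D_t V` along `c`. A vector of the tangent space at `c t`
is, in Mathlib, given by its components in the chart `chartAt E (c t)`. -/
def covDerivAlong (g : BilinField E M) (c : ℝ → M) (V : (s : ℝ) → TangentSpace 𝓘(ℝ, E) (c s))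
    (t : ℝ) : TangentSpace 𝓘(ℝ, E) (c t) :=
  covDerivInCoords (F := E) g (chartAt E (c t)) c V t

/-- The velocity of a curve. -/
def velocity (c : ℝ → M) (t : ℝ) : TangentSpace 𝓘(ℝ, E) (c t) :=
  mfderiv 𝓘(ℝ, ℝ) 𝓘(ℝ, E) c t (1 : ℝ)

/-- `c` is a geodesic of `g` on the open set `s` of times: `D_t (dc/dt) = 0`. -/
def IsGeodesicOn (g : BilinField E M) (c : ℝ → M) (s : Set ℝ) : Prop :=
  ContMDiffOn 𝓘(ℝ, ℝ) 𝓘(ℝ, E) ∞ c s ∧ ∀ t ∈ s, covDerivAlong g c (velocity c) t = 0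

/-- `c` is a geodesic, defined on an open interval containing `[0, 1]`, that starts at time `0`
at the point `q` with velocity `v`. -/
def IsGeodesicFrom (g : BilinField E M) (q : M) (v : TangentSpace 𝓘(ℝ, E) q) (c : ℝ → M) : Prop :=
  (∃ ε > 0, IsGeodesicOn g c (Ioo (-ε) (1 + ε))) ∧
    (⟨c 0, velocity c 0⟩ : TangentBundle 𝓘(ℝ, E) M) = ⟨q, v⟩

/-- `exp_q v` is defined and equal to `q'`. -/
def IsExp (g : BilinField E M) (q : M) (v : TangentSpace 𝓘(ℝ, E) q) (q' : M) : Prop :=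
  ∃ c : ℝ → M, IsGeodesicFrom g q v c ∧ c 1 = q'

/-- `v` is normal to the submanifold at `ι y`. -/
def IsNormal (g : BilinField E M) (ι : S → M) (y : S) (v : TangentSpace 𝓘(ℝ, E) (ι y)) : Prop :=
  ∀ w : TangentSpace 𝓘(ℝ, E') y, g (ι y) v (mfderiv 𝓘(ℝ, E') 𝓘(ℝ, E) ι y w) = 0

/-- The normal section `N` is parallel along the curve `γ` of the submanifold at time `t`, with
respect to the induced connection of the normal bundle: the normal component of the ambient
covariant derivative `D_t (N ∘ γ)` vanishes, i.e. this derivative is tangent to the submanifold. -/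
def IsNormalParallelAt (g : BilinField E M) (ι : S → M)
    (N : (y : S) → TangentSpace 𝓘(ℝ, E) (ι y)) (γ : ℝ → S) (t : ℝ) : Prop :=
  covDerivAlong g (fun s ↦ ι (γ s)) (fun s ↦ N (γ s)) t ∈
    range (mfderiv 𝓘(ℝ, E') 𝓘(ℝ, E) ι (γ t))

end Metric

/-! ### Submanifold geodesic normal coordinates

Here `dim S = k`, `dim M = k + m`. Unprimed indices are `Sum.inl α` with `α : Fin k`, primed ones
are `Sum.inr α'` with `α' : Fin m`. -/

section Coordinates

/-- `ℝ^k` -/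
abbrev Eu (k : ℕ) : Type := EuclideanSpace ℝ (Fin k)

variable {k m : ℕ}

/-- The standard basis of `ℝ^k × ℝ^m`, i.e. the coordinate vector fields `∂_α`, `∂_α'`. -/
def coordVector : Fin k ⊕ Fin m → Eu k × Eu m
  | Sum.inl a => (EuclideanSpace.single a 1, 0)
  | Sum.inr a => (0, EuclideanSpace.single a 1)

/-- The matrix of a nondegenerate quadratic form on `ℝ^k ⊕ ℝ^m` for which the two summands are
orthogonal. -/
structure IsReferenceForm (h : Matrix (Fin k ⊕ Fin m) (Fin k ⊕ Fin m) ℝ) : Prop where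
  isSymm : h.IsSymm
  nondegenerate : h.det ≠ 0
  orthogonal : ∀ a b, h (Sum.inl a) (Sum.inr b) = 0

variable {M : Type*} [TopologicalSpace M] [ChartedSpace (Eu (k + m)) M]
  {S : Type*} [TopologicalSpace S] [ChartedSpace (Eu k) S]

/-- The component `g_{ij}` of the metric in the coordinates `φ = (x, u)`, as a function of
`z = (x, u)`. -/
def metricCoeff (g : BilinField (Eu (k + m)) M) (φ : OpenPartialHomeomorph M (Eu k × Eu m))
    (i j : Fin k ⊕ Fin m) (z : Eu k × Eu m) : ℝ :=
  metricInCoords g φ z (coordVector i) (coordVector j)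

/-- `e`, `e'` are frames for the tangent space and for the normal space of the submanifold at `p`,
with inner products given by `h`. -/
structure IsAdaptedFrame (g : BilinField (Eu (k + m)) M) (ι : S → M) (p : S)
    (h : Matrix (Fin k ⊕ Fin m) (Fin k ⊕ Fin m) ℝ)
    (e : Fin k → TangentSpace 𝓘(ℝ, Eu k) p)
    (e' : Fin m → TangentSpace 𝓘(ℝ, Eu (k + m)) (ι p)) : Prop where
  linearIndependent : LinearIndependent ℝ e
  linearIndependent' : LinearIndependent ℝ e'
  normal : ∀ a, IsNormal (E' := Eu k) g ι p (e' a)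
  inner_eq : ∀ a b, pullback ι g p (e a) (e b) = h (Sum.inl a) (Sum.inl b)
  inner_eq' : ∀ a b, g (ι p) (e' a) (e' b) = h (Sum.inr a) (Sum.inr b)

/-- `N` extends the normal frame `e'` at `p` to smooth sections of the normal bundle near `p` that
are parallel along the radial geodesics `γ_x`, `γ_x(t) = exp_p (t x^α e_α)`, of the submanifold. -/
structure IsRadiallyParallelExtension (g : BilinField (Eu (k + m)) M) (ι : S → M) (p : S)
    [IsManifold 𝓘(ℝ, Eu (k + m)) ∞ M]
    (e : Fin k → TangentSpace 𝓘(ℝ, Eu k) p)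
    (e' : Fin m → TangentSpace 𝓘(ℝ, Eu (k + m)) (ι p))
    (N : Fin m → (y : S) → TangentSpace 𝓘(ℝ, Eu (k + m)) (ι y)) : Prop where
  eq_at : ∀ a, N a p = e' a
  smooth : ∀ a, ∀ᶠ y in 𝓝 p, ContMDiffAt 𝓘(ℝ, Eu k) 𝓘(ℝ, Eu (k + m)).tangent ∞
    (fun y ↦ (⟨ι y, N a y⟩ : TangentBundle 𝓘(ℝ, Eu (k + m)) M)) y
  normal : ∀ a, ∀ᶠ y in 𝓝 p, IsNormal (E' := Eu k) g ι y (N a y)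
  parallel : ∀ᶠ x : Eu k in 𝓝 0, ∀ γ : ℝ → S,
    IsGeodesicFrom (pullback ι g) p (∑ b, x b • e b) γ →
      ∀ a, ∀ t ∈ Icc (0 : ℝ) 1, IsNormalParallelAt (E' := Eu k) g ι (N a) γ t

/-- Near `p`, the coordinates `φ = (x, u)` are the submanifold geodesic normal coordinates for the
frames `e`, `e'`: the point with coordinates `(x, u)` is `exp^g_y (u^{α'} e_{α'}(y))` with
`y = exp^{ι^* g}_p (x^α e_α)`, where `e_{α'}(y)` is the radially parallel extension of `e'`. -/
def IsSubmanifoldGeodesicNormal [IsManifold 𝓘(ℝ, Eu (k + m)) ∞ M]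
    (g : BilinField (Eu (k + m)) M) (ι : S → M) (p : S)
    (e : Fin k → TangentSpace 𝓘(ℝ, Eu k) p)
    (e' : Fin m → TangentSpace 𝓘(ℝ, Eu (k + m)) (ι p))
    (φ : OpenPartialHomeomorph M (Eu k × Eu m)) : Prop :=
  ∃ N : Fin m → (y : S) → TangentSpace 𝓘(ℝ, Eu (k + m)) (ι y),
    IsRadiallyParallelExtension g ι p e e' N ∧
    ∀ᶠ z : Eu k × Eu m in 𝓝 0, ∃ y : S,
      IsExp (pullback ι g) p (∑ a, z.1 a • e a) y ∧
      IsExp g (ι y) (∑ a, z.2 a • N a y) (φ.symm z)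

end Coordinates

end SubmanifoldNormal

end

open scoped Manifold ContDiff Topology
open Set Filter

noncomputable section

namespace SubmanifoldNormal

/-! ### Metrics on open subsets of a normed space -/

section NormedSpace

set_option maxSynthPendingDepth 3

variable {F F' : Type*} [NormedAddCommGroup F] [NormedSpace ℝ F]
  [NormedAddCommGroup F'] [NormedSpace ℝ F']

/-! Let `G` be the metric written in the coordinates (x, u). Being submanifold geodesic normal
coordinates amounts to three statements about Christoffel symbols near 0, together with normality of
the fields ∂_α' along u = 0: the lines t ↦ t x are geodesics of the induced metric, the lines t ↦
(x, t u) are geodesics of `G`, and the fields ∂_α' are parallel in the normal bundle along t ↦ (t x,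
0), that is, Γ((x, 0), (0, u)) has no vertical part there. The theorem translates these statements
into identities for `G`.

The two families of lines are treated by one Gauss lemma. Let P be a linear projection. A line in
the direction P z is a geodesic at z exactly when 2 (∂_{Pz} G)(Pz, w) = (∂_w G)(Pz, Pz) for all w.
Given the right values of `G` on {P z = 0}, this system is equivalent to G_z(Pz, w) = H(Pz, w) with
a constant form H (`gauss_lemma`, `gauss_lemma_converse`). For P = id on the submanifold this is
(A). For P(x, u) = (0, u) it is (B) and (D) at once, according to whether w is vertical or
horizontal. The values needed on u = 0 hold because the fields ∂_α' are normal to the submanifold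
and have constant inner products along radial geodesics, parallel transport being isometric
(`vertical_inner_eq`).

Condition (C) encodes the parallelism. On u = 0, 2 G(Γ(x, u), u') = ∂_x G(u, u') + ∂_u G(x, u') -
∂_{u'} G(x, u). Parallelism makes ∂_u G(x, u') symmetric in u, u'; the vertical Gauss identity makes
it alternating; hence it vanishes (`fderiv_mixed_eq_zero`). Conversely, that identity kills the
first term and (C) kills the other two (`christoffel_mixed_snd_eq_zero`).

Since the exponential map is given by the existence of some geodesic, uniqueness of geodesics in a
Hausdorff manifold (`eqOn_of_isGeodesicOn`) is what identifies that geodesic with a coordinate line.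
Finally g_ij(0) = h_ij follows in one direction from the frames being adapted, and in the other by
dividing (A), (B) and (D) by a scale factor that tends to 0. -/

lemma isInvertible_of_nondegenerate [FiniteDimensional ℝ F] {B : F →L[ℝ] F →L[ℝ] ℝ}
    (hB : ∀ v, (∀ w, B v w = 0) → v = 0) : B.IsInvertible := by
  have hinj : Function.Injective B.toLinearMap := by
    rw [← LinearMap.ker_eq_bot, LinearMap.ker_eq_bot']
    intro v hv
    refine hB v fun w ↦ ?_
    have hv' : B v = 0 := hv
    simp [hv']
  have hdim : Module.finrank ℝ F = Module.finrank ℝ (F →L[ℝ] ℝ) := by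
    rw [← (LinearMap.toContinuousLinearMap (𝕜 := ℝ) (E := F) (F' := ℝ)).finrank_eq]
    exact Subspace.dual_finrank_eq.symm
  let e := LinearEquiv.ofInjectiveOfFinrankEq B.toLinearMap hinj hdim
  exact ⟨e.toContinuousLinearEquiv, by ext; rfl⟩

lemma apply_christoffel [FiniteDimensional ℝ F] {G : F → F →L[ℝ] F →L[ℝ] ℝ} {z : F}
    (hG : ∀ v, (∀ w, G z v w = 0) → v = 0) (a b w : F) :
    G z (christoffel G z a b) w =
      1 / 2 * (fderiv ℝ G z a b w + fderiv ℝ G z b a w - fderiv ℝ G z w a b) := by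
  rw [christoffel, (isInvertible_of_nondegenerate hG).self_apply_inverse]
  simp

/-- With equal arguments two of the three terms coincide. The geodesic equation for straight lines
becomes a relation linear in the first derivatives of `G`, free of the inverse metric; this is the
form the Gauss lemma works with. -/
lemma christoffel_eq_zero_iff [FiniteDimensional ℝ F] {G : F → F →L[ℝ] F →L[ℝ] ℝ} {z : F}
    (hG : ∀ v, (∀ w, G z v w = 0) → v = 0) (a : F) :
    christoffel G z a a = 0 ↔ ∀ w, 2 * fderiv ℝ G z a a w = fderiv ℝ G z w a a := by
  constructor
  · intro h w
    have := apply_christoffel hG a a w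
    rw [h] at this
    simp at this
    linarith
  · intro h
    refine hG _ fun w ↦ ?_
    rw [apply_christoffel hG, ← h w]
    ring

/-- C¹ regularity gives the local Lipschitz bound behind uniqueness of geodesics, and the continuity
used when passing to the limit along a line. -/
lemma contDiffAt_christoffel [FiniteDimensional ℝ F] {G : F → F →L[ℝ] F →L[ℝ] ℝ} {z v : F}
    (hG : ∀ v, (∀ w, G z v w = 0) → v = 0) (hs : ContDiffAt ℝ ∞ G z) :
    ContDiffAt ℝ 1 (fun y : F × F ↦ christoffel G y.1 y.2 y.2) (z, v) := by
  have h1 : ContDiffAt ℝ 1 (fun y : F × F ↦ G y.1) (z, v) :=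
    (hs.of_le (by norm_cast)).comp (z, v) contDiffAt_fst
  have h2 : ContDiffAt ℝ 1 (fun y : F × F ↦ fderiv ℝ G y.1) (z, v) :=
    (hs.fderiv_right (m := 1) (by norm_cast)).comp (z, v) contDiffAt_fst
  have h3 : ContDiffAt ℝ 1 (fun y : F × F ↦ y.2) (z, v) := contDiffAt_snd
  have h4 : ContDiffAt ℝ 1 (fun y : F × F ↦ (G y.1).inverse) (z, v) :=
    ContDiffAt.comp (g := ContinuousLinearMap.inverse) (z, v)
      (isInvertible_of_nondegenerate hG).contDiffAt_map_inverse h1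
  have h5 := (h2.clm_apply h3).clm_apply h3
  have hflip : ContDiff ℝ 1 (fun B : F →L[ℝ] F →L[ℝ] ℝ ↦ B.flip) :=
    (ContinuousLinearMap.flipₗᵢ ℝ F F ℝ).contDiff
  have hflip' : ContDiff ℝ 1 (fun B : F →L[ℝ] F →L[ℝ] F →L[ℝ] ℝ ↦ B.flip) :=
    (ContinuousLinearMap.flipₗᵢ ℝ F F (F →L[ℝ] ℝ)).contDiff
  have h6 := (hflip.contDiffAt.comp (z, v)
    ((hflip'.contDiffAt.comp (z, v) h2).clm_apply h3)).clm_apply h3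
  exact h4.clm_apply (((h5.add h5).sub h6).const_smul (1 / 2 : ℝ))

/-- The derivative of a pulled back metric. -/
lemma fderiv_bilinearComp_fderiv {G : F → F →L[ℝ] F →L[ℝ] ℝ} {G' : F' → F' →L[ℝ] F' →L[ℝ] ℝ}
    {f : F' → F} {z : F'} (hf : ContDiffAt ℝ ∞ f z) (hG : DifferentiableAt ℝ G (f z))
    (hG'd : DifferentiableAt ℝ G' z)
    (hG' : G' =ᶠ[𝓝 z] fun y ↦ (G (f y)).bilinearComp (fderiv ℝ f y) (fderiv ℝ f y))
    (a b c : F') :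
    fderiv ℝ G' z a b c =
      fderiv ℝ G (f z) (fderiv ℝ f z a) (fderiv ℝ f z b) (fderiv ℝ f z c)
        + G (f z) (fderiv ℝ (fderiv ℝ f) z a b) (fderiv ℝ f z c)
        + G (f z) (fderiv ℝ f z b) (fderiv ℝ (fderiv ℝ f) z a c) := by
  have hdf : HasFDerivAt f (fderiv ℝ f z) z := (hf.differentiableAt (by simp)).hasFDerivAt
  have hddf : HasFDerivAt (fderiv ℝ f) (fderiv ℝ (fderiv ℝ f) z) z :=
    ((hf.fderiv_right (m := 1) (by norm_cast)).differentiableAt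
      (by simp)).hasFDerivAt
  have h1 : HasFDerivAt (fun y ↦ G (f y)) (fderiv ℝ G (f z) ∘L fderiv ℝ f z) z :=
    hG.hasFDerivAt.comp z hdf
  have h2 := (h1.clm_apply (hddf.clm_apply (hasFDerivAt_const b z))).clm_apply
    (hddf.clm_apply (hasFDerivAt_const c z))
  have h3 := (hG'd.hasFDerivAt.clm_apply (hasFDerivAt_const b z)).clm_apply
    (hasFDerivAt_const c z)
  have h4 : (fun y ↦ G' y b c) =ᶠ[𝓝 z] fun y ↦ G (f y) (fderiv ℝ f y b) (fderiv ℝ f y c) := by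
    filter_upwards [hG'] with y hy
    rw [hy]; rfl
  have h5 := congrArg (fun L ↦ L a) (h3.unique (h2.congr_of_eventuallyEq h4))
  simp at h5
  linarith

/-- The transformation law of the Christoffel symbols. -/
lemma fderiv_christoffel [FiniteDimensional ℝ F] [FiniteDimensional ℝ F']
    {G : F → F →L[ℝ] F →L[ℝ] ℝ} {G' : F' → F' →L[ℝ] F' →L[ℝ] ℝ}
    {f : F' → F} {z : F'} (hf : ContDiffAt ℝ ∞ f z) (hG : DifferentiableAt ℝ G (f z))
    (hG'd : DifferentiableAt ℝ G' z)
    (hG' : G' =ᶠ[𝓝 z] fun y ↦ (G (f y)).bilinearComp (fderiv ℝ f y) (fderiv ℝ f y))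
    (hsymm : ∀ a b, G (f z) a b = G (f z) b a)
    (hnd : ∀ v, (∀ w, G (f z) v w = 0) → v = 0) (hnd' : ∀ v, (∀ w, G' z v w = 0) → v = 0)
    (hsurj : Function.Surjective (fderiv ℝ f z)) (a b : F') :
    fderiv ℝ f z (christoffel G' z a b) =
      christoffel G (f z) (fderiv ℝ f z a) (fderiv ℝ f z b) + fderiv ℝ (fderiv ℝ f) z a b := by
  -- By nondegeneracy it suffices to pair with `fderiv ℝ f z c`. The three derivatives of `G'`
  -- produce six terms containing the second derivative of `f`; by its symmetry four of them cancel
  -- and the other two agree, which absorbs the factor ½.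
  rw [← sub_eq_zero]
  refine hnd _ fun w ↦ ?_
  obtain ⟨c, rfl⟩ := hsurj w
  have hs : IsSymmSndFDerivAt ℝ f z := hf.isSymmSndFDerivAt (by simp; norm_cast)
  have h0 : G (f z) (fderiv ℝ f z (christoffel G' z a b)) (fderiv ℝ f z c)
      = G' z (christoffel G' z a b) c := by
    rw [hG'.self_of_nhds]; rfl
  have h1 := fderiv_bilinearComp_fderiv hf hG hG'd hG'
  simp only [map_sub, map_add, sub_apply, add_apply,
    h0, apply_christoffel hnd', apply_christoffel hnd, h1, hs.eq b a, hs.eq c a, hs.eq c b,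
    hsymm (fderiv ℝ f z b) (fderiv ℝ (fderiv ℝ f) z a c)]
  ring

lemma eq_of_hasDerivAt_zero {f : ℝ → ℝ} (hc : ContinuousOn f (Icc 0 1))
    (hd : ∀ s ∈ Ioo (0 : ℝ) 1, HasDerivAt f 0 s) : f 1 = f 0 := by
  obtain ⟨s, hs, h⟩ := exists_hasDerivAt_eq_slope f (fun _ ↦ 0) zero_lt_one hc hd
  simp at h
  linarith

lemma hasDerivAt_comp_apply_apply {G : F → F →L[ℝ] F →L[ℝ] ℝ} {l : ℝ → F} {l' : F} {s : ℝ}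
    (hG : DifferentiableAt ℝ G (l s)) (hl : HasDerivAt l l' s) (a b : F) :
    HasDerivAt (fun s ↦ G (l s) a b) (fderiv ℝ G (l s) l' a b) s := by
  have h1 : HasDerivAt (fun s ↦ G (l s)) (fderiv ℝ G (l s) l') s :=
    hG.hasFDerivAt.comp_hasDerivAt s hl
  have h2 := (h1.clm_apply (hasDerivAt_const s a)).clm_apply (hasDerivAt_const s b)
  simpa using h2

/-- The Gauss lemma: if the lines `s ↦ z - P z + s • P z`, for a projection `P`, are geodesics
that meet the set `P = 0` with prescribed inner products, then `G z (P z)` is constant. -/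
lemma gauss_lemma {G : F → F →L[ℝ] F →L[ℝ] ℝ} {U : Set F} (hU : IsOpen U) (P : F →L[ℝ] F)
    (hP : ∀ v, P (P v) = P v) (H : F →L[ℝ] F →L[ℝ] ℝ) (hH : ∀ v w, H v w = H w v)
    (hUP : ∀ z ∈ U, ∀ s ∈ Icc (0 : ℝ) 1, z - P z + s • P z ∈ U)
    (hG : ∀ z ∈ U, DifferentiableAt ℝ G z) (hsymm : ∀ z ∈ U, ∀ v w, G z v w = G z w v)
    (hgeo : ∀ z ∈ U, ∀ w, 2 * fderiv ℝ G z (P z) (P z) w = fderiv ℝ G z w (P z) (P z))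
    (hbase : ∀ z ∈ U, P z = 0 → ∀ v w, G z (P v) w = H (P v) w) :
    ∀ z ∈ U, ∀ w, G z (P z) w = H (P z) w := by
  have hPl : ∀ z (s : ℝ), P (z - P z + s • P z) = s • P z := fun z s ↦ by simp [hP]
  have hl : ∀ z (s : ℝ), HasDerivAt (fun s : ℝ ↦ z - P z + s • P z) (P z) s := fun z s ↦ by
    simpa using ((hasDerivAt_id s).smul_const (P z)).const_add (z - P z)
  have hd : ∀ z ∈ U, ∀ w, ∀ s ∈ Icc (0 : ℝ) 1,
      HasDerivAt (fun s : ℝ ↦ G (z - P z + s • P z) (P z) w)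
        (fderiv ℝ G (z - P z + s • P z) (P z) (P z) w) s := by
    intro z hz w s hs
    exact hasDerivAt_comp_apply_apply (hG _ (hUP z hz s hs)) (hl z s) _ _
  have hdc : ∀ z ∈ U, ∀ w,
      ContinuousOn (fun s : ℝ ↦ G (z - P z + s • P z) (P z) w) (Icc 0 1) :=
    fun z hz w s hs ↦ (hd z hz w s hs).continuousAt.continuousWithinAt
  have h0 : ∀ z ∈ U, ∀ w, G (z - P z + (0 : ℝ) • P z) (P z) w = H (P z) w := by
    intro z hz w
    exact hbase _ (hUP z hz 0 (by simp)) (by simp [hP]) z w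
  -- Conservation of energy. At the point z - P z + s • P z the projection is s • P z, so with w = P
  -- z the geodesic equation reads 2 s² X = s² X, where X is the derivative of G(P z, P z) along the
  -- line.
  have hE : ∀ z ∈ U, G z (P z) (P z) = H (P z) (P z) := by
    intro z hz
    have h := eq_of_hasDerivAt_zero (hdc z hz (P z)) fun s hs ↦ by
      have h1 := hd z hz (P z) s (Ioo_subset_Icc_self hs)
      have h2 := hgeo _ (hUP z hz s (Ioo_subset_Icc_self hs)) (P z)
      rw [hPl] at h2
      simp only [map_smul, smul_apply, smul_eq_mul] at h2
      have h3 : fderiv ℝ G (z - P z + s • P z) (P z) (P z) (P z) = 0 := by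
        have : s * s * fderiv ℝ G (z - P z + s • P z) (P z) (P z) (P z) = 0 := by linarith
        simpa [hs.1.ne'] using this
      rwa [h3] at h1
    rw [h0 z hz] at h
    simpa using h
  -- The energy identity holds on the whole open set, so it may be differentiated in any direction
  -- w.
  have hE' : ∀ z ∈ U, ∀ w,
      fderiv ℝ G z w (P z) (P z) + 2 * G z (P z) (P w) = 2 * H (P z) (P w) := by
    intro z hz w
    have h1 := ((hG z hz).hasFDerivAt.clm_apply P.hasFDerivAt).clm_apply P.hasFDerivAt
    have h2 := ((H.hasFDerivAt.comp z P.hasFDerivAt).clm_apply P.hasFDerivAt)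
    have h3 : (fun y ↦ G y (P y) (P y)) =ᶠ[𝓝 z] fun y ↦ H (P y) (P y) := by
      filter_upwards [hU.mem_nhds hz] with y hy using hE y hy
    have h5 := congrArg (fun L ↦ L w) (h1.unique (h2.congr_of_eventuallyEq h3))
    simp at h5
    rw [hsymm z hz (P w), hH (P w)] at h5
    linarith
  -- Eliminating (∂_w G)(P z, P z) between the geodesic equation and `hE'` leaves a linear
  -- differential equation in s along the line.
  have hgeo' : ∀ z ∈ U, ∀ w, ∀ s ∈ Ioo (0 : ℝ) 1,
      s * fderiv ℝ G (z - P z + s • P z) (P z) (P z) w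
        = H (P z) (P w) - G (z - P z + s • P z) (P z) (P w) := by
    intro z hz w s hs
    have hzs := hUP z hz s (Ioo_subset_Icc_self hs)
    have h2 := hgeo _ hzs w
    have h3 := hE' _ hzs w
    rw [hPl] at h2 h3
    simp only [map_smul, smul_apply, smul_eq_mul] at h2 h3
    refine mul_left_cancel₀ hs.1.ne' ?_
    linarith
  -- For w in the image of P the equation says that s (G - H) has derivative zero; it vanishes at s
  -- = 0, so no initial value of `G` is needed here.
  have hT : ∀ z ∈ U, ∀ w, G z (P z) (P w) = H (P z) (P w) := by
    intro z hz w
    have h := eq_of_hasDerivAt_zero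
      (f := fun s ↦ s * (G (z - P z + s • P z) (P z) (P w) - H (P z) (P w)))
      (continuousOn_id.mul ((hdc z hz (P w)).sub continuousOn_const)) fun s hs ↦ by
        have h1 := (hasDerivAt_id s).mul
          ((hd z hz (P w) s (Ioo_subset_Icc_self hs)).sub_const (H (P z) (P w)))
        have h2 := hgeo' z hz (P w) s hs
        rw [hP] at h2
        refine h1.congr_deriv ?_
        rw [id_eq, h2]
        ring
    simp at h
    linarith
  -- For general w, `hT` at the points of the line makes the right side of `hgeo'` zero. Hence G(P
  -- z, w) is constant along the line, with the value prescribed where P vanishes.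
  intro z hz w
  have h := eq_of_hasDerivAt_zero (hdc z hz w) fun s hs ↦ by
    have hs' := Ioo_subset_Icc_self hs
    have h1 := hd z hz w s hs'
    have h2 := hgeo' z hz w s hs
    have h3 := hT _ (hUP z hz s hs') w
    rw [hPl] at h3
    simp only [map_smul, smul_apply, smul_eq_mul] at h3
    rw [mul_left_cancel₀ hs.1.ne' h3, sub_self] at h2
    rwa [(mul_eq_zero.1 h2).resolve_left hs.1.ne'] at h1
  rw [h0 z hz] at h
  simpa using h

/-- The converse of `gauss_lemma`. -/
lemma gauss_lemma_converse {G : F → F →L[ℝ] F →L[ℝ] ℝ} {U : Set F} (hU : IsOpen U)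
    (P : F →L[ℝ] F) (hP : ∀ v, P (P v) = P v) (H : F →L[ℝ] F →L[ℝ] ℝ)
    (hH : ∀ v w, H v w = H w v) 
    (hG : ∀ z ∈ U, DifferentiableAt ℝ G z) (hsymm : ∀ z ∈ U, ∀ v w, G z v w = G z w v)
    (h : ∀ z ∈ U, ∀ w, G z (P z) w = H (P z) w) :
    ∀ z ∈ U, ∀ w, 2 * fderiv ℝ G z (P z) (P z) w = fderiv ℝ G z w (P z) (P z) := by
  intro z hz w
  have hGz := (hG z hz).hasFDerivAt
  -- Both sides of the goal are zero: the left by differentiating the hypothesis along P z with w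
  -- fixed, the right by differentiating its diagonal case G_y(P y, P y) = H(P y, P y) along w.
  have h1 := (hGz.clm_apply P.hasFDerivAt).clm_apply (hasFDerivAt_const w z)
  have h2 := (H.hasFDerivAt.comp z P.hasFDerivAt).clm_apply (hasFDerivAt_const w z)
  have h3 : (fun y ↦ G y (P y) w) =ᶠ[𝓝 z] fun y ↦ H (P y) w := by
    filter_upwards [hU.mem_nhds hz] with y hy using h y hy w
  have h4 := congrArg (fun L ↦ L (P z)) (h1.unique (h2.congr_of_eventuallyEq h3))
  have h1' := (hGz.clm_apply P.hasFDerivAt).clm_apply P.hasFDerivAt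
  have h2' := (H.hasFDerivAt.comp z P.hasFDerivAt).clm_apply P.hasFDerivAt
  have h3' : (fun y ↦ G y (P y) (P y)) =ᶠ[𝓝 z] fun y ↦ H (P y) (P y) := by
    filter_upwards [hU.mem_nhds hz] with y hy using h y hy (P y)
  have h4' := congrArg (fun L ↦ L w) (h1'.unique (h2'.congr_of_eventuallyEq h3'))
  simp [hP, h z hz] at h4
  simp [hsymm z hz (P w), hH (P w), h z hz] at h4'
  linarith

end NormedSpace

/-! ### Coordinate systems -/

section CoordinateSystem

set_option maxSynthPendingDepth 3

variable {E F F' E' : Type*}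
  [NormedAddCommGroup E] [NormedSpace ℝ E]
  [NormedAddCommGroup F] [NormedSpace ℝ F]
  [NormedAddCommGroup F'] [NormedSpace ℝ F']
  [NormedAddCommGroup E'] [NormedSpace ℝ E']
  {M : Type*} [TopologicalSpace M] [ChartedSpace E M]
  {S : Type*} [TopologicalSpace S] [ChartedSpace E' S]

variable (E F) in
/-- The derivative of a map between manifolds, as a linear map between the model spaces. -/
def tangentMapAt {N : Type*} [TopologicalSpace N] [ChartedSpace F N] (f : M → N) (q : M) :
    E →L[ℝ] F :=
  mfderiv 𝓘(ℝ, E) 𝓘(ℝ, F) f q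

/-- The value of a field of bilinear forms, as a bilinear form on the model space. -/
def BilinField.at (g : BilinField E M) (q : M) : E →L[ℝ] E →L[ℝ] ℝ := g q

lemma tangentMapAt_comp {N P : Type*} [TopologicalSpace N] [ChartedSpace F N]
    [TopologicalSpace P] [ChartedSpace F' P] {f : M → N} {h : N → P} {q : M}
    (hh : MDifferentiableAt 𝓘(ℝ, F) 𝓘(ℝ, F') h (f q))
    (hf : MDifferentiableAt 𝓘(ℝ, E) 𝓘(ℝ, F) f q) (v : E) :
    tangentMapAt E F' (h ∘ f) q v = tangentMapAt F F' h (f q) (tangentMapAt E F f q v) := by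
  unfold tangentMapAt
  rw [mfderiv_comp q hh hf]
  rfl

lemma tangentMapAt_id (q : M) (v : E) : tangentMapAt E E (id : M → M) q v = v := by
  unfold tangentMapAt
  rw [mfderiv_id]
  rfl

lemma tangentMapAt_eq_fderiv (f : F → F') (z : F) : tangentMapAt F F' f z = fderiv ℝ f z :=
  mfderiv_eq_fderiv

lemma tangentMapAt_congr {N : Type*} [TopologicalSpace N] [ChartedSpace F N] {f h : M → N} {q : M}
    (hfh : f =ᶠ[𝓝 q] h) : tangentMapAt E F f q = tangentMapAt E F h q :=
  hfh.mfderiv_eq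

lemma metricInCoords_apply (g : BilinField E M) (φ : OpenPartialHomeomorph M F) (z v w : F) :
    metricInCoords g φ z v w =
      g.at (φ.symm z) (tangentMapAt F E φ.symm z v) (tangentMapAt F E φ.symm z w) :=
  rfl

lemma pullback_at (g : BilinField E M) (ι : S → M) (y : S) (v w : E') :
    (pullback ι g).at y v w =
      g.at (ι y) (tangentMapAt E' E ι y v) (tangentMapAt E' E ι y w) :=
  rfl

lemma isCoordinateSystem_chartAt [IsManifold 𝓘(ℝ, E) ∞ M] (q : M) :
    IsCoordinateSystem (E := E) (F := E) (chartAt E q) :=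
  ⟨contMDiffOn_chart, contMDiffOn_chart_symm⟩

/-- A tangent vector at `q` is stored as its components in the chart at `q`, so in the model space
that chart has the identity as derivative at its own base point. -/
lemma tangentMapAt_chartAt_self [IsManifold 𝓘(ℝ, E) ∞ M] (q : M) (v : E) :
    tangentMapAt E E (chartAt E q) q v = v := by
  have : IsManifold 𝓘(ℝ, E) 1 M := IsManifold.of_le (n := ∞) (by norm_cast)
  unfold tangentMapAt
  rw [mfderiv_chartAt_eq_tangentCoordChange (mem_chart_source E q)]
  exact tangentCoordChange_self (mem_extChartAt_source q)

namespace IsCoordinateSystem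

variable {φ : OpenPartialHomeomorph M F}

lemma contMDiffAt (hφ : IsCoordinateSystem (E := E) φ) {q : M} (hq : q ∈ φ.source) :
    ContMDiffAt 𝓘(ℝ, E) 𝓘(ℝ, F) ∞ φ q :=
  hφ.contMDiffOn.contMDiffAt (φ.open_source.mem_nhds hq)

lemma contMDiffAt_symm (hφ : IsCoordinateSystem (E := E) φ) {z : F} (hz : z ∈ φ.target) :
    ContMDiffAt 𝓘(ℝ, F) 𝓘(ℝ, E) ∞ φ.symm z :=
  hφ.contMDiffOn_symm.contMDiffAt (φ.open_target.mem_nhds hz)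

lemma mdifferentiableAt (hφ : IsCoordinateSystem (E := E) φ) {q : M} (hq : q ∈ φ.source) :
    MDifferentiableAt 𝓘(ℝ, E) 𝓘(ℝ, F) φ q :=
  (hφ.contMDiffAt hq).mdifferentiableAt (by simp)

lemma mdifferentiableAt_symm (hφ : IsCoordinateSystem (E := E) φ) {z : F} (hz : z ∈ φ.target) :
    MDifferentiableAt 𝓘(ℝ, F) 𝓘(ℝ, E) φ.symm z :=
  (hφ.contMDiffAt_symm hz).mdifferentiableAt (by simp)

lemma tangentMapAt_symm_right (hφ : IsCoordinateSystem (E := E) φ) {z : F} (hz : z ∈ φ.target)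
    (v : F) : tangentMapAt E F φ (φ.symm z) (tangentMapAt F E φ.symm z v) = v := by
  rw [← tangentMapAt_comp (hφ.mdifferentiableAt (φ.map_target hz)) (hφ.mdifferentiableAt_symm hz),
    tangentMapAt_congr (f := φ ∘ φ.symm) (h := id) (φ.eventually_right_inverse hz), tangentMapAt_id]

lemma tangentMapAt_symm_left (hφ : IsCoordinateSystem (E := E) φ) {q : M} (hq : q ∈ φ.source)
    (v : E) : tangentMapAt F E φ.symm (φ q) (tangentMapAt E F φ q v) = v := by
  rw [← tangentMapAt_comp (hφ.mdifferentiableAt_symm (φ.map_source hq)) (hφ.mdifferentiableAt hq),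
    tangentMapAt_congr (f := φ.symm ∘ φ) (h := id) (φ.eventually_left_inverse hq), tangentMapAt_id]

lemma tangentMapAt_injective (hφ : IsCoordinateSystem (E := E) φ) {q : M} (hq : q ∈ φ.source) :
    Function.Injective (tangentMapAt E F φ q) :=
  Function.LeftInverse.injective (hφ.tangentMapAt_symm_left hq)

lemma tangentMapAt_surjective (hφ : IsCoordinateSystem (E := E) φ) {q : M} (hq : q ∈ φ.source) :
    Function.Surjective (tangentMapAt E F φ q) := by
  obtain ⟨z, hz, rfl⟩ : ∃ z ∈ φ.target, φ.symm z = q := ⟨_, φ.map_source hq, φ.left_inv hq⟩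
  exact Function.RightInverse.surjective (hφ.tangentMapAt_symm_right hz)

lemma metricInCoords_tangentMapAt (hφ : IsCoordinateSystem (E := E) φ) (g : BilinField E M) {q : M}
    (hq : q ∈ φ.source) (v w : E) :
    metricInCoords g φ (φ q) (tangentMapAt E F φ q v) (tangentMapAt E F φ q w) = g.at q v w := by
  rw [metricInCoords_apply, hφ.tangentMapAt_symm_left hq, hφ.tangentMapAt_symm_left hq,
    φ.left_inv hq]

lemma metricInCoords_nondegenerate (hφ : IsCoordinateSystem (E := E) φ) {g : BilinField E M}
    (hg : IsNondegenerate g) {z : F} (hz : z ∈ φ.target) (v : F)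
    (hv : ∀ w, metricInCoords g φ z v w = 0) : v = 0 := by
  have h : tangentMapAt F E φ.symm z v = 0 := hg (φ.symm z) _ fun w ↦ by
    have := hv (tangentMapAt E F φ (φ.symm z) w)
    have hw := hφ.tangentMapAt_symm_left (φ.map_target hz) w
    rw [φ.right_inv hz] at hw
    rwa [metricInCoords_apply, hw] at this
  rw [← hφ.tangentMapAt_symm_right hz v, h, map_zero]

end IsCoordinateSystem

lemma metricInCoords_symm {φ : OpenPartialHomeomorph M F} {g : BilinField E M}
    (hg : ∀ q v w, g q v w = g q w v) (z v w : F) :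
    metricInCoords g φ z v w = metricInCoords g φ z w v :=
  hg _ _ _

/-! ### Pullback metrics read in coordinates. -/

section Pullback

variable {φ : OpenPartialHomeomorph M F} {ψ : OpenPartialHomeomorph S F'} {ι : S → M}

lemma contDiffAt_inCoords (hφ : IsCoordinateSystem (E := E) φ)
    (hψ : IsCoordinateSystem (E := E') ψ) {z : F'} (hz : z ∈ ψ.target)
    (hι : ContMDiffAt 𝓘(ℝ, E') 𝓘(ℝ, E) ∞ ι (ψ.symm z)) (hιz : ι (ψ.symm z) ∈ φ.source) :
    ContDiffAt ℝ ∞ (φ ∘ ι ∘ ψ.symm) z := by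
  rw [← contMDiffAt_iff_contDiffAt]
  exact (hφ.contMDiffAt hιz).comp z (hι.comp z (hψ.contMDiffAt_symm hz))

lemma fderiv_inCoords (hφ : IsCoordinateSystem (E := E) φ)
    (hψ : IsCoordinateSystem (E := E') ψ) {z : F'} (hz : z ∈ ψ.target)
    (hι : ContMDiffAt 𝓘(ℝ, E') 𝓘(ℝ, E) ∞ ι (ψ.symm z)) (hιz : ι (ψ.symm z) ∈ φ.source) (v : F') :
    fderiv ℝ (φ ∘ ι ∘ ψ.symm) z v = tangentMapAt E F φ (ι (ψ.symm z))
      (tangentMapAt E' E ι (ψ.symm z) (tangentMapAt F' E' ψ.symm z v)) := by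
  have hι' := hι.mdifferentiableAt (by simp)
  have hψ' := hψ.mdifferentiableAt_symm hz
  rw [← tangentMapAt_eq_fderiv,
    tangentMapAt_comp (f := ι ∘ ψ.symm) (h := φ) (hφ.mdifferentiableAt hιz) (hι'.comp z hψ'),
    tangentMapAt_comp hι' hψ']
  rfl

lemma fderiv_inCoords_tangentMapAt (hφ : IsCoordinateSystem (E := E) φ)
    (hψ : IsCoordinateSystem (E := E') ψ) {y : S} (hy : y ∈ ψ.source)
    (hι : ContMDiffAt 𝓘(ℝ, E') 𝓘(ℝ, E) ∞ ι y) (hιy : ι y ∈ φ.source) (v : E') :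
    fderiv ℝ (φ ∘ ι ∘ ψ.symm) (ψ y) (tangentMapAt E' F' ψ y v) =
      tangentMapAt E F φ (ι y) (tangentMapAt E' E ι y v) := by
  have hy' : ψ.symm (ψ y) = y := ψ.left_inv hy
  rw [fderiv_inCoords hφ hψ (ψ.map_source hy) (by rwa [hy']) (by rwa [hy']),
    hψ.tangentMapAt_symm_left hy, hy']

lemma metricInCoords_pullback (hφ : IsCoordinateSystem (E := E) φ)
    (hψ : IsCoordinateSystem (E := E') ψ) (g : BilinField E M) {z : F'} (hz : z ∈ ψ.target)
    (hι : ContMDiffAt 𝓘(ℝ, E') 𝓘(ℝ, E) ∞ ι (ψ.symm z)) (hιz : ι (ψ.symm z) ∈ φ.source) :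
    metricInCoords (E := E') (pullback ι g) ψ z =
      (metricInCoords g φ ((φ ∘ ι ∘ ψ.symm) z)).bilinearComp
        (fderiv ℝ (φ ∘ ι ∘ ψ.symm) z) (fderiv ℝ (φ ∘ ι ∘ ψ.symm) z) := by
  ext v w
  rw [ContinuousLinearMap.bilinearComp_apply, fderiv_inCoords hφ hψ hz hι hιz,
    fderiv_inCoords hφ hψ hz hι hιz, metricInCoords_apply, pullback_at]
  exact (hφ.metricInCoords_tangentMapAt g hιz _ _).symm

lemma metricInCoords_pullback_eventuallyEq (hφ : IsCoordinateSystem (E := E) φ)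
    (hψ : IsCoordinateSystem (E := E') ψ) (g : BilinField E M) {y : S} (hy : y ∈ ψ.source)
    (hι : ContMDiff 𝓘(ℝ, E') 𝓘(ℝ, E) ∞ ι) (hιy : ι y ∈ φ.source) :
    metricInCoords (E := E') (pullback ι g) ψ =ᶠ[𝓝 (ψ y)] fun z ↦
      (metricInCoords g φ ((φ ∘ ι ∘ ψ.symm) z)).bilinearComp
        (fderiv ℝ (φ ∘ ι ∘ ψ.symm) z) (fderiv ℝ (φ ∘ ι ∘ ψ.symm) z) := by
  have h1 : ∀ᶠ z in 𝓝 (ψ y), z ∈ ψ.target := ψ.open_target.mem_nhds (ψ.map_source hy)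
  have h2 : ∀ᶠ z in 𝓝 (ψ y), ι (ψ.symm z) ∈ φ.source := by
    have hc : ContinuousAt (fun z ↦ ι (ψ.symm z)) (ψ y) :=
      hι.continuous.continuousAt.comp (ψ.continuousAt_symm (ψ.map_source hy))
    refine hc.eventually_mem ?_
    rw [ψ.left_inv hy]
    exact φ.open_source.mem_nhds hιy
  filter_upwards [h1, h2] with z hz hz'
  exact metricInCoords_pullback hφ hψ g hz hι.contMDiffAt hz'

end Pullback

/-- Makes a change of coordinates the case ι = id of the pullback formulas, so one computation
serves both transition maps and the induced metric. -/
lemma pullback_id (g : BilinField E M) : pullback (E' := E) id g = g := by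
  funext q
  refine ContinuousLinearMap.ext fun v ↦ ContinuousLinearMap.ext fun w ↦ ?_
  change g.at q (tangentMapAt E E id q v) (tangentMapAt E E id q w) = g.at q v w
  exact congrArg₂ (fun a b ↦ g.at q a b) (tangentMapAt_id (E := E) q v)
    (tangentMapAt_id (E := E) q w)

/-- Through a basis of `F`, the space of linear maps is a finite product of copies of `F'`, so
smoothness can be tested on vectors. -/
lemma contDiffAt_clm_of_apply [FiniteDimensional ℝ F] {n : WithTop ℕ∞} {f : E → F →L[ℝ] F'}
    {x : E}
    (h : ∀ y, ContDiffAt ℝ n (fun x ↦ f x y) x) : ContDiffAt ℝ n f x := by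
  let e₁ := ContinuousLinearEquiv.ofFinrankEq
    (Module.finrank_fin_fun ℝ (n := Module.finrank ℝ F)).symm
  let e₂ := (e₁.arrowCongr (1 : F' ≃L[ℝ] F')).trans
    (ContinuousLinearEquiv.piRing (Fin (Module.finrank ℝ F)))
  rw [← Function.id_comp f, ← e₂.symm_comp_self]
  exact e₂.symm.contDiff.contDiffAt.comp x (contDiffAt_pi.2 fun i ↦ h _)

lemma contDiffAt_bilinearComp_fderiv [FiniteDimensional ℝ F']
    {G : F → F →L[ℝ] F →L[ℝ] ℝ} {f : F' → F} {z : F'}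
    (hG : ContDiffAt ℝ ∞ G (f z)) (hf : ContDiffAt ℝ ∞ f z) :
    ContDiffAt ℝ ∞ (fun y ↦ (G (f y)).bilinearComp (fderiv ℝ f y) (fderiv ℝ f y)) z := by
  have hdf : ContDiffAt ℝ ∞ (fderiv ℝ f) z := hf.fderiv_right (by norm_cast)
  have hGf : ContDiffAt ℝ ∞ (fun y ↦ G (f y)) z := hG.comp z hf
  have hconst : ∀ v : F', ContDiffAt ℝ ∞ (fun y ↦ fderiv ℝ f y v) z :=
    fun v ↦ hdf.clm_apply contDiffAt_const
  have key : ∀ v w : F', ContDiffAt ℝ ∞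
      (fun y ↦ (G (f y)).bilinearComp (fderiv ℝ f y) (fderiv ℝ f y) v w) z :=
    fun v w ↦ (hGf.clm_apply (hconst v)).clm_apply (hconst w)
  exact contDiffAt_clm_of_apply fun v ↦ contDiffAt_clm_of_apply fun w ↦ key v w

/-- The properties of a pseudo-Riemannian metric, read in charts. -/
structure IsRegularMetric (g : BilinField E M) : Prop where
  symm : ∀ q v w, g q v w = g q w v
  nondegenerate : IsNondegenerate g
  contDiffAt_chartAt : ∀ q, ContDiffAt ℝ ∞ (metricInCoords (F := E) g (chartAt E q)) (chartAt E q q)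

/-- Near the point, the metric in `φ` is the pullback of the metric in a preferred chart under the
smooth transition map. -/
lemma IsRegularMetric.contDiffAt [IsManifold 𝓘(ℝ, E) ∞ M] [FiniteDimensional ℝ F]
    {g : BilinField E M} (hg : IsRegularMetric g) {φ : OpenPartialHomeomorph M F}
    (hφ : IsCoordinateSystem (E := E) φ) {z : F} (hz : z ∈ φ.target) :
    ContDiffAt ℝ ∞ (metricInCoords g φ) z := by
  obtain ⟨q, hq, rfl⟩ : ∃ q ∈ φ.source, φ q = z := ⟨_, φ.map_target hz, φ.right_inv hz⟩
  have hc := isCoordinateSystem_chartAt (E := E) q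
  have h := metricInCoords_pullback_eventuallyEq hc hφ g hq (ι := id) contMDiff_id
    (mem_chart_source E q)
  rw [pullback_id] at h
  refine (contDiffAt_bilinearComp_fderiv (f := chartAt E q ∘ id ∘ φ.symm) ?_
    (contDiffAt_inCoords hc hφ hz contMDiffAt_id ?_)).congr_of_eventuallyEq h
  · simpa [φ.left_inv hq] using hg.contDiffAt_chartAt q
  · simp [φ.left_inv hq]

/-- Smoothness formulated in charts passes directly to the induced metric through its coordinate
expression, without treating it as a section of a bundle. -/
lemma IsRegularMetric.pullback [IsManifold 𝓘(ℝ, E) ∞ M] [IsManifold 𝓘(ℝ, E') ∞ S]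
    [FiniteDimensional ℝ E] [FiniteDimensional ℝ E'] {g : BilinField E M} (hg : IsRegularMetric g)
    {ι : S → M} (hι : ContMDiff 𝓘(ℝ, E') 𝓘(ℝ, E) ∞ ι)
    (hnd : IsNondegenerate (pullback ι g : BilinField E' S)) :
    IsRegularMetric (SubmanifoldNormal.pullback ι g : BilinField E' S) where
  symm y v w := hg.symm _ _ _
  nondegenerate := hnd
  contDiffAt_chartAt y := by
    have hy := mem_chart_source E' y
    have hc := isCoordinateSystem_chartAt (E := E) (ι y)
    have hc' := isCoordinateSystem_chartAt (E := E') y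
    refine (contDiffAt_bilinearComp_fderiv (f := chartAt E (ι y) ∘ ι ∘ (chartAt E' y).symm) ?_
      (contDiffAt_inCoords hc hc' ((chartAt E' y).map_source hy) hι.contMDiffAt
        ?_)).congr_of_eventuallyEq
      (metricInCoords_pullback_eventuallyEq hc hc' g hy hι (mem_chart_source E _))
    · simpa using hg.contDiffAt_chartAt (ι y)
    · simp

/-- The field `z ↦ df z a` along `f` is smooth. -/
lemma contMDiffOn_tangentMapAt [IsManifold 𝓘(ℝ, E) ∞ M] {f : F → M} {s : Set F} (hs : IsOpen s)
    (hf : ContMDiffOn 𝓘(ℝ, F) 𝓘(ℝ, E) ∞ f s) (a : F) :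
    ContMDiffOn 𝓘(ℝ, F) 𝓘(ℝ, E).tangent ∞
      (fun z ↦ (⟨f z, tangentMapAt F E f z a⟩ : TangentBundle 𝓘(ℝ, E) M)) s := by
  have : IsManifold 𝓘(ℝ, E) 1 M := IsManifold.of_le (n := ∞) (by norm_cast)
  have h1 := hf.contMDiffOn_tangentMapWithin (m := ∞) (by norm_cast) hs.uniqueMDiffOn
  have h2 : ContMDiffOn 𝓘(ℝ, F) 𝓘(ℝ, F).tangent ∞
      (fun z ↦ (⟨z, a⟩ : TangentBundle 𝓘(ℝ, F) F)) s := by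
    exact contMDiffOn_vectorSpace_iff_contDiffOn.2 contDiffOn_const
  have h3 := h1.comp h2 fun z hz ↦ hz
  refine h3.congr fun z hz ↦ ?_
  simp only [Function.comp_apply, tangentMapWithin, mfderivWithin_of_isOpen hs hz]
  rfl

lemma IsPseudoRiemannianMetric.contDiffAt_apply [IsManifold 𝓘(ℝ, E) ∞ M]
    {g : BilinField E M} (hg : IsPseudoRiemannianMetric g) {b : F → M}
    {v w : (z : F) → TangentSpace 𝓘(ℝ, E) (b z)} {z : F} (hb : ContMDiffAt 𝓘(ℝ, F) 𝓘(ℝ, E) ∞ b z)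
    (hv : ContMDiffAt 𝓘(ℝ, F) 𝓘(ℝ, E).tangent ∞
      (fun z ↦ (⟨b z, v z⟩ : TangentBundle 𝓘(ℝ, E) M)) z)
    (hw : ContMDiffAt 𝓘(ℝ, F) 𝓘(ℝ, E).tangent ∞
      (fun z ↦ (⟨b z, w z⟩ : TangentBundle 𝓘(ℝ, E) M)) z) :
    ContDiffAt ℝ ∞ (fun z ↦ g (b z) (v z) (w z)) z := by
  have : IsManifold 𝓘(ℝ, E) 1 M := IsManifold.of_le (n := ∞) (by norm_cast)
  have h : ContMDiffAt 𝓘(ℝ, F) (𝓘(ℝ, E).prod 𝓘(ℝ)) ∞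
      (fun z ↦ Bundle.TotalSpace.mk' ℝ (E := Bundle.Trivial M ℝ) (b z) (g (b z) (v z) (w z)))
      z := by
    apply ContMDiffAt.clm_bundle_apply₂ (F₁ := E) (F₂ := E)
    · exact hg.contMDiff.contMDiffAt.comp z hb
    · exact hv
    · exact hw
  rw [Bundle.contMDiffAt_totalSpace] at h
  exact contMDiffAt_iff_contDiffAt.1 h.2

lemma IsPseudoRiemannianMetric.isRegularMetric [IsManifold 𝓘(ℝ, E) ∞ M] [FiniteDimensional ℝ E]
    {g : BilinField E M} (hg : IsPseudoRiemannianMetric g) : IsRegularMetric g where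
  symm := hg.symm
  nondegenerate := hg.nondegenerate
  contDiffAt_chartAt q := by
    have : IsManifold 𝓘(ℝ, E) 1 M := IsManifold.of_le (n := ∞) (by norm_cast)
    set φ := chartAt E q
    have hφ : IsCoordinateSystem (E := E) φ := isCoordinateSystem_chartAt q
    have hq : φ q ∈ φ.target := φ.map_source (mem_chart_source E q)
    have hs := φ.open_target.mem_nhds hq
    have key : ∀ v w : E, ContDiffAt ℝ ∞ (fun z ↦ metricInCoords g φ z v w) (φ q) := by
      intro v w
      have hv := (contMDiffOn_tangentMapAt φ.open_target hφ.contMDiffOn_symm v).contMDiffAt hs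
      have hw := (contMDiffOn_tangentMapAt φ.open_target hφ.contMDiffOn_symm w).contMDiffAt hs
      exact hg.contDiffAt_apply (hφ.contMDiffAt_symm hq) hv hw
    exact contDiffAt_clm_of_apply fun v ↦ contDiffAt_clm_of_apply fun w ↦ key v w

end CoordinateSystem

/-! ### Covariant derivatives and geodesics in coordinates -/

section Geodesic

set_option maxSynthPendingDepth 3

variable {E F F' : Type*}
  [NormedAddCommGroup E] [NormedSpace ℝ E]
  [NormedAddCommGroup F] [NormedSpace ℝ F]
  [NormedAddCommGroup F'] [NormedSpace ℝ F']
  {M : Type*} [TopologicalSpace M] [ChartedSpace E M]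

lemma covDerivInCoords_def (g : BilinField E M) (φ : OpenPartialHomeomorph M F) (c : ℝ → M)
    (V : ℝ → E) (t : ℝ) :
    covDerivInCoords g φ c V t = deriv (fun s ↦ tangentMapAt E F φ (c s) (V s)) t +
      christoffel (metricInCoords g φ) (φ (c t)) (deriv (fun s ↦ φ (c s)) t)
        (tangentMapAt E F φ (c t) (V t)) :=
  rfl

/-- The product rule applied to df(V) creates the term D²f(dc/dt, V), which is exactly the
inhomogeneous term in the transformation law `fderiv_christoffel`. -/
lemma covDerivInCoords_transition [FiniteDimensional ℝ F] [FiniteDimensional ℝ F']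
    [IsManifold 𝓘(ℝ, E) ∞ M] {g : BilinField E M}
    (hg : IsRegularMetric g) {φ : OpenPartialHomeomorph M F} {ψ : OpenPartialHomeomorph M F'}
    (hφ : IsCoordinateSystem (E := E) φ) (hψ : IsCoordinateSystem (E := E) ψ)
    {c : ℝ → M} {V : ℝ → E} {t : ℝ} (hq : c t ∈ φ.source) (hq' : c t ∈ ψ.source)
    (hc : MDifferentiableAt 𝓘(ℝ, ℝ) 𝓘(ℝ, E) c t)
    (hV : DifferentiableAt ℝ (fun s ↦ tangentMapAt E F' ψ (c s) (V s)) t) :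
    covDerivInCoords g φ c V t =
      fderiv ℝ (φ ∘ id ∘ ψ.symm) (ψ (c t)) (covDerivInCoords g ψ c V t) := by
  -- The `id` gives the transition map the shape φ ∘ ι ∘ ψ.symm expected by the pullback formulas.
  set f := φ ∘ id ∘ ψ.symm with hf_def
  have hx : DifferentiableAt ℝ (fun s ↦ ψ (c s)) t :=
    ((hψ.mdifferentiableAt hq').comp t hc).differentiableAt
  have htar : ψ (c t) ∈ ψ.target := ψ.map_source hq'
  have hleft : ψ.symm (ψ (c t)) = c t := ψ.left_inv hq'
  have hf : ContDiffAt ℝ ∞ f (ψ (c t)) :=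
    contDiffAt_inCoords hφ hψ htar contMDiffAt_id (by simpa [hleft] using hq)
  have hev : ∀ᶠ s in 𝓝 t, c s ∈ φ.source ∧ c s ∈ ψ.source :=
    hc.continuousAt.eventually_mem
      ((φ.open_source.inter ψ.open_source).mem_nhds ⟨hq, hq'⟩)
  have hD : ∀ q ∈ φ.source ∩ ψ.source, ∀ v : E,
      tangentMapAt E F φ q v = fderiv ℝ f (ψ q) (tangentMapAt E F' ψ q v) := by
    intro q hqs v
    rw [fderiv_inCoords_tangentMapAt hφ hψ hqs.2 contMDiffAt_id hqs.1]
    exact congrArg _ (tangentMapAt_id (E := E) q v).symm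
  have h1 : (fun s ↦ φ (c s)) =ᶠ[𝓝 t] fun s ↦ f (ψ (c s)) := by
    filter_upwards [hev] with s hs
    simp [hf_def, ψ.left_inv hs.2]
  have h2 : (fun s ↦ tangentMapAt E F φ (c s) (V s)) =ᶠ[𝓝 t]
      fun s ↦ fderiv ℝ f (ψ (c s)) (tangentMapAt E F' ψ (c s) (V s)) := by
    filter_upwards [hev] with s hs using hD _ hs _
  have hdf : HasFDerivAt f (fderiv ℝ f (ψ (c t))) (ψ (c t)) :=
    (hf.differentiableAt (by simp)).hasFDerivAt
  have hddf : HasFDerivAt (fderiv ℝ f) (fderiv ℝ (fderiv ℝ f) (ψ (c t))) (ψ (c t)) :=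
    ((hf.fderiv_right (m := 1) (by norm_cast)).differentiableAt (by simp)).hasFDerivAt
  have h1' : HasDerivAt (fun s ↦ f (ψ (c s)))
      (fderiv ℝ f (ψ (c t)) (deriv (fun s ↦ ψ (c s)) t)) t :=
    hdf.comp_hasDerivAt t hx.hasDerivAt
  have h2' : HasDerivAt (fun s ↦ fderiv ℝ f (ψ (c s)))
      (fderiv ℝ (fderiv ℝ f) (ψ (c t)) (deriv (fun s ↦ ψ (c s)) t)) t :=
    hddf.comp_hasDerivAt t hx.hasDerivAt
  have hmet := metricInCoords_pullback_eventuallyEq hφ hψ g hq' (ι := id) contMDiff_id hq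
  rw [pullback_id] at hmet
  have hft : f (ψ (c t)) = φ (c t) := h1.self_of_nhds.symm
  have hGφ : ContDiffAt ℝ ∞ (metricInCoords g φ) (f (ψ (c t))) :=
    hft ▸ hg.contDiffAt hφ (φ.map_source hq)
  have hchr := fderiv_christoffel (f := f) hf (hGφ.differentiableAt (by simp))
    ((hg.contDiffAt hψ htar).differentiableAt (by simp)) hmet
    (fun a b ↦ metricInCoords_symm hg.symm _ a b)
    (hft ▸ hφ.metricInCoords_nondegenerate hg.nondegenerate (φ.map_source hq))
    (hψ.metricInCoords_nondegenerate hg.nondegenerate htar)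
    (fun w ↦ by
      obtain ⟨v, rfl⟩ := hφ.tangentMapAt_surjective hq w
      exact ⟨_, (hD _ ⟨hq, hq'⟩ v).symm⟩)
    (deriv (fun s ↦ ψ (c s)) t) (tangentMapAt E F' ψ (c t) (V t))
  rw [covDerivInCoords_def, covDerivInCoords_def, h2.deriv_eq, h1.deriv_eq, h1'.deriv,
    (h2'.clm_apply hV.hasDerivAt).deriv, map_add, hchr, hft, hD _ ⟨hq, hq'⟩]
  abel

/-- Chart independence: `covDerivAlong` is computed in the chart at `c t`, where the derivative of
that chart is the identity, and the transition law carries the result to any coordinates. -/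
lemma tangentMapAt_covDerivAlong [FiniteDimensional ℝ E] [FiniteDimensional ℝ F]
    [IsManifold 𝓘(ℝ, E) ∞ M] {g : BilinField E M}
    (hg : IsRegularMetric g) {φ : OpenPartialHomeomorph M F} (hφ : IsCoordinateSystem (E := E) φ)
    {c : ℝ → M} {V : ℝ → E} {t : ℝ} (hq : c t ∈ φ.source)
    (hc : MDifferentiableAt 𝓘(ℝ, ℝ) 𝓘(ℝ, E) c t)
    (hV : DifferentiableAt ℝ (fun s ↦ tangentMapAt E F φ (c s) (V s)) t) :
    tangentMapAt E F φ (c t) (covDerivAlong g c V t) = covDerivInCoords g φ c V t := by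
  obtain ⟨v, hv⟩ := hφ.tangentMapAt_surjective hq (covDerivInCoords g φ c V t)
  have hc' := isCoordinateSystem_chartAt (E := E) (c t)
  have hs := mem_chart_source E (c t)
  have h := covDerivInCoords_transition hg hc' hφ hs hq hc hV
  rw [← hv, fderiv_inCoords_tangentMapAt hc' hφ hq contMDiffAt_id hs] at h
  have h1 : tangentMapAt E E (chartAt E (c t)) (c t) (tangentMapAt E E id (c t) v) = v := by
    rw [tangentMapAt_id]
    exact tangentMapAt_chartAt_self _ _
  have h2 : covDerivAlong g c V t = v := h.trans h1
  rw [h2, hv]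

lemma tangentMapAt_velocity {φ : OpenPartialHomeomorph M F} (hφ : IsCoordinateSystem (E := E) φ)
    {c : ℝ → M} {t : ℝ} (hq : c t ∈ φ.source) (hc : MDifferentiableAt 𝓘(ℝ, ℝ) 𝓘(ℝ, E) c t) :
    tangentMapAt E F φ (c t) (velocity (E := E) c t) = deriv (fun s ↦ φ (c s)) t := by
  have h := tangentMapAt_comp (hφ.mdifferentiableAt hq) hc (1 : ℝ)
  rw [tangentMapAt_eq_fderiv, fderiv_apply_one_eq_deriv] at h
  exact h.symm

lemma contDiffAt_curve {φ : OpenPartialHomeomorph M F} (hφ : IsCoordinateSystem (E := E) φ)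
    {c : ℝ → M} {t : ℝ} (hq : c t ∈ φ.source) (hc : ContMDiffAt 𝓘(ℝ, ℝ) 𝓘(ℝ, E) ∞ c t) :
    ContDiffAt ℝ ∞ (fun s ↦ φ (c s)) t :=
  contMDiffAt_iff_contDiffAt.1 ((hφ.contMDiffAt hq).comp t hc)

lemma differentiableAt_deriv {x : ℝ → F} {t : ℝ} (hx : ContDiffAt ℝ ∞ x t) :
    DifferentiableAt ℝ (deriv x) t :=
  ((hx.fderiv_right (m := 1) (by norm_cast)).clm_apply
    (contDiffAt_const (c := (1 : ℝ)))).differentiableAt (by simp)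

lemma covDerivAlong_velocity_eq_zero_iff [FiniteDimensional ℝ E] [FiniteDimensional ℝ F]
    [IsManifold 𝓘(ℝ, E) ∞ M] {g : BilinField E M}
    (hg : IsRegularMetric g) {φ : OpenPartialHomeomorph M F} (hφ : IsCoordinateSystem (E := E) φ)
    {c : ℝ → M} {s : Set ℝ} (hs : IsOpen s) (hc : ContMDiffOn 𝓘(ℝ, ℝ) 𝓘(ℝ, E) ∞ c s) {t : ℝ}
    (ht : t ∈ s) (hq : c t ∈ φ.source) :
    covDerivAlong g c (velocity c) t = 0 ↔
      deriv (deriv (fun s ↦ φ (c s))) t + christoffel (metricInCoords g φ) (φ (c t))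
        (deriv (fun s ↦ φ (c s)) t) (deriv (fun s ↦ φ (c s)) t) = 0 := by
  have hct : ∀ r ∈ s, ContMDiffAt 𝓘(ℝ, ℝ) 𝓘(ℝ, E) ∞ c r :=
    fun r hr ↦ hc.contMDiffAt (hs.mem_nhds hr)
  have hctd : ∀ r ∈ s, MDifferentiableAt 𝓘(ℝ, ℝ) 𝓘(ℝ, E) c r :=
    fun r hr ↦ (hct r hr).mdifferentiableAt (by simp)
  have hev : (fun r ↦ tangentMapAt E F φ (c r) (velocity (E := E) c r)) =ᶠ[𝓝 t]
      deriv (fun s ↦ φ (c s)) := by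
    filter_upwards [hs.mem_nhds ht,
      (hct t ht).continuousAt.eventually_mem (φ.open_source.mem_nhds hq)] with r hr hr'
    exact tangentMapAt_velocity hφ hr' (hctd r hr)
  have hx : ContDiffAt ℝ ∞ (fun s ↦ φ (c s)) t := contDiffAt_curve hφ hq (hct t ht)
  have hx' : DifferentiableAt ℝ (deriv (fun s ↦ φ (c s))) t :=
    differentiableAt_deriv hx
  have h := (tangentMapAt_covDerivAlong hg hφ (V := velocity c) hq (hctd t ht)
    (hx'.congr_of_eventuallyEq hev)).trans (covDerivInCoords_def g φ c (velocity c) t)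
  rw [hev.deriv_eq, tangentMapAt_velocity hφ hq (hctd t ht)] at h
  rw [← h]
  exact (map_eq_zero_iff _ (hφ.tangentMapAt_injective hq)).symm

/-- Geodesics that agree to first order at some time agree nearby. -/
lemma eventuallyEq_of_isGeodesicOn [FiniteDimensional ℝ E] [FiniteDimensional ℝ F]
    [IsManifold 𝓘(ℝ, E) ∞ M] {g : BilinField E M}
    (hg : IsRegularMetric g) {φ : OpenPartialHomeomorph M F} (hφ : IsCoordinateSystem (E := E) φ)
    {c₁ c₂ : ℝ → M} {s : Set ℝ} (hs : IsOpen s) (h₁ : IsGeodesicOn g c₁ s)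
    (h₂ : IsGeodesicOn g c₂ s) {t : ℝ} (ht : t ∈ s) (hq : c₁ t ∈ φ.source) (h0 : c₁ t = c₂ t)
    (h0' : deriv (fun s ↦ φ (c₁ s)) t = deriv (fun s ↦ φ (c₂ s)) t) : c₁ =ᶠ[𝓝 t] c₂ := by
  -- The geodesic equation as a first-order system for position and velocity; the field is C¹, hence
  -- locally Lipschitz.
  let X : F × F → F × F := fun y ↦ (y.2, -christoffel (metricInCoords g φ) y.1 y.2 y.2)
  have htar : φ (c₁ t) ∈ φ.target := φ.map_source hq
  have hX : ContDiffAt ℝ 1 X (φ (c₁ t), deriv (fun s ↦ φ (c₁ s)) t) :=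
    contDiffAt_snd.prodMk (contDiffAt_christoffel
      (hφ.metricInCoords_nondegenerate hg.nondegenerate htar) (hg.contDiffAt hφ htar)).neg
  obtain ⟨K, U, hU, hK⟩ := hX.exists_lipschitzOnWith
  have key : ∀ c : ℝ → M, IsGeodesicOn g c s → c t ∈ φ.source →
      (φ (c t), deriv (fun s ↦ φ (c s)) t) = (φ (c₁ t), deriv (fun s ↦ φ (c₁ s)) t) →
      ∀ᶠ r in 𝓝 t, HasDerivAt (fun r ↦ (φ (c r), deriv (fun s ↦ φ (c s)) r))
        (X (φ (c r), deriv (fun s ↦ φ (c s)) r)) r ∧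
        (φ (c r), deriv (fun s ↦ φ (c s)) r) ∈ U := by
    intro c hc hcq hct
    have hcs : ∀ r ∈ s, ContMDiffAt 𝓘(ℝ, ℝ) 𝓘(ℝ, E) ∞ c r :=
      fun r hr ↦ hc.1.contMDiffAt (hs.mem_nhds hr)
    have hd : ∀ r ∈ s, c r ∈ φ.source →
        HasDerivAt (fun r ↦ (φ (c r), deriv (fun s ↦ φ (c s)) r))
          (X (φ (c r), deriv (fun s ↦ φ (c s)) r)) r := by
      intro r hr hrq
      have hx : ContDiffAt ℝ ∞ (fun s ↦ φ (c s)) r := contDiffAt_curve hφ hrq (hcs r hr)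
      have hx' : DifferentiableAt ℝ (deriv (fun s ↦ φ (c s))) r :=
        differentiableAt_deriv hx
      have h := (covDerivAlong_velocity_eq_zero_iff hg hφ hs hc.1 hr hrq).1 (hc.2 r hr)
      have h' := (hx.differentiableAt (by simp)).hasDerivAt.prodMk hx'.hasDerivAt
      rwa [eq_neg_of_add_eq_zero_left h] at h'
    filter_upwards [hs.mem_nhds ht,
      (hcs t ht).continuousAt.eventually_mem (φ.open_source.mem_nhds hcq),
      (hd t ht hcq).continuousAt.eventually_mem (by rwa [hct])] with r hr hr' hr''
    exact ⟨hd r hr hr', hr''⟩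
  have heq := ODE_solution_unique_of_eventually (v := fun _ ↦ X) (s := fun _ ↦ U)
    (.of_forall fun _ ↦ hK) (key c₁ h₁ hq rfl) (key c₂ h₂ (h0 ▸ hq) (by rw [h0, h0']))
    (by rw [h0, h0'])
  have hcont : ∀ c : ℝ → M, IsGeodesicOn g c s → c t ∈ φ.source → ∀ᶠ r in 𝓝 t, c r ∈ φ.source :=
    fun c hc hcq ↦ (hc.1.contMDiffAt (hs.mem_nhds ht)).continuousAt.eventually_mem
      (φ.open_source.mem_nhds hcq)
  filter_upwards [heq, hcont c₁ h₁ hq, hcont c₂ h₂ (h0 ▸ hq)] with r hr hr₁ hr₂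
  exact φ.injOn hr₁ hr₂ (congrArg Prod.fst hr)

lemma deriv_eq_of_velocity_eq {φ : OpenPartialHomeomorph M F}
    (hφ : IsCoordinateSystem (E := E) φ) {c : ℝ → M} {t : ℝ} {q : M} {v : TangentSpace 𝓘(ℝ, E) q}
    (hq : q ∈ φ.source) (hc : MDifferentiableAt 𝓘(ℝ, ℝ) 𝓘(ℝ, E) c t)
    (h : (⟨c t, velocity c t⟩ : TangentBundle 𝓘(ℝ, E) M) = ⟨q, v⟩) :
    deriv (fun s ↦ φ (c s)) t = tangentMapAt E F φ q v := by
  have h1 : c t = q := congrArg (fun p ↦ p.1) h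
  rw [← tangentMapAt_velocity hφ (h1 ▸ hq) hc]
  exact congrArg (fun p : TangentBundle 𝓘(ℝ, E) M ↦ tangentMapAt E F φ p.1 p.2) h

/-- Uniqueness of geodesics with a given initial velocity. -/
lemma eqOn_of_isGeodesicOn [FiniteDimensional ℝ E] [T2Space M] [IsManifold 𝓘(ℝ, E) ∞ M]
    {g : BilinField E M} (hg : IsRegularMetric g) {c₁ c₂ : ℝ → M} {s : Set ℝ} (hs : IsOpen s)
    (hs' : IsPreconnected s)
    (h₁ : IsGeodesicOn g c₁ s) (h₂ : IsGeodesicOn g c₂ s) {t : ℝ} (ht : t ∈ s)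
    (h0 : (⟨c₁ t, velocity c₁ t⟩ : TangentBundle 𝓘(ℝ, E) M) = ⟨c₂ t, velocity c₂ t⟩) :
    EqOn c₁ c₂ s := by
  have hsm : ∀ c : ℝ → M, IsGeodesicOn g c s → ∀ r ∈ s, ContMDiffAt 𝓘(ℝ, ℝ) 𝓘(ℝ, E) ∞ c r :=
    fun c hc r hr ↦ hc.1.contMDiffAt (hs.mem_nhds hr)
  -- Connectedness argument. The set of local agreement is open. At a limit point in `s` the two
  -- curves agree in position, because `M` is Hausdorff, and in velocity, by continuity; local
  -- uniqueness then applies there.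
  have hsub : s ⊆ {r | c₁ =ᶠ[𝓝 r] c₂} := by
    refine hs'.subset_of_closure_inter_subset isOpen_setOfPred_eventually_nhds ⟨t, ht, ?_⟩ ?_
    · have hchart := isCoordinateSystem_chartAt (E := E) (c₁ t)
      have heq : c₁ t = c₂ t := congrArg (fun p ↦ p.1) h0
      have hmem := mem_chart_source E (c₁ t)
      refine eventuallyEq_of_isGeodesicOn hg hchart hs h₁ h₂ ht hmem heq ?_
      rw [deriv_eq_of_velocity_eq hchart hmem
          ((hsm c₂ h₂ t ht).mdifferentiableAt (by simp)) h0.symm,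
        deriv_eq_of_velocity_eq hchart hmem
          ((hsm c₁ h₁ t ht).mdifferentiableAt (by simp)) rfl]
    · rintro r ⟨hr, hrs⟩
      have hfr : ∃ᶠ r' in 𝓝 r, c₁ =ᶠ[𝓝 r'] c₂ := mem_closure_iff_frequently.1 hr
      have heq : c₁ r = c₂ r := tendsto_nhds_unique_of_frequently_eq
        (hsm c₁ h₁ r hrs).continuousAt (hsm c₂ h₂ r hrs).continuousAt
        (hfr.mono fun r' hr' ↦ hr'.self_of_nhds)
      have hchart := isCoordinateSystem_chartAt (E := E) (c₁ r)
      have hmem := mem_chart_source E (c₁ r)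
      refine eventuallyEq_of_isGeodesicOn hg hchart hs h₁ h₂ hrs hmem heq ?_
      have hcont : ∀ c : ℝ → M, IsGeodesicOn g c s → c r ∈ (chartAt E (c₁ r)).source →
          ContinuousAt (deriv (fun s ↦ chartAt E (c₁ r) (c s))) r := fun c hc hcr ↦
        (differentiableAt_deriv (contDiffAt_curve hchart hcr (hsm c hc r hrs))).continuousAt
      refine tendsto_nhds_unique_of_frequently_eq (hcont c₁ h₁ hmem) (hcont c₂ h₂ (heq ▸ hmem))
        (hfr.mono fun r' hr' ↦ ?_)
      exact (hr'.fun_comp (chartAt E (c₁ r))).deriv_eq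
  exact fun r hr ↦ (hsub hr).self_of_nhds

lemma IsRegularMetric.isGeodesicOn [FiniteDimensional ℝ E] [FiniteDimensional ℝ F]
    [IsManifold 𝓘(ℝ, E) ∞ M] {g : BilinField E M} (hg : IsRegularMetric g)
    {φ : OpenPartialHomeomorph M F} (hφ : IsCoordinateSystem (E := E) φ) {z w : F} {s : Set ℝ}
    (hs : IsOpen s) (htar : ∀ t ∈ s, z + t • w ∈ φ.target)
    (hΓ : ∀ t ∈ s, christoffel (metricInCoords g φ) (z + t • w) w w = 0) :
    IsGeodesicOn g (fun t ↦ φ.symm (z + t • w)) s := by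
  have hsm : ContMDiffOn 𝓘(ℝ, ℝ) 𝓘(ℝ, E) ∞ (fun t : ℝ ↦ φ.symm (z + t • w)) s := by
    refine hφ.contMDiffOn_symm.comp (t := φ.target) (ContMDiff.contMDiffOn ?_) htar
    rw [contMDiff_iff_contDiff]
    fun_prop
  refine ⟨hsm, fun t ht ↦ ?_⟩
  rw [covDerivAlong_velocity_eq_zero_iff hg hφ hs hsm ht (φ.map_target (htar t ht))]
  have hev : (fun t : ℝ ↦ φ (φ.symm (z + t • w))) =ᶠ[𝓝 t] fun t ↦ z + t • w := by
    filter_upwards [hs.mem_nhds ht] with r hr using φ.right_inv (htar r hr)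
  have hd : deriv (fun t : ℝ ↦ z + t • w) = fun _ ↦ w := by
    funext r
    simpa using (((hasDerivAt_id r).smul_const w).const_add z).deriv
  rw [hev.deriv.deriv_eq, hev.deriv_eq, hd, φ.right_inv (htar t ht), hΓ t ht]
  simp

/-- A line in coordinates that satisfies the geodesic equation gives the exponential map. -/
lemma IsRegularMetric.isGeodesicFrom [FiniteDimensional ℝ E] [FiniteDimensional ℝ F]
    [IsManifold 𝓘(ℝ, E) ∞ M] {g : BilinField E M} (hg : IsRegularMetric g)
    {φ : OpenPartialHomeomorph M F} (hφ : IsCoordinateSystem (E := E) φ) {z w : F} {q : M}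
    (hq : q ∈ φ.source) (hz : φ q = z) {v : TangentSpace 𝓘(ℝ, E) q}
    (hv : tangentMapAt E F φ q v = w) (htar : ∀ t ∈ Ioo (-1 : ℝ) 2, z + t • w ∈ φ.target)
    (hΓ : ∀ t ∈ Ioo (-1 : ℝ) 2, christoffel (metricInCoords g φ) (z + t • w) w w = 0) :
    IsGeodesicFrom g q v (fun t ↦ φ.symm (z + t • w)) := by
  have hgeo := hg.isGeodesicOn hφ isOpen_Ioo htar hΓ
  refine ⟨⟨1, one_pos, ?_⟩, ?_⟩
  · rwa [show (1 : ℝ) + 1 = 2 by norm_num]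
  · set c : ℝ → M := fun t ↦ φ.symm (z + t • w) with hc
    have h0 : (0 : ℝ) ∈ Ioo (-1 : ℝ) 2 := by norm_num
    have hcq : c 0 = q := by simp [hc, ← hz, φ.left_inv hq]
    have hvel := tangentMapAt_velocity hφ (c := c) (hcq ▸ hq)
      ((hgeo.1.contMDiffAt (isOpen_Ioo.mem_nhds h0)).mdifferentiableAt (by simp))
    have hev : (fun t : ℝ ↦ φ (c t)) =ᶠ[𝓝 0] fun t ↦ z + t • w := by
      filter_upwards [isOpen_Ioo.mem_nhds h0] with r hr using φ.right_inv (htar r hr)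
    have hd : deriv (fun t : ℝ ↦ z + t • w) 0 = w := by
      simpa using (((hasDerivAt_id (0 : ℝ)).smul_const w).const_add z).deriv
    rw [hev.deriv_eq, hd, ← hv] at hvel
    clear_value c
    subst hcq
    have hvel' : velocity c 0 = v := hφ.tangentMapAt_injective hq hvel
    rw [hvel']

lemma christoffel_smul_smul (G : F → F →L[ℝ] F →L[ℝ] ℝ) (z a : F) (r : ℝ)
    (hG : (G z).IsInvertible) :
    christoffel G z (r • a) (r • a) = (r * r) • christoffel G z a a := by
  obtain ⟨e, he⟩ := hG
  simp only [christoffel, ← he, ContinuousLinearMap.inverse_equiv]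
  rw [← map_smul]
  congr 1
  ext w
  simp
  ring

/-- Γ is quadratic in the velocity, so t ↦ c (r t) is again a geodesic. Hence exp (r v) = c r: a
single geodesic carries the exponentials of all the multiples of `v` allowed by its domain. -/
lemma IsGeodesicFrom.comp_mul [FiniteDimensional ℝ E] [IsManifold 𝓘(ℝ, E) ∞ M]
    {g : BilinField E M} (hg : IsRegularMetric g) {q : M} {v : TangentSpace 𝓘(ℝ, E) q}
    {c : ℝ → M} {ε : ℝ} (hgeo : IsGeodesicOn g c (Ioo (-ε) (1 + ε)))
    (h0 : (⟨c 0, velocity c 0⟩ : TangentBundle 𝓘(ℝ, E) M) = ⟨q, v⟩) {r : ℝ}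
    (hr : r ∈ Ioo (-ε) (1 + ε)) (hε : 0 < ε) :
    IsGeodesicFrom g q (r • v) (fun t ↦ c (r * t)) := by
  set P : Set ℝ := (fun t ↦ r * t) ⁻¹' Ioo (-ε) (1 + ε) with hP
  have hPo : IsOpen P := isOpen_Ioo.preimage (by fun_prop)
  have hc : ∀ t ∈ P, ContMDiffAt 𝓘(ℝ, ℝ) 𝓘(ℝ, E) ∞ c (r * t) :=
    fun t ht ↦ hgeo.1.contMDiffAt (isOpen_Ioo.mem_nhds ht)
  have hsm : ContMDiffOn 𝓘(ℝ, ℝ) 𝓘(ℝ, E) ∞ (fun t ↦ c (r * t)) P := by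
    refine hgeo.1.comp (ContMDiff.contMDiffOn ?_) fun t ht ↦ ht
    rw [contMDiff_iff_contDiff]
    fun_prop
  have hgP : IsGeodesicOn g (fun t ↦ c (r * t)) P := by
    refine ⟨hsm, fun t ht ↦ ?_⟩
    have hchart := isCoordinateSystem_chartAt (E := E) (c (r * t))
    have hmem := mem_chart_source E (c (r * t))
    rw [covDerivAlong_velocity_eq_zero_iff hg hchart hPo hsm ht hmem]
    have h := (covDerivAlong_velocity_eq_zero_iff hg hchart isOpen_Ioo hgeo.1 ht hmem).1
      (hgeo.2 _ ht)
    have hd : ∀ x : ℝ → E, deriv (fun s ↦ x (r * s)) = fun s ↦ r • deriv x (r * s) :=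
      fun x ↦ funext fun s ↦ deriv_comp_mul_left r x s
    rw [hd (fun s ↦ chartAt E (c (r * t)) (c s)), deriv_fun_const_smul_field,
      deriv_comp_mul_left, christoffel_smul_smul, smul_smul, ← smul_add, h, smul_zero]
    exact isInvertible_of_nondegenerate
      (hchart.metricInCoords_nondegenerate hg.nondegenerate ((chartAt E _).map_source hmem))
  have h0P : (0 : ℝ) ∈ P := by simp [hP, hε]; linarith
  have h1P : (1 : ℝ) ∈ P := by simpa [hP] using hr
  have hPord : P.OrdConnected :=
    ((convex_Ioo (-ε) (1 + ε)).is_linear_preimage (IsLinearMap.isLinearMap_smul r)).ordConnected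
  refine ⟨?_, ?_⟩
  -- `r` may be negative or zero, so the endpoints of `P` are not computed: `P` is open and
  -- order-connected and contains 0 and 1, hence contains a slightly larger interval than [0, 1].
  · obtain ⟨δ₀, hδ₀, hb₀⟩ := Metric.isOpen_iff.1 hPo 0 h0P
    obtain ⟨δ₁, hδ₁, hb₁⟩ := Metric.isOpen_iff.1 hPo 1 h1P
    set δ := min δ₀ δ₁ / 2 with hδ
    have hδpos : 0 < δ := by positivity
    have hδ0 : δ < δ₀ := by have := min_le_left δ₀ δ₁; linarith
    have hδ1 : δ < δ₁ := by have := min_le_right δ₀ δ₁; linarith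
    have hm0 : -δ ∈ P := hb₀ (by simp [abs_of_pos hδpos, hδ0])
    have hm1 : 1 + δ ∈ P := hb₁ (by simp [abs_of_pos hδpos, hδ1])
    have hsub : Ioo (-δ) (1 + δ) ⊆ P := Ioo_subset_Icc_self.trans (hPord.out hm0 hm1)
    exact ⟨δ, hδpos, hgP.1.mono hsub, fun t ht ↦ hgP.2 t (hsub ht)⟩
  · have hcq : c 0 = q := congrArg (fun p ↦ p.1) h0
    subst hcq
    have hv : velocity c 0 = v := by simpa using h0
    subst hv
    have hcd : MDifferentiableAt 𝓘(ℝ, ℝ) 𝓘(ℝ, E) c (r * 0) :=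
      (hc 0 h0P).mdifferentiableAt (by simp)
    have hmul : HasFDerivAt (fun t : ℝ ↦ r * t) (r • ContinuousLinearMap.id ℝ ℝ) 0 :=
      (hasFDerivAt_id (0 : ℝ)).const_mul r
    have hvel : tangentMapAt ℝ E (c ∘ fun t ↦ r * t) 0 1 = r • tangentMapAt ℝ E c 0 1 := by
      rw [tangentMapAt_comp (F := ℝ) hcd hmul.differentiableAt.mdifferentiableAt,
        tangentMapAt_eq_fderiv, hmul.fderiv, ← map_smul]
      simp
    -- The base points c (r * 0) and c 0 agree only propositionally; generalising over the point and
    -- the vector avoids a transport between tangent spaces.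
    have key : ∀ (q' : M) (v' : E), q' = c 0 → v' = r • tangentMapAt ℝ E c 0 1 →
        (⟨q', v'⟩ : TangentBundle 𝓘(ℝ, E) M) = ⟨c 0, r • velocity c 0⟩ := by
      rintro q' v' rfl rfl
      rfl
    exact key _ _ (by simp) hvel

lemma IsGeodesicFrom.exists_eqOn [FiniteDimensional ℝ E] [T2Space M] [IsManifold 𝓘(ℝ, E) ∞ M]
    {g : BilinField E M} (hg : IsRegularMetric g) {q : M} {v : TangentSpace 𝓘(ℝ, E) q}
    {c₁ c₂ : ℝ → M} (h₁ : IsGeodesicFrom g q v c₁) (h₂ : IsGeodesicFrom g q v c₂) :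
    ∃ ε > 0, EqOn c₁ c₂ (Ioo (-ε) (1 + ε)) := by
  obtain ⟨⟨ε₁, hε₁, h₁⟩, h₁0⟩ := h₁
  obtain ⟨⟨ε₂, hε₂, h₂⟩, h₂0⟩ := h₂
  have hpos : 0 < min ε₁ ε₂ := lt_min hε₁ hε₂
  have hsub₁ : Ioo (-min ε₁ ε₂) (1 + min ε₁ ε₂) ⊆ Ioo (-ε₁) (1 + ε₁) :=
    Ioo_subset_Ioo (by simp) (by simp)
  have hsub₂ : Ioo (-min ε₁ ε₂) (1 + min ε₁ ε₂) ⊆ Ioo (-ε₂) (1 + ε₂) :=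
    Ioo_subset_Ioo (by simp) (by simp)
  exact ⟨_, hpos, eqOn_of_isGeodesicOn hg isOpen_Ioo isPreconnected_Ioo
    ⟨h₁.1.mono hsub₁, fun t ht ↦ h₁.2 t (hsub₁ ht)⟩
    ⟨h₂.1.mono hsub₂, fun t ht ↦ h₂.2 t (hsub₂ ht)⟩ (t := 0)
    ⟨by linarith, by linarith⟩ (h₁0.trans h₂0.symm)⟩

lemma IsExp.unique [FiniteDimensional ℝ E] [T2Space M] [IsManifold 𝓘(ℝ, E) ∞ M]
    {g : BilinField E M} (hg : IsRegularMetric g) {q : M} {v : TangentSpace 𝓘(ℝ, E) q} {a b : M}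
    (ha : IsExp g q v a) (hb : IsExp g q v b) : a = b := by
  obtain ⟨c₁, h₁, rfl⟩ := ha
  obtain ⟨c₂, h₂, rfl⟩ := hb
  obtain ⟨ε, hε, h⟩ := h₁.exists_eqOn hg h₂
  exact h ⟨by linarith, by linarith⟩

/-- If the exponential map is a line in coordinates, then the line satisfies the geodesic
equation. -/
lemma christoffel_eq_zero_of_isExp [FiniteDimensional ℝ E] [FiniteDimensional ℝ F] [T2Space M]
    [IsManifold 𝓘(ℝ, E) ∞ M] {g : BilinField E M} (hg : IsRegularMetric g)
    {φ : OpenPartialHomeomorph M F} (hφ : IsCoordinateSystem (E := E) φ) {z w : F} {q : M}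
    {v : TangentSpace 𝓘(ℝ, E) q} {U : Set F} (hU : IsOpen U) (hUφ : U ⊆ φ.target)
    (h0 : z ∈ U) (h1 : z + w ∈ U)
    (hexp : ∀ r : ℝ, z + r • w ∈ U → IsExp g q (r • v) (φ.symm (z + r • w))) :
    φ.symm z = q ∧ tangentMapAt E F φ q v = w ∧
      christoffel (metricInCoords g φ) (z + w) w w = 0 := by
  obtain ⟨c, ⟨⟨ε, hε, hc⟩, hc0⟩, -⟩ : IsExp g q v (φ.symm (z + w)) := by
    simpa using hexp 1 (by simpa using h1)
  -- Both points are exp (r v), one by rescaling `c` and the other by hypothesis, so uniqueness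
  -- makes `c` the coordinate line.
  have hline : ∀ r ∈ Ioo (-ε) (1 + ε), z + r • w ∈ U → c r = φ.symm (z + r • w) := by
    intro r hr hrU
    exact IsExp.unique hg ⟨_, IsGeodesicFrom.comp_mul hg hc hc0 hr hε, by simp⟩ (hexp r hrU)
  have hcont : Continuous fun r : ℝ ↦ z + r • w := by fun_prop
  have hev : ∀ r ∈ Ioo (-ε) (1 + ε), z + r • w ∈ U →
      (fun s ↦ φ (c s)) =ᶠ[𝓝 r] fun s ↦ z + s • w := by
    intro r hr hrU
    filter_upwards [isOpen_Ioo.mem_nhds hr, (hU.preimage hcont).mem_nhds hrU] with s hs hsU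
    rw [hline s hs hsU, φ.right_inv (hUφ hsU)]
  have hd : deriv (fun t : ℝ ↦ z + t • w) = fun _ ↦ w := by
    funext r
    simpa using (((hasDerivAt_id r).smul_const w).const_add z).deriv
  have hI0 : (0 : ℝ) ∈ Ioo (-ε) (1 + ε) := ⟨by linarith, by linarith⟩
  have hI1 : (1 : ℝ) ∈ Ioo (-ε) (1 + ε) := ⟨by linarith, by linarith⟩
  have hU0 : z + (0 : ℝ) • w ∈ U := by simpa using h0
  have hU1 : z + (1 : ℝ) • w ∈ U := by simpa using h1
  have hcq : c 0 = q := congrArg (fun p ↦ p.1) hc0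
  have hc0' : c 0 = φ.symm z := by simpa using hline 0 hI0 hU0
  have hqs : q ∈ φ.source := by
    rw [← hcq, hc0']
    exact φ.map_target (hUφ h0)
  refine ⟨hc0'.symm.trans hcq, ?_, ?_⟩
  · rw [← deriv_eq_of_velocity_eq hφ hqs ((hc.1.contMDiffAt
      (isOpen_Ioo.mem_nhds hI0)).mdifferentiableAt (by simp)) hc0, (hev 0 hI0 hU0).deriv_eq, hd]
  · have hc1 : c 1 = φ.symm (z + w) := by simpa using hline 1 hI1 hU1
    have hs1 : c 1 ∈ φ.source := by
      rw [hc1]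
      exact φ.map_target (hUφ h1)
    have h := (covDerivAlong_velocity_eq_zero_iff hg hφ isOpen_Ioo hc.1 hI1 hs1).1 (hc.2 1 hI1)
    rw [(hev 1 hI1 hU1).deriv.deriv_eq, (hev 1 hI1 hU1).deriv_eq, hd, hc1,
      φ.right_inv (hUφ h1)] at h
    simpa using h

end Geodesic

/-! ### The coordinates induced on the submanifold -/

section Slice

set_option maxSynthPendingDepth 3

variable {E A B : Type*} [NormedAddCommGroup A] [NormedAddCommGroup B]
  {M : Type*} [TopologicalSpace M] {S : Type*} [TopologicalSpace S]

/-- The coordinates `x` of the submanifold `u = 0`, where `φ = (x, u)`. -/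
def sliceChart {ι : S → M} (hι : Topology.IsEmbedding ι) (φ : OpenPartialHomeomorph M (A × B))
    (hS : ∀ q ∈ φ.source, q ∈ range ι ↔ (φ q).2 = 0) (p : S) : OpenPartialHomeomorph S A :=
  -- Only supplies the default value of `Function.invFun`; over the target the argument lies in the
  -- range of ι, where the inverse is the true one. The point `p` plays no other role.
  have : Nonempty S := ⟨p⟩
  have hinv : ∀ x : A, (x, (0 : B)) ∈ φ.target →
      ι (Function.invFun ι (φ.symm (x, 0))) = φ.symm (x, 0) := fun x hx ↦
    Function.invFun_eq ((hS _ (φ.map_target hx)).2 (by rw [φ.right_inv hx]))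
  have hfst : ∀ y, ι y ∈ φ.source → ((φ (ι y)).1, (0 : B)) = φ (ι y) := fun y hy ↦
    Prod.ext rfl ((hS _ hy).1 ⟨y, rfl⟩).symm
  { toFun := fun y ↦ (φ (ι y)).1
    invFun := fun x ↦ Function.invFun ι (φ.symm (x, 0))
    source := ι ⁻¹' φ.source
    target := (fun x : A ↦ (x, (0 : B))) ⁻¹' φ.target
    map_source' := fun y hy ↦ by
      rw [mem_preimage, hfst y hy]
      exact φ.map_source hy
    map_target' := fun x hx ↦ by
      rw [mem_preimage, hinv x hx]
      exact φ.map_target hx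
    left_inv' := fun y hy ↦ by
      rw [hfst y hy, φ.left_inv hy]
      exact Function.leftInverse_invFun hι.injective y
    right_inv' := fun x hx ↦ by
      rw [hinv x hx, φ.right_inv hx]
    open_source := φ.open_source.preimage hι.continuous
    open_target := φ.open_target.preimage (by fun_prop)
    continuousOn_toFun := (continuous_fst.comp_continuousOn φ.continuousOn).comp
      hι.continuous.continuousOn fun _ hy ↦ hy
    continuousOn_invFun := by
      rw [hι.isInducing.continuousOn_iff]
      refine ContinuousOn.congr (f := fun x : A ↦ φ.symm (x, (0 : B))) ?_ hinv
      exact φ.continuousOn_symm.comp (by fun_prop) fun _ hx ↦ hx }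

variable {ι : S → M} {hι : Topology.IsEmbedding ι} {φ : OpenPartialHomeomorph M (A × B)}
  {hS : ∀ q ∈ φ.source, q ∈ range ι ↔ (φ q).2 = 0} {p : S}

lemma apply_eq_sliceChart {y : S} (hy : ι y ∈ φ.source) :
    φ (ι y) = (sliceChart hι φ hS p y, 0) :=
  Prod.ext rfl ((hS _ hy).1 ⟨y, rfl⟩)

lemma apply_sliceChart_symm {x : A} (hx : (x, (0 : B)) ∈ φ.target) :
    ι ((sliceChart hι φ hS p).symm x) = φ.symm (x, 0) := by
  have hx' : x ∈ (sliceChart hι φ hS p).target := hx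
  have hy : ι ((sliceChart hι φ hS p).symm x) ∈ φ.source :=
    (sliceChart hι φ hS p).map_target hx'
  have h := apply_eq_sliceChart (hι := hι) (hS := hS) (p := p) hy
  rw [(sliceChart hι φ hS p).right_inv hx'] at h
  rw [← h, φ.left_inv hy]

variable [NormedAddCommGroup E] [NormedSpace ℝ E] [NormedSpace ℝ A] [NormedSpace ℝ B]
  [ChartedSpace E M] [ChartedSpace A S]

lemma sliceChart_contMDiffAt (hι' : ContMDiff 𝓘(ℝ, A) 𝓘(ℝ, E) ∞ ι)
    (hφ : IsCoordinateSystem (E := E) φ) {y : S} (hy : ι y ∈ φ.source) :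
    ContMDiffAt 𝓘(ℝ, A) 𝓘(ℝ, A) ∞ (sliceChart hι φ hS p) y := by
  have h1 : ContMDiffAt 𝓘(ℝ, A × B) 𝓘(ℝ, A) ∞ (Prod.fst : A × B → A) (φ (ι y)) :=
    contMDiffAt_iff_contDiffAt.2 contDiffAt_fst
  exact ContMDiffAt.comp (I' := 𝓘(ℝ, A × B)) (g := Prod.fst) (f := φ ∘ ι) y h1
    ((hφ.contMDiffAt hy).comp y hι'.contMDiffAt)

lemma tangentMapAt_tangentMapAt_eq (hι' : ContMDiff 𝓘(ℝ, A) 𝓘(ℝ, E) ∞ ι)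
    (hφ : IsCoordinateSystem (E := E) φ) {y : S} (hy : ι y ∈ φ.source) (v : A) :
    tangentMapAt E (A × B) φ (ι y) (tangentMapAt A E ι y v) =
      (tangentMapAt A A (sliceChart hι φ hS p) y v, 0) := by
  have hev : (φ ∘ ι) =ᶠ[𝓝 y] ContinuousLinearMap.inl ℝ A B ∘ sliceChart hι φ hS p := by
    filter_upwards [(φ.open_source.preimage hι'.continuous).mem_nhds hy] with y' hy'
    exact apply_eq_sliceChart (hι := hι) (hS := hS) (p := p) hy'
  have hι'' : MDifferentiableAt 𝓘(ℝ, A) 𝓘(ℝ, E) ι y := hι'.contMDiffAt.mdifferentiableAt (by simp)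
  have hψ := (sliceChart_contMDiffAt (hι := hι) (hS := hS) (p := p) hι' hφ hy).mdifferentiableAt
    (by simp)
  have hL := (ContinuousLinearMap.inl ℝ A B).differentiableAt
    (x := sliceChart hι φ hS p y)
  rw [← tangentMapAt_comp (hφ.mdifferentiableAt hy) hι'', tangentMapAt_congr hev,
    tangentMapAt_comp hL.mdifferentiableAt hψ, tangentMapAt_eq_fderiv,
    ContinuousLinearMap.fderiv]
  rfl

/-- Smoothness of the chart is inherited from `φ`. Smoothness of its inverse comes from the inverse
function theorem: ι is an immersion with image in u = 0, so the derivative of the chart is an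
injective endomorphism of the finite-dimensional space `A`. -/
lemma isCoordinateSystem_sliceChart [FiniteDimensional ℝ A] [IsManifold 𝓘(ℝ, A) ∞ S]
    (hι' : IsEmbeddedSubmanifold (E := E) (E' := A) ι) (hφ : IsCoordinateSystem (E := E) φ) :
    IsCoordinateSystem (E := A) (sliceChart hι φ hS p) := by
  set ψ := sliceChart hι φ hS p with hψ
  refine ⟨fun y hy ↦ (sliceChart_contMDiffAt hι'.contMDiff hφ hy).contMDiffWithinAt,
    fun x hx ↦ ContMDiffAt.contMDiffWithinAt ?_⟩
  have hy : ψ.symm x ∈ ψ.source := ψ.map_target hx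
  have hψy : ContMDiffAt 𝓘(ℝ, A) 𝓘(ℝ, A) ∞ ψ (ψ.symm x) :=
    sliceChart_contMDiffAt hι'.contMDiff hφ hy
  set c := chartAt A (ψ.symm x) with hc
  have hcs : IsCoordinateSystem (E := A) c := isCoordinateSystem_chartAt _
  have hmem : ψ.symm x ∈ c.source := mem_chart_source A _
  have hmem' : c (ψ.symm x) ∈ c.target := c.map_source hmem
  have hcy : c.symm (c (ψ.symm x)) = ψ.symm x := c.left_inv hmem
  -- The slice chart read in the chart that `S` already carries, so that the inverse function
  -- theorem is applied inside `A`.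
  let f : OpenPartialHomeomorph A A := c.symm.trans ψ
  have hfx : x ∈ f.target := by
    simp only [f, OpenPartialHomeomorph.trans_target, OpenPartialHomeomorph.symm_target]
    exact ⟨hx, hmem⟩
  have hfs : f.symm x = c (ψ.symm x) := rfl
  have hfc : ContDiffAt ℝ ∞ f (f.symm x) := by
    rw [← contMDiffAt_iff_contDiffAt, hfs]
    exact ContMDiffAt.comp (I' := 𝓘(ℝ, A)) (g := ψ) (f := c.symm) _ (by rwa [hcy])
      (hcs.contMDiffAt_symm hmem')
  have hinj : Function.Injective (fderiv ℝ f (f.symm x)) := by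
    intro v w hvw
    have hd : ∀ v, fderiv ℝ f (f.symm x) v =
        tangentMapAt A A ψ (ψ.symm x) (tangentMapAt A A c.symm (c (ψ.symm x)) v) := by
      intro v
      rw [← tangentMapAt_eq_fderiv, hfs]
      change tangentMapAt A A (ψ ∘ c.symm) (c (ψ.symm x)) v = _
      rw [tangentMapAt_comp (by rw [hcy]; exact hψy.mdifferentiableAt (by simp))
        (hcs.mdifferentiableAt_symm hmem'), hcy]
    rw [hd, hd] at hvw
    have h2 := congrArg (fun a ↦ (a, (0 : B))) hvw
    simp only [hψ] at h2
    rw [← tangentMapAt_tangentMapAt_eq hι'.contMDiff hφ hy,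
      ← tangentMapAt_tangentMapAt_eq hι'.contMDiff hφ hy] at h2
    have h3 := hι'.injective_mfderiv _ (hφ.tangentMapAt_injective hy h2)
    have h4 := congrArg (tangentMapAt A A c (c.symm (c (ψ.symm x)))) h3
    rwa [hcs.tangentMapAt_symm_right hmem', hcs.tangentMapAt_symm_right hmem'] at h4
  let e : A ≃L[ℝ] A :=
    (LinearEquiv.ofInjectiveEndo (fderiv ℝ f (f.symm x)).toLinearMap hinj).toContinuousLinearEquiv
  have he : (e : A →L[ℝ] A) = fderiv ℝ f (f.symm x) := by ext; rfl
  have hsymm : ContDiffAt ℝ ∞ f.symm x :=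
    f.contDiffAt_symm (f₀' := e) hfx
      (by rw [he]; exact (hfc.differentiableAt (by simp)).hasFDerivAt) hfc
  have hcomp : ContMDiffAt 𝓘(ℝ, A) 𝓘(ℝ, A) ∞ (c.symm ∘ f.symm) x :=
    ContMDiffAt.comp (I' := 𝓘(ℝ, A)) x (hcs.contMDiffAt_symm (by rwa [hfs]))
      (contMDiffAt_iff_contDiffAt.2 hsymm)
  refine hcomp.congr_of_eventuallyEq ?_
  have hcont : ContinuousAt ψ.symm x := ψ.continuousAt_symm hx
  filter_upwards [hcont.eventually_mem (c.open_source.mem_nhds hmem)] with x' hx'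
  exact (c.left_inv hx').symm

/-- In these coordinates ι is x ↦ (x, 0), so the induced metric is the tangential block of the
ambient one. -/
lemma metricInCoords_sliceChart [FiniteDimensional ℝ A] [IsManifold 𝓘(ℝ, A) ∞ S]
    (hι' : IsEmbeddedSubmanifold (E := E) (E' := A) ι) (hφ : IsCoordinateSystem (E := E) φ)
    (g : BilinField E M) {x : A} (hx : (x, (0 : B)) ∈ φ.target) (v w : A) :
    metricInCoords (E := A) (pullback ι g) (sliceChart hι φ hS p) x v w =
      metricInCoords g φ (x, 0) (v, 0) (w, 0) := by
  have hψ : IsCoordinateSystem (E := A) (sliceChart hι φ hS p) :=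
    isCoordinateSystem_sliceChart hι' hφ
  have hιx := apply_sliceChart_symm (hι := hι) (hS := hS) (p := p) hx
  have hsrc : ι ((sliceChart hι φ hS p).symm x) ∈ φ.source := by
    rw [hιx]
    exact φ.map_target hx
  have hev : (φ ∘ ι ∘ (sliceChart hι φ hS p).symm) =ᶠ[𝓝 x] ContinuousLinearMap.inl ℝ A B := by
    filter_upwards [(sliceChart hι φ hS p).open_target.mem_nhds hx] with x' hx'
    simp [apply_sliceChart_symm hx', φ.right_inv hx']
  rw [metricInCoords_pullback hφ hψ g hx hι'.contMDiff.contMDiffAt hsrc, hev.fderiv_eq,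
    ContinuousLinearMap.fderiv, hev.self_of_nhds]
  rfl

/-- The section of the normal bundle with constant coordinates `(0, u)` is parallel along the curve
`t ↦ (t x, 0)` if and only if the vertical part of `Γ((x, 0), (0, u))` vanishes. -/
lemma isNormalParallelAt_iff [FiniteDimensional ℝ E] [FiniteDimensional ℝ A]
    [FiniteDimensional ℝ B] [IsManifold 𝓘(ℝ, E) ∞ M] [IsManifold 𝓘(ℝ, A) ∞ S]
    (hι' : IsEmbeddedSubmanifold (E := E) (E' := A) ι) (hφ : IsCoordinateSystem (E := E) φ)
    (hS : ∀ q ∈ φ.source, q ∈ range ι ↔ (φ q).2 = 0)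
    {g : BilinField E M} (hg : IsRegularMetric g) {N : (y : S) → TangentSpace 𝓘(ℝ, E) (ι y)}
    {γ : ℝ → S} {t : ℝ} (hγ : MDifferentiableAt 𝓘(ℝ, ℝ) 𝓘(ℝ, A) γ t) (hsrc : ι (γ t) ∈ φ.source)
    {x : A} {u : B} (hx : (fun s ↦ φ (ι (γ s))) =ᶠ[𝓝 t] fun s ↦ (s • x, 0))
    (hN : (fun s ↦ tangentMapAt E (A × B) φ (ι (γ s)) (N (γ s))) =ᶠ[𝓝 t] fun _ ↦ (0, u)) :
    IsNormalParallelAt (E' := A) g ι N γ t ↔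
      (christoffel (metricInCoords g φ) (t • x, 0) (x, 0) (0, u)).2 = 0 := by
  have hψ : IsCoordinateSystem (E := A) (sliceChart hι'.isEmbedding φ hS (γ t)) :=
    isCoordinateSystem_sliceChart hι' hφ
  have hc : MDifferentiableAt 𝓘(ℝ, ℝ) 𝓘(ℝ, E) (fun s ↦ ι (γ s)) t :=
    (hι'.contMDiff.contMDiffAt.mdifferentiableAt (by simp)).comp t hγ
  have hV : DifferentiableAt ℝ (fun s ↦ tangentMapAt E (A × B) φ (ι (γ s)) (N (γ s))) t :=
    (differentiableAt_const _).congr_of_eventuallyEq hN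
  have hdx : HasDerivAt (fun s : ℝ ↦ (s • x, (0 : B))) (x, 0) t := by
    simpa using ((hasDerivAt_id t).smul_const x).prodMk (hasDerivAt_const t (0 : B))
  have h := (tangentMapAt_covDerivAlong hg hφ (c := fun s ↦ ι (γ s)) (V := fun s ↦ N (γ s)) hsrc hc
    hV).trans (covDerivInCoords_def g φ _ _ t)
  have hN' : tangentMapAt E (A × B) φ (ι (γ t)) (N (γ t)) = (0, u) := hN.self_of_nhds
  have hx' : φ (ι (γ t)) = (t • x, 0) := hx.self_of_nhds
  rw [hN.deriv_eq, hx.deriv_eq, hdx.deriv, hN', hx', deriv_const, zero_add] at h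
  rw [← h]
  constructor
  · rintro ⟨w, hw⟩
    have h1 := tangentMapAt_tangentMapAt_eq (hι := hι'.isEmbedding) (hS := hS) (p := γ t)
      hι'.contMDiff hφ hsrc w
    have h2 := congrArg Prod.snd h1
    have hw' : tangentMapAt A E ι (γ t) w =
      covDerivAlong g (fun s ↦ ι (γ s)) (fun s ↦ N (γ s)) t := hw
    rwa [hw'] at h2
  · intro h0
    obtain ⟨w, hw⟩ := hψ.tangentMapAt_surjective (q := γ t) hsrc (tangentMapAt E (A × B) φ (ι (γ t))
      (covDerivAlong g (fun s ↦ ι (γ s)) (fun s ↦ N (γ s)) t)).1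
    refine ⟨w, hφ.tangentMapAt_injective hsrc ?_⟩
    refine (tangentMapAt_tangentMapAt_eq (hι := hι'.isEmbedding) (hS := hS) (p := γ t)
      hι'.contMDiff hφ hsrc w).trans ?_
    exact Prod.ext hw h0.symm

end Slice

/-! ### Metrics in coordinates adapted to a submanifold -/

section AdaptedCoordinates

set_option maxSynthPendingDepth 3

variable {F A B : Type*} [NormedAddCommGroup F] [NormedSpace ℝ F]
  [NormedAddCommGroup A] [NormedSpace ℝ A] [NormedAddCommGroup B] [NormedSpace ℝ B]

lemma fderiv_apply_symm {G : F → F →L[ℝ] F →L[ℝ] ℝ} (hsymm : ∀ z v w, G z v w = G z w v) {z : F}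
    (hG : DifferentiableAt ℝ G z) (a v w : F) : fderiv ℝ G z a v w = fderiv ℝ G z a w v := by
  have hl : HasDerivAt (fun t : ℝ ↦ z + t • a) a 0 := by
    simpa using ((hasDerivAt_id (0 : ℝ)).smul_const a).const_add z
  have h : ∀ v w, HasDerivAt (fun t : ℝ ↦ G (z + t • a) v w) (fderiv ℝ G z a v w) 0 := by
    intro v w
    simpa using hasDerivAt_comp_apply_apply (l := fun t : ℝ ↦ z + t • a) (by simpa using hG) hl v w
  refine (h v w).unique ((h w v).congr_of_eventuallyEq (.of_forall fun t ↦ hsymm _ _ _))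

/-- Serves to cancel the scale factor in an identity homogeneous along a ray and still obtain it, by
continuity, at the origin of the ray. -/
lemma eq_zero_of_mul_eventually_eq_zero {f : ℝ → ℝ} (hf : ContinuousAt f 0)
    (h : ∀ᶠ t in 𝓝 0, t * f t = 0) : f 0 = 0 := by
  have h1 : Tendsto f (𝓝[≠] 0) (𝓝 (f 0)) := hf.tendsto.mono_left nhdsWithin_le_nhds
  refine tendsto_nhds_unique_of_eventuallyEq h1 (tendsto_const_nhds (x := 0)) ?_
  filter_upwards [nhdsWithin_le_nhds h, self_mem_nhdsWithin] with t ht ht0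
  exact (mul_eq_zero.1 ht).resolve_left ht0

variable (A B) in
/-- The projection `(x, u) ↦ (0, u)`. -/
def verticalProj : A × B →L[ℝ] A × B :=
  ContinuousLinearMap.inr ℝ A B ∘L ContinuousLinearMap.snd ℝ A B

lemma verticalProj_apply (z : A × B) : verticalProj A B z = (0, z.2) := rfl

lemma mem_ball_smul {r : ℝ} {z : A × B} (hz : z ∈ Metric.ball (0 : A × B) r) {s t : ℝ}
    (hs : s ∈ Icc (0 : ℝ) 1) (ht : t ∈ Icc (0 : ℝ) 1) :
    (s • z.1, t • z.2) ∈ Metric.ball (0 : A × B) r := by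
  rw [mem_ball_zero_iff, Prod.norm_def] at hz ⊢
  have h1 : ‖s • z.1‖ ≤ ‖z.1‖ := by
    rw [norm_smul, Real.norm_of_nonneg hs.1]
    exact mul_le_of_le_one_left (norm_nonneg _) hs.2
  have h2 : ‖t • z.2‖ ≤ ‖z.2‖ := by
    rw [norm_smul, Real.norm_of_nonneg ht.1]
    exact mul_le_of_le_one_left (norm_nonneg _) ht.2
  exact (max_le_max h1 h2).trans_lt hz

lemma prodMk_zero_mem_ball {A B : Type*} [SeminormedAddCommGroup A] [SeminormedAddCommGroup B]
    {r : ℝ} {x : A} (hx : x ∈ Metric.ball (0 : A) r) :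
    (x, (0 : B)) ∈ Metric.ball (0 : A × B) r := by
  rw [mem_ball_zero_iff] at hx ⊢
  simpa [Prod.norm_def] using hx

lemma mem_ball_of_fst {r : ℝ} {z : A × B} (hz : z ∈ Metric.ball (0 : A × B) r) :
    (z.1, (0 : B)) ∈ Metric.ball (0 : A × B) r := by
  simpa using mem_ball_smul hz (s := 1) (t := 0) (by simp) (by simp)

/-! ### From Christoffel symbols to the metric. -/

section Forward

variable {G : A × B → (A × B) →L[ℝ] (A × B) →L[ℝ] ℝ} {r : ℝ}

/-- The inner products of the vertical coordinate fields are constant on the submanifold `u = 0`. -/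
lemma vertical_inner_eq [FiniteDimensional ℝ A] [FiniteDimensional ℝ B]
    (hG : ∀ z ∈ Metric.ball 0 r, DifferentiableAt ℝ G z)
    (hsymm : ∀ z v w, G z v w = G z w v)
    (hnd : ∀ z ∈ Metric.ball 0 r, ∀ v, (∀ w, G z v w = 0) → v = 0)
    (hperp : ∀ z ∈ Metric.ball (0 : A × B) r, z.2 = 0 → ∀ u a, G z (0, u) (a, 0) = 0)
    (hpar : ∀ z ∈ Metric.ball (0 : A × B) r, ∀ u, ∀ s ∈ Icc (0 : ℝ) 1,
      (christoffel G (s • z.1, 0) (z.1, 0) (0, u)).2 = 0)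
    {z : A × B} (hz : z ∈ Metric.ball 0 r) (hz2 : z.2 = 0) (u u' : B) :
    G z (0, u) (0, u') = G 0 (0, u) (0, u') := by
  have hl : ∀ s : ℝ, HasDerivAt (fun s : ℝ ↦ (s • z.1, (0 : B))) (z.1, 0) s := fun s ↦ by
    simpa using ((hasDerivAt_id s).smul_const z.1).prodMk (hasDerivAt_const s (0 : B))
  have hmem : ∀ s ∈ Icc (0 : ℝ) 1, (s • z.1, (0 : B)) ∈ Metric.ball (0 : A × B) r := fun s hs ↦ by
    simpa using mem_ball_smul hz hs (t := 0) (by simp)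
  have hd : ∀ s ∈ Icc (0 : ℝ) 1, HasDerivAt (fun s : ℝ ↦ G (s • z.1, 0) (0, u) (0, u')) 0 s := by
    intro s hs
    have h1 := hasDerivAt_comp_apply_apply (l := fun s : ℝ ↦ (s • z.1, (0 : B)))
      (hG _ (hmem s hs)) (hl s) (0, u) (0, u')
    -- By `hpar` the vector Γ((x, 0), (0, u)) is horizontal, hence orthogonal on u = 0 to every
    -- vertical vector.
    have hΓ : ∀ u u' : B,
        G (s • z.1, 0) (christoffel G (s • z.1, 0) (z.1, 0) (0, u)) (0, u') = 0 := by
      intro u u'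
      rw [← hperp _ (hmem s hs) rfl u' (christoffel G (s • z.1, 0) (z.1, 0) (0, u)).1, hsymm]
      congr 1
      exact Prod.ext rfl (hpar z hz u s hs)
    have h2 := hΓ u u'
    have h3 := hΓ u' u
    -- Adding the two relations cancels the terms antisymmetric in u, u' and leaves ∂_x G(u, u') =
    -- 0: compatibility of the normal connection with the metric.
    rw [apply_christoffel (hnd _ (hmem s hs))] at h2 h3
    have hs1 := fderiv_apply_symm hsymm (hG _ (hmem s hs))
    refine h1.congr_deriv ?_
    linarith [hs1 (z.1, 0) (0, u') (0, u), hs1 (0, u') (z.1, 0) (0, u),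
      hs1 (0, u) (z.1, 0) (0, u')]
  have h := eq_of_hasDerivAt_zero (fun s hs ↦ (hd s hs).continuousAt.continuousWithinAt)
    fun s hs ↦ hd s (Ioo_subset_Icc_self hs)
  have hz' : z = (z.1, 0) := Prod.ext rfl hz2
  simp only [one_smul, zero_smul] at h
  rw [hz']
  exact h

/-- The Gauss lemma for P = `verticalProj`. Its base is the submanifold u = 0, where normality
settles the mixed inner products and parallel transport the vertical ones. -/
lemma apply_vertical_eq [FiniteDimensional ℝ A] [FiniteDimensional ℝ B]
    (hG : ∀ z ∈ Metric.ball 0 r, DifferentiableAt ℝ G z)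
    (hsymm : ∀ z v w, G z v w = G z w v)
    (hnd : ∀ z ∈ Metric.ball 0 r, ∀ v, (∀ w, G z v w = 0) → v = 0)
    (hgeo : ∀ z ∈ Metric.ball 0 r, christoffel G z (0, z.2) (0, z.2) = 0)
    (hperp : ∀ z ∈ Metric.ball (0 : A × B) r, z.2 = 0 → ∀ u a, G z (0, u) (a, 0) = 0)
    (hpar : ∀ z ∈ Metric.ball (0 : A × B) r, ∀ u, ∀ s ∈ Icc (0 : ℝ) 1,
      (christoffel G (s • z.1, 0) (z.1, 0) (0, u)).2 = 0) :
    ∀ z ∈ Metric.ball 0 r, ∀ w, G z (0, z.2) w = G 0 (0, z.2) w := by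
  refine gauss_lemma Metric.isOpen_ball (verticalProj A B) (fun v ↦ rfl) (G 0) (hsymm 0) ?_ hG
    (fun z _ ↦ hsymm z) (fun z hz ↦ (christoffel_eq_zero_iff (hnd z hz) _).1 (hgeo z hz)) ?_
  · intro z hz s hs
    have h := mem_ball_smul hz (s := 1) (t := s) (by simp) hs
    convert h using 1
    ext <;> simp [verticalProj_apply]
  · intro z hz hPz v w
    have hz2 : z.2 = 0 := congrArg Prod.snd hPz
    have h0 : (0 : A × B) ∈ Metric.ball 0 r :=
      Metric.mem_ball_self ((norm_nonneg z).trans_lt (mem_ball_zero_iff.1 hz))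
    have hw : w = (w.1, 0) + (0, w.2) := by simp
    rw [verticalProj_apply, hw, map_add, map_add, hperp z hz hz2, hperp 0 h0 rfl,
      vertical_inner_eq hG hsymm hnd hperp hpar hz hz2]

/-- As a bilinear form in u, u', the expression is symmetric, since Γ((x, 0), (0, u)) is horizontal,
and alternating, by the vertical Gauss identity; so it vanishes. -/
lemma fderiv_mixed_eq_zero [FiniteDimensional ℝ A] [FiniteDimensional ℝ B]
    (hG : ∀ z ∈ Metric.ball 0 r, DifferentiableAt ℝ G z)
    (hsymm : ∀ z v w, G z v w = G z w v)
    (hnd : ∀ z ∈ Metric.ball 0 r, ∀ v, (∀ w, G z v w = 0) → v = 0)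
    (hperp : ∀ z ∈ Metric.ball (0 : A × B) r, z.2 = 0 → ∀ u a, G z (0, u) (a, 0) = 0)
    (hpar : ∀ z ∈ Metric.ball (0 : A × B) r, ∀ u, ∀ s ∈ Icc (0 : ℝ) 1,
      (christoffel G (s • z.1, 0) (z.1, 0) (0, u)).2 = 0)
    (hvert : ∀ z ∈ Metric.ball 0 r, ∀ w, G z (0, z.2) w = G 0 (0, z.2) w)
    {x : A} (hx : (x, (0 : B)) ∈ Metric.ball 0 r) (u u' : B) :
    fderiv ℝ G (x, 0) (0, u) (x, 0) (0, u') = 0 := by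
  have h0 : (0 : A × B) ∈ Metric.ball 0 r :=
    Metric.mem_ball_self ((norm_nonneg _).trans_lt (mem_ball_zero_iff.1 hx))
  have hs1 := fderiv_apply_symm hsymm (hG _ hx)
  have hΓ : ∀ u u' : B, G (x, 0) (christoffel G (x, 0) (x, 0) (0, u)) (0, u') = 0 := by
    intro u u'
    rw [← hperp _ hx rfl u' (christoffel G (x, 0) (x, 0) (0, u)).1, hsymm]
    congr 1
    have := hpar _ hx u 1 (by simp)
    rw [one_smul] at this
    exact Prod.ext rfl this
  have h1 := hΓ u u'
  have h2 := hΓ u' u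
  rw [apply_christoffel (hnd _ hx)] at h1 h2
  -- Along t ↦ (x, t u), `hvert` gives t G((0, u), (x, 0)) = 0. So the inner product vanishes for t
  -- ≠ 0, at t = 0 by normality, and its derivative is zero.
  have hdiag : ∀ u : B, fderiv ℝ G (x, 0) (0, u) (0, u) (x, 0) = 0 := by
    intro u
    have hl : HasDerivAt (fun t : ℝ ↦ (x, t • u)) (0, u) 0 := by
      simpa using (hasDerivAt_const (0 : ℝ) x).prodMk ((hasDerivAt_id (0 : ℝ)).smul_const u)
    have hd := hasDerivAt_comp_apply_apply (G := G) (l := fun t : ℝ ↦ (x, t • u))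
      (by simpa using hG _ hx) hl (0, u) (x, 0)
    have hev : (fun t : ℝ ↦ G (x, t • u) (0, u) (x, 0)) =ᶠ[𝓝 0] fun _ ↦ 0 := by
      have hmem : ∀ᶠ t : ℝ in 𝓝 0, (x, t • u) ∈ Metric.ball (0 : A × B) r :=
        hl.continuousAt.eventually_mem (Metric.isOpen_ball.mem_nhds (by simpa using hx))
      filter_upwards [hmem] with t ht
      rcases eq_or_ne t 0 with rfl | ht0
      · exact hperp _ ht (by simp) _ _
      · have h := hvert _ ht (x, 0)
        have e : ((0 : A), t • u) = t • ((0 : A), u) := by simp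
        simp only at h
        rw [e, map_smul, map_smul, smul_apply, smul_apply, hperp 0 h0 rfl, smul_zero, smul_eq_mul]
          at h
        exact (mul_eq_zero.1 h).resolve_left ht0
    simpa using hd.unique ((hasDerivAt_const (0 : ℝ) (0 : ℝ)).congr_of_eventuallyEq hev)
  have hpol := hdiag (u + u')
  have e : ((0 : A), u + u') = (0, u) + (0, u') := by simp
  simp only [e, map_add, add_apply, hdiag] at hpol
  linarith [hs1 (x, 0) (0, u') (0, u), hs1 (0, u') (x, 0) (0, u), hs1 (0, u) (x, 0) (0, u')]

/-- The Gauss lemma for the exponential map of a single point. -/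
lemma apply_radial_eq [FiniteDimensional ℝ A] {G' : A → A →L[ℝ] A →L[ℝ] ℝ}
    (hG : ∀ x ∈ Metric.ball 0 r, DifferentiableAt ℝ G' x)
    (hsymm : ∀ x v w, G' x v w = G' x w v)
    (hnd : ∀ x ∈ Metric.ball 0 r, ∀ v, (∀ w, G' x v w = 0) → v = 0)
    (hgeo : ∀ x ∈ Metric.ball 0 r, christoffel G' x x x = 0) :
    ∀ x ∈ Metric.ball 0 r, ∀ w, G' x x w = G' 0 x w := by
  refine gauss_lemma Metric.isOpen_ball (ContinuousLinearMap.id ℝ A) (fun v ↦ rfl) (G' 0) (hsymm 0)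
    ?_ hG (fun z _ ↦ hsymm z) (fun z hz ↦ (christoffel_eq_zero_iff (hnd z hz) _).1 (hgeo z hz)) ?_
  · intro z hz s hs
    rw [mem_ball_zero_iff] at hz ⊢
    simp only [ContinuousLinearMap.id_apply, sub_self, zero_add, norm_smul,
      Real.norm_of_nonneg hs.1]
    exact (mul_le_of_le_one_left (norm_nonneg _) hs.2).trans_lt hz
  · intro z hz hPz v w
    have hz0 : z = 0 := hPz
    rw [hz0]

end Forward

/-! ### From the metric to Christoffel symbols. -/

section Backward

variable {G : A × B → (A × B) →L[ℝ] (A × B) →L[ℝ] ℝ} {r : ℝ}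

lemma christoffel_radial_eq_zero [FiniteDimensional ℝ A] {G' : A → A →L[ℝ] A →L[ℝ] ℝ}
    (hG : ∀ x ∈ Metric.ball 0 r, DifferentiableAt ℝ G' x)
    (hsymm : ∀ x v w, G' x v w = G' x w v)
    (hnd : ∀ x ∈ Metric.ball 0 r, ∀ v, (∀ w, G' x v w = 0) → v = 0)
    (h : ∀ x ∈ Metric.ball 0 r, ∀ w, G' x x w = G' 0 x w) :
    ∀ x ∈ Metric.ball 0 r, christoffel G' x x x = 0 := fun x hx ↦
  (christoffel_eq_zero_iff (hnd x hx) _).2 (gauss_lemma_converse Metric.isOpen_ball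
    (ContinuousLinearMap.id ℝ A) (fun _ ↦ rfl) (G' 0) (hsymm 0) hG (fun z _ ↦ hsymm z) h x hx)

lemma christoffel_vertical_eq_zero [FiniteDimensional ℝ A] [FiniteDimensional ℝ B]
    (hG : ∀ z ∈ Metric.ball 0 r, DifferentiableAt ℝ G z)
    (hsymm : ∀ z v w, G z v w = G z w v)
    (hnd : ∀ z ∈ Metric.ball 0 r, ∀ v, (∀ w, G z v w = 0) → v = 0)
    (hvert : ∀ z ∈ Metric.ball 0 r, ∀ w, G z (0, z.2) w = G 0 (0, z.2) w) :
    ∀ z ∈ Metric.ball 0 r, christoffel G z (0, z.2) (0, z.2) = 0 := fun z hz ↦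
  (christoffel_eq_zero_iff (hnd z hz) _).2 (gauss_lemma_converse Metric.isOpen_ball
    (verticalProj A B) (fun _ ↦ rfl) (G 0) (hsymm 0) hG (fun z _ ↦ hsymm z) hvert z hz)

/-- At u = 0 the hypothesis is empty; the information comes from applying it at (x, t u), cancelling
t and letting t tend to 0. -/
lemma apply_vertical_eq_of_snd_eq_zero (hG : ∀ z ∈ Metric.ball 0 r, DifferentiableAt ℝ G z)
    (hvert : ∀ z ∈ Metric.ball 0 r, ∀ w, G z (0, z.2) w = G 0 (0, z.2) w)
    {x : A} (hx : (x, (0 : B)) ∈ Metric.ball 0 r) (u : B) (w : A × B) :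
    G (x, 0) (0, u) w = G 0 (0, u) w := by
  have hl : HasDerivAt (fun t : ℝ ↦ (x, t • u)) (0, u) 0 := by
    simpa using (hasDerivAt_const (0 : ℝ) x).prodMk ((hasDerivAt_id (0 : ℝ)).smul_const u)
  have hd := hasDerivAt_comp_apply_apply (G := G) (l := fun t : ℝ ↦ (x, t • u))
    (by simpa using hG _ hx) hl (0, u) w
  have hmem : ∀ᶠ t : ℝ in 𝓝 0, (x, t • u) ∈ Metric.ball (0 : A × B) r :=
    hl.continuousAt.eventually_mem (Metric.isOpen_ball.mem_nhds (by simpa using hx))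
  have h := eq_zero_of_mul_eventually_eq_zero
    (f := fun t ↦ G (x, t • u) (0, u) w - G 0 (0, u) w)
    (hd.continuousAt.sub continuousAt_const) (by
      filter_upwards [hmem] with t ht
      have h := hvert _ ht w
      have e : ((0 : A), t • u) = t • ((0 : A), u) := by simp
      simp only at h
      rw [e, map_smul, map_smul, smul_apply, smul_apply, smul_eq_mul, smul_eq_mul] at h
      linarith)
  simpa [sub_eq_zero] using h

/-- In the formula for G(Γ((x, 0), (0, u)), (0, u')) every derivative vanishes: ∂_x G(u, u') because
vertical inner products are constant on the submanifold, the other two by `hmix`. -/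
lemma christoffel_mixed_snd_eq_zero [FiniteDimensional ℝ A] [FiniteDimensional ℝ B]
    (hG : ∀ z ∈ Metric.ball 0 r, ContDiffAt ℝ ∞ G z)
    (hsymm : ∀ z v w, G z v w = G z w v)
    (hnd : ∀ z ∈ Metric.ball 0 r, ∀ v, (∀ w, G z v w = 0) → v = 0)
    (hvert : ∀ z ∈ Metric.ball 0 r, ∀ w, G z (0, z.2) w = G 0 (0, z.2) w)
    (hperp : ∀ u a, G 0 (0, u) (a, 0) = 0)
    (hmix : ∀ z ∈ Metric.ball (0 : A × B) r, z.2 = 0 → ∀ u u',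
      fderiv ℝ G z (0, u) z (0, u') = 0)
    {x : A} (hx : (x, (0 : B)) ∈ Metric.ball 0 r) {s : ℝ} (hs : s ∈ Icc (0 : ℝ) 1) (u : B) :
    (christoffel G (s • x, 0) (x, 0) (0, u)).2 = 0 := by
  have hGd : ∀ z ∈ Metric.ball 0 r, DifferentiableAt ℝ G z :=
    fun z hz ↦ (hG z hz).differentiableAt (by simp)
  have h0 : (0 : A × B) ∈ Metric.ball 0 r :=
    Metric.mem_ball_self ((norm_nonneg _).trans_lt (mem_ball_zero_iff.1 hx))
  have hsx : (s • x, (0 : B)) ∈ Metric.ball (0 : A × B) r := by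
    simpa using mem_ball_smul hx hs (t := 0) (by simp)
  have hs1 := fderiv_apply_symm hsymm (hGd _ hsx)
  -- `hmix` at (s x, 0) speaks of the vector (s x, 0), so it controls (x, 0) only after division by
  -- s; s = 0 is recovered by continuity.
  have hmix' : ∀ u u' : B, fderiv ℝ G (s • x, 0) (0, u) (x, 0) (0, u') = 0 := by
    intro u u'
    have key : ∀ t : ℝ, (t • x, (0 : B)) ∈ Metric.ball (0 : A × B) r →
        t * fderiv ℝ G (t • x, 0) (0, u) (x, 0) (0, u') = 0 := by
      intro t ht
      have h := hmix _ ht rfl u u'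
      have e : (t • x, (0 : B)) = t • (x, (0 : B)) := by simp
      rw [← smul_eq_mul, ← h]
      conv_rhs => enter [1, 2]; rw [e]
      rw [map_smul, smul_apply]
    rcases eq_or_ne s 0 with rfl | hs0
    · have hl : ContinuousAt (fun t : ℝ ↦ (t • x, (0 : B))) 0 := by fun_prop
      have hl0 : (fun t : ℝ ↦ (t • x, (0 : B))) 0 = 0 := by simp
      have hc : ContinuousAt (fun t : ℝ ↦ fderiv ℝ G (t • x, 0)) 0 :=
        ContinuousAt.comp_of_eq ((hG 0 h0).continuousAt_fderiv (by simp)) hl hl0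
      refine eq_zero_of_mul_eventually_eq_zero
        (f := fun t : ℝ ↦ fderiv ℝ G (t • x, 0) (0, u) (x, 0) (0, u'))
        (((hc.clm_apply continuousAt_const).clm_apply continuousAt_const).clm_apply
          continuousAt_const) ?_
      have hm : Metric.ball (0 : A × B) r ∈ 𝓝 ((fun t : ℝ ↦ (t • x, (0 : B))) 0) := by
        rw [hl0]
        exact Metric.isOpen_ball.mem_nhds h0
      filter_upwards [hl.eventually_mem hm] with t ht using key t ht
    · exact (mul_eq_zero.1 (key s hsx)).resolve_left hs0
  have hconst : ∀ u u' : B, fderiv ℝ G (s • x, 0) (x, 0) (0, u) (0, u') = 0 := by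
    intro u u'
    have hl : HasDerivAt (fun t : ℝ ↦ (t • x, (0 : B))) (x, 0) s := by
      simpa using ((hasDerivAt_id s).smul_const x).prodMk (hasDerivAt_const s (0 : B))
    have hd := hasDerivAt_comp_apply_apply (G := G) (l := fun t : ℝ ↦ (t • x, (0 : B)))
      (hGd _ hsx) hl (0, u) (0, u')
    have hev : (fun t : ℝ ↦ G (t • x, 0) (0, u) (0, u')) =ᶠ[𝓝 s]
        fun _ ↦ G 0 (0, u) (0, u') := by
      filter_upwards [hl.continuousAt.eventually_mem (Metric.isOpen_ball.mem_nhds hsx)] with t ht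
      exact apply_vertical_eq_of_snd_eq_zero hGd hvert ht u _
    exact hd.unique ((hasDerivAt_const s _).congr_of_eventuallyEq hev)
  set v := christoffel G (s • x, 0) (x, 0) (0, u) with hv
  have hvu : ∀ u' : B, G (s • x, 0) v (0, u') = 0 := by
    intro u'
    rw [hv, apply_christoffel (hnd _ hsx), hconst, hmix']
    linarith [hmix' u' u, hs1 (0, u') (x, 0) (0, u)]
  -- Products with vertical vectors are the same at (s x, 0) as at 0. At 0 the metric is block
  -- diagonal and nondegenerate, so orthogonality to all vertical vectors forces the vertical part
  -- to vanish.
  have hv2 : ((0 : A), v.2) = 0 := by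
    refine hnd 0 h0 _ fun w ↦ ?_
    have hw : w = (w.1, 0) + (0, w.2) := by simp
    have h1 := hvu w.2
    rw [hsymm, apply_vertical_eq_of_snd_eq_zero hGd hvert hsx] at h1
    have hv' : v = (v.1, 0) + (0, v.2) := by simp
    rw [hv', map_add, hperp, zero_add] at h1
    rw [hw, map_add, hperp, zero_add, hsymm, h1]
  exact congrArg Prod.snd hv2

end Backward

end AdaptedCoordinates

/-! ### Frames and matrices -/

section Frames

set_option maxSynthPendingDepth 3

variable {F : Type*} [NormedAddCommGroup F] [NormedSpace ℝ F] {k m : ℕ}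

/-- If the geodesic equation holds along the punctured line, it holds at `z` too. -/
lemma christoffel_line_eq_zero [FiniteDimensional ℝ F] {G : F → F →L[ℝ] F →L[ℝ] ℝ} {U : Set F}
    (hU : IsOpen U) (hG : ∀ z ∈ U, ContDiffAt ℝ ∞ G z)
    (hnd : ∀ z ∈ U, ∀ v, (∀ w, G z v w = 0) → v = 0) {z w : F}
    (h : ∀ t : ℝ, z + t • w ∈ U → christoffel G (z + t • w) (t • w) (t • w) = 0)
    {t : ℝ} (ht : z + t • w ∈ U) : christoffel G (z + t • w) w w = 0 := by
  have hne : ∀ t : ℝ, t ≠ 0 → z + t • w ∈ U → christoffel G (z + t • w) w w = 0 := by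
    intro t ht0 ht
    have := h t ht
    rw [christoffel_smul_smul _ _ _ _ (isInvertible_of_nondegenerate (hnd _ ht))] at this
    exact (smul_eq_zero.1 this).resolve_left (mul_ne_zero ht0 ht0)
  rcases eq_or_ne t 0 with rfl | ht0
  · have hl : ContinuousAt (fun t : ℝ ↦ z + t • w) 0 := by fun_prop
    have hc : ContinuousAt (fun t : ℝ ↦ christoffel G (z + t • w) w w) 0 :=
      ContinuousAt.comp (g := fun y : F × F ↦ christoffel G y.1 y.2 y.2)
        (f := fun t : ℝ ↦ (z + t • w, w))
        (contDiffAt_christoffel (hnd _ ht) (hG _ ht)).continuousAt (hl.prodMk continuousAt_const)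
    have h1 : Tendsto (fun t : ℝ ↦ christoffel G (z + t • w) w w) (𝓝[≠] 0)
      (𝓝 (christoffel G (z + (0 : ℝ) • w) w w)) := hc.tendsto.mono_left nhdsWithin_le_nhds
    refine tendsto_nhds_unique_of_eventuallyEq h1 (tendsto_const_nhds (x := 0)) ?_
    filter_upwards [nhdsWithin_le_nhds (hl.eventually_mem (hU.mem_nhds ht)), self_mem_nhdsWithin]
      with t ht ht0 using hne t ht0 ht
  · exact hne t ht0 ht

lemma christoffel_sum_right {ι : Type*} (s : Finset ι) (G : F → F →L[ℝ] F →L[ℝ] ℝ) (z a : F)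
    (c : ι → ℝ) (b : ι → F) :
    christoffel G z a (∑ i ∈ s, c i • b i) = ∑ i ∈ s, c i • christoffel G z a (b i) := by
  have h : ∀ b, christoffel G z a b = ((G z).inverse ∘L ((1 / 2 : ℝ) •
      (fderiv ℝ G z a + (fderiv ℝ G z).flip a - ((fderiv ℝ G z).flip a).flip))) b := fun b ↦ rfl
  simp only [h, map_sum, map_smul]

lemma sum_smul_single {n : ℕ} (x : Eu n) :
    ∑ a, x a • (EuclideanSpace.single a 1 : Eu n) = x := by
  ext i
  simp [Finset.sum_apply, Pi.single_apply]

lemma sum_smul_coordVector_inl (x : Eu k) :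
    ∑ a, x a • (coordVector (Sum.inl a) : Eu k × Eu m) = (x, 0) := by
  ext1
  · simpa [coordVector, Prod.fst_sum] using sum_smul_single x
  · simp [coordVector, Prod.snd_sum]

lemma sum_smul_coordVector_inr (u : Eu m) :
    ∑ a, u a • (coordVector (Sum.inr a) : Eu k × Eu m) = (0, u) := by
  ext1
  · simp [coordVector, Prod.fst_sum]
  · simpa [coordVector, Prod.snd_sum] using sum_smul_single u

lemma forall_coordVector_inl {L : Eu k × Eu m →L[ℝ] F} :
    (∀ a, L (coordVector (Sum.inl a)) = 0) ↔ ∀ v, L (v, 0) = 0 := by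
  refine ⟨fun h v ↦ ?_, fun h a ↦ h _⟩
  rw [← sum_smul_coordVector_inl, map_sum]
  exact Finset.sum_eq_zero fun a _ ↦ by rw [map_smul, h, smul_zero]

lemma forall_coordVector_inr {L : Eu k × Eu m →L[ℝ] F} :
    (∀ a, L (coordVector (Sum.inr a)) = 0) ↔ ∀ u, L (0, u) = 0 := by
  refine ⟨fun h v ↦ ?_, fun h a ↦ h _⟩
  rw [← sum_smul_coordVector_inr, map_sum]
  exact Finset.sum_eq_zero fun a _ ↦ by rw [map_smul, h, smul_zero]

lemma sum_apply_mul_inl (L : Eu k × Eu m →L[ℝ] ℝ) (x : Eu k) :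
    ∑ b, L (coordVector (Sum.inl b)) * x b = L (x, 0) := by
  rw [← sum_smul_coordVector_inl, map_sum]
  simp [mul_comm]

lemma sum_apply_mul_inr (L : Eu k × Eu m →L[ℝ] ℝ) (u : Eu m) :
    ∑ b, L (coordVector (Sum.inr b)) * u b = L (0, u) := by
  rw [← sum_smul_coordVector_inr, map_sum]
  simp [mul_comm]

/-- A linear map is determined on a frame by its values on small combinations. -/
lemma apply_frame_eq {V W : Type*} [AddCommGroup V] [Module ℝ V] [AddCommGroup W] [Module ℝ W]
    {n : ℕ} (T : V →ₗ[ℝ] W) (f : Fin n → V) (j : Eu n →ₗ[ℝ] W) {r : ℝ} (hr : 0 < r)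
    (h : ∀ x : Eu n, ‖x‖ < r → T (∑ a, x a • f a) = j x) (a : Fin n) :
    T (f a) = j (EuclideanSpace.single a 1) := by
  have h1 := h ((r / 2) • EuclideanSpace.single a 1) (by
    rw [norm_smul, PiLp.norm_single, Real.norm_of_nonneg (by positivity), norm_one]
    linarith)
  have h2 : ∑ b, ((r / 2) • (EuclideanSpace.single a 1 : Eu n)) b • f b = (r / 2) • f a := by
    simp
  rw [h2, map_smul, map_smul] at h1
  exact smul_right_injective W (by positivity : r / 2 ≠ 0) h1

/-- Apply the identity at t y, cancel t, let t tend to 0. This reads off the metric at the origin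
from radial identities such as (A), (B) and (D). -/
lemma apply_zero_eq_of_eventually {V : Type*} [NormedAddCommGroup V] [NormedSpace ℝ V]
    {G : V → F →L[ℝ] F →L[ℝ] ℝ} (hG : ContinuousAt G 0) (L : V →L[ℝ] F) (c : V → ℝ)
    (hc : ∀ (t : ℝ) y, c (t • y) = t * c y) (v : F) (h : ∀ᶠ y in 𝓝 0, G y v (L y) = c y) (y : V) :
    G 0 v (L y) = c y := by
  have hl : ContinuousAt (fun t : ℝ ↦ t • y) 0 := by fun_prop
  have hl0 : (fun t : ℝ ↦ t • y) 0 = 0 := by simp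
  have hGl : ContinuousAt (fun t : ℝ ↦ G (t • y)) 0 := ContinuousAt.comp_of_eq hG hl hl0
  have h1 := eq_zero_of_mul_eventually_eq_zero (f := fun t : ℝ ↦ G (t • y) v (L y) - c y)
    (((hGl.clm_apply continuousAt_const).clm_apply continuousAt_const).sub continuousAt_const) (by
      have h' : ∀ᶠ t : ℝ in 𝓝 0, G (t • y) v (L (t • y)) = c (t • y) := by
        have h0 : ∀ᶠ y' in 𝓝 ((fun t : ℝ ↦ t • y) 0), G y' v (L y') = c y' := by rwa [hl0]
        exact hl.tendsto.eventually h0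
      filter_upwards [h'] with t ht
      rw [map_smul, map_smul, hc, smul_eq_mul] at ht
      linarith)
  simpa [sub_eq_zero] using h1

variable {G : Eu k × Eu m → Eu k × Eu m →L[ℝ] Eu k × Eu m →L[ℝ] ℝ}
  {h : Matrix (Fin k ⊕ Fin m) (Fin k ⊕ Fin m) ℝ}

lemma tangential_condition_iff (hsymm : ∀ z v w, G z v w = G z w v)
    (hG0 : ∀ i j, G 0 (coordVector i) (coordVector j) = h i j) (x : Eu k) :
    (∀ a, ∑ b, G (x, 0) (coordVector (Sum.inl a)) (coordVector (Sum.inl b)) * x b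
      = ∑ b, h (Sum.inl a) (Sum.inl b) * x b) ↔
    ∀ v, G (x, 0) (x, 0) (v, 0) = G 0 (x, 0) (v, 0) := by
  have e := forall_coordVector_inl (L := G (x, 0) (x, 0) - G 0 (x, 0))
  simp only [sub_apply, sub_eq_zero] at e
  rw [← e]
  simp only [← hG0, sum_apply_mul_inl, hsymm _ (coordVector _) (x, 0)]

/-- (B) and (D) are the vertical and horizontal components of one Gauss identity; orthogonality of
the blocks of `h` makes the horizontal right-hand side zero. -/
lemma normal_condition_iff (hh : IsReferenceForm h) (hsymm : ∀ z v w, G z v w = G z w v)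
    (hG0 : ∀ i j, G 0 (coordVector i) (coordVector j) = h i j) (z : Eu k × Eu m) :
    ((∀ a, ∑ b, G z (coordVector (Sum.inr a)) (coordVector (Sum.inr b)) * z.2 b
      = ∑ b, h (Sum.inr a) (Sum.inr b) * z.2 b) ∧
      ∀ c, ∑ a, G z (coordVector (Sum.inl c)) (coordVector (Sum.inr a)) * z.2 a = 0) ↔
    ∀ w, G z (0, z.2) w = G 0 (0, z.2) w := by
  have h0 : ∀ c, G 0 (0, z.2) (coordVector (Sum.inl c)) = 0 := fun c ↦ by
    rw [hsymm, ← sum_apply_mul_inr]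
    exact Finset.sum_eq_zero fun a _ ↦ by rw [hG0, hh.orthogonal, zero_mul]
  have e := forall_coordVector_inl (L := G z (0, z.2) - G 0 (0, z.2))
  have e' := forall_coordVector_inr (L := G z (0, z.2) - G 0 (0, z.2))
  simp only [sub_apply, sub_eq_zero, h0] at e e'
  simp only [← hG0, sum_apply_mul_inr, hsymm _ (coordVector _) (0, z.2), e, e']
  refine ⟨fun H w ↦ ?_, fun H ↦ ⟨fun v ↦ H _, fun u ↦ H _⟩⟩
  have hw : w = (w.1, 0) + (0, w.2) := by simp
  rw [hw, map_add, map_add, H.1, H.2]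

lemma mixed_condition_iff (hsymm : ∀ z v w, G z v w = G z w v) {x : Eu k}
    (hG : DifferentiableAt ℝ G (x, 0)) :
    (∀ a b, ∑ c, fderiv ℝ (fun z ↦ G z (coordVector (Sum.inl c)) (coordVector (Sum.inr a))) (x, 0)
      (coordVector (Sum.inr b)) * x c = 0) ↔
    ∀ u u', fderiv ℝ G (x, 0) (0, u) (x, 0) (0, u') = 0 := by
  have hd : ∀ v w y, fderiv ℝ (fun z ↦ G z v w) (x, 0) y = fderiv ℝ G (x, 0) y v w := by
    intro v w y
    rw [((hG.hasFDerivAt.clm_apply (hasFDerivAt_const v _)).clm_apply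
      (hasFDerivAt_const w _)).fderiv]
    simp
  have hs := fderiv_apply_symm hsymm hG
  have e : ∀ a b, ∑ c, fderiv ℝ (fun z ↦ G z (coordVector (Sum.inl c)) (coordVector (Sum.inr a)))
      (x, 0) (coordVector (Sum.inr b)) * x c =
        (fderiv ℝ G (x, 0) (coordVector (Sum.inr b))) (coordVector (Sum.inr a)) (x, 0) := by
    intro a b
    rw [← sum_apply_mul_inl]
    exact Finset.sum_congr rfl fun c _ ↦ by rw [hd, hs]
  simp only [e]
  constructor
  · intro H u u'
    have h1 : ∀ b, (fderiv ℝ G (x, 0)) (coordVector (Sum.inr b)) (x, 0) (0, u') = 0 := fun b ↦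
      forall_coordVector_inr (L := fderiv ℝ G (x, 0) (coordVector (Sum.inr b)) (x, 0)).1
        (fun a ↦ by rw [hs, H]) u'
    exact forall_coordVector_inr (L := ((fderiv ℝ G (x, 0)).flip (x, 0)).flip (0, u')).1 h1 u
  · intro H a b
    rw [hs]
    exact H _ _

end Frames

/-! ### The characterization -/

section Characterization

set_option maxSynthPendingDepth 3

variable {k m : ℕ} {M : Type*} [TopologicalSpace M] [ChartedSpace (Eu (k + m)) M]
  {S : Type*} [TopologicalSpace S] [ChartedSpace (Eu k) S] [IsManifold 𝓘(ℝ, Eu k) ∞ S]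
  {g : BilinField (Eu (k + m)) M} {ι : S → M} {p : S}
  {φ : OpenPartialHomeomorph M (Eu k × Eu m)}

/-- The hypothesis supplies a geodesic, which is rescaled by r = 0. -/
lemma IsExp.zero {E : Type*} [NormedAddCommGroup E] [NormedSpace ℝ E] [FiniteDimensional ℝ E]
    {N : Type*} [TopologicalSpace N] [ChartedSpace E N] [IsManifold 𝓘(ℝ, E) ∞ N]
    {g : BilinField E N} (hg : IsRegularMetric g) {q a : N} {v : TangentSpace 𝓘(ℝ, E) q}
    (h : IsExp g q v a) : IsExp g q 0 q := by
  obtain ⟨c, ⟨⟨ε, hε, hc⟩, hc0⟩, -⟩ := h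
  have h0 := IsGeodesicFrom.comp_mul hg hc hc0 (r := 0) ⟨by linarith, by linarith⟩ hε
  rw [zero_smul] at h0
  have hcq : c 0 = q := congrArg (fun p ↦ p.1) hc0
  exact ⟨_, h0, by rw [zero_mul, hcq]⟩

lemma metricInCoords_normal (hι : IsEmbeddedSubmanifold (E := Eu (k + m)) (E' := Eu k) ι)
    (hφ : IsCoordinateSystem (E := Eu (k + m)) φ)
    (hS : ∀ q ∈ φ.source, q ∈ range ι ↔ (φ q).2 = 0) {y : S} (hy : ι y ∈ φ.source)
    (v : Eu (k + m)) :
    IsNormal (E' := Eu k) g ι y v ↔ ∀ w, metricInCoords g φ (φ (ι y))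
      (tangentMapAt (Eu (k + m)) (Eu k × Eu m) φ (ι y) v) (w, 0) = 0 := by
  have hψ : IsCoordinateSystem (E := Eu k) (sliceChart hι.isEmbedding φ hS y) :=
    isCoordinateSystem_sliceChart hι hφ
  have key : ∀ w : Eu k, metricInCoords g φ (φ (ι y))
      (tangentMapAt (Eu (k + m)) (Eu k × Eu m) φ (ι y) v)
      (tangentMapAt (Eu k) (Eu k) (sliceChart hι.isEmbedding φ hS y) y w, 0) =
        g.at (ι y) v (tangentMapAt (Eu k) (Eu (k + m)) ι y w) := by
    intro w
    rw [← tangentMapAt_tangentMapAt_eq hι.contMDiff hφ hy, hφ.metricInCoords_tangentMapAt g hy]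
  constructor
  · intro h w
    obtain ⟨w, rfl⟩ := hψ.tangentMapAt_surjective (q := y) hy w
    rw [key]
    exact h w
  · intro h w
    exact (key w).symm.trans (h _)

end Characterization

/-! ### Exponential maps and coordinate lines. -/

section Characterization

set_option maxSynthPendingDepth 3

variable {k m : ℕ} {M : Type*} [TopologicalSpace M] [T2Space M] [ChartedSpace (Eu (k + m)) M]
  [IsManifold 𝓘(ℝ, Eu (k + m)) ∞ M]
  {S : Type*} [TopologicalSpace S] [ChartedSpace (Eu k) S] [IsManifold 𝓘(ℝ, Eu k) ∞ S]
  {g : BilinField (Eu (k + m)) M} {ι : S → M} {p : S}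
  {φ : OpenPartialHomeomorph M (Eu k × Eu m)}

/-- The definition gives only some foot point y for each (x, u). At (x, 0) the ambient exponential
is that of the zero vector, so ι y has coordinates (x, 0); uniqueness of the exponential of `S`
gives the same y for every u. -/
lemma exists_ball_isExp (hg : IsRegularMetric g)
    (hι : IsEmbeddedSubmanifold (E := Eu (k + m)) (E' := Eu k) ι)
    (hgS : IsRegularMetric (pullback ι g : BilinField (Eu k) S))
    (hS : ∀ q ∈ φ.source, q ∈ range ι ↔ (φ q).2 = 0) (h0 : (0 : Eu k × Eu m) ∈ φ.target)
    {e : Fin k → TangentSpace 𝓘(ℝ, Eu k) p}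
    {N : Fin m → (y : S) → TangentSpace 𝓘(ℝ, Eu (k + m)) (ι y)}
    (hexp : ∀ᶠ z : Eu k × Eu m in 𝓝 0, ∃ y : S,
      IsExp (pullback ι g) p (∑ a, z.1 a • e a) y ∧
      IsExp g (ι y) (∑ a, z.2 a • N a y) (φ.symm z)) :
    ∃ r > 0, Metric.ball (0 : Eu k × Eu m) r ⊆ φ.target ∧
      ∀ z ∈ Metric.ball (0 : Eu k × Eu m) r,
        IsExp (pullback ι g) p (∑ a, z.1 a • e a) ((sliceChart hι.isEmbedding φ hS p).symm z.1) ∧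
        IsExp g (ι ((sliceChart hι.isEmbedding φ hS p).symm z.1))
          (∑ a, z.2 a • N a ((sliceChart hι.isEmbedding φ hS p).symm z.1)) (φ.symm z) := by
  have : T2Space S := hι.isEmbedding.t2Space
  obtain ⟨r, hr, hball⟩ := Metric.eventually_nhds_iff_ball.1
    (hexp.and (φ.open_target.mem_nhds h0))
  refine ⟨r, hr, fun z hz ↦ (hball z hz).2, fun z hz ↦ ?_⟩
  have hz' := mem_ball_of_fst hz
  obtain ⟨⟨y, hy1, hy2⟩, htar⟩ := hball _ hz'
  have hsum : ∑ a, (0 : Eu m) a • N a y = 0 := by simp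
  have hy0 : ι y = φ.symm (z.1, 0) := IsExp.unique hg (hy2.zero hg) (hsum ▸ hy2)
  have hy : (sliceChart hι.isEmbedding φ hS p).symm z.1 = y :=
    hι.isEmbedding.injective ((apply_sliceChart_symm htar).trans hy0.symm)
  obtain ⟨⟨y', hy1', hy2'⟩, -⟩ := hball z hz
  have hyy' : y = y' := IsExp.unique hgS hy1 hy1'
  subst hyy'
  rw [hy]
  exact ⟨hy1', hy2'⟩

/-- In geodesic normal coordinates the lines `t ↦ (t x, 0)` and `t ↦ (x, t u)` are geodesics. -/
lemma geodesic_lines (hg : IsRegularMetric g)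
    (hι : IsEmbeddedSubmanifold (E := Eu (k + m)) (E' := Eu k) ι)
    (hgS : IsRegularMetric (pullback ι g : BilinField (Eu k) S))
    (hφ : IsCoordinateSystem (E := Eu (k + m)) φ)
    (hS : ∀ q ∈ φ.source, q ∈ range ι ↔ (φ q).2 = 0)
    {e : Fin k → TangentSpace 𝓘(ℝ, Eu k) p}
    {N : Fin m → (y : S) → TangentSpace 𝓘(ℝ, Eu (k + m)) (ι y)} {r : ℝ} (hr : 0 < r)
    (htar : Metric.ball (0 : Eu k × Eu m) r ⊆ φ.target)
    (hexp : ∀ z ∈ Metric.ball (0 : Eu k × Eu m) r,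
      IsExp (pullback ι g) p (∑ a, z.1 a • e a) ((sliceChart hι.isEmbedding φ hS p).symm z.1) ∧
      IsExp g (ι ((sliceChart hι.isEmbedding φ hS p).symm z.1))
        (∑ a, z.2 a • N a ((sliceChart hι.isEmbedding φ hS p).symm z.1)) (φ.symm z)) :
    (∀ a, tangentMapAt (Eu k) (Eu k) (sliceChart hι.isEmbedding φ hS p) p (e a)
      = EuclideanSpace.single a 1) ∧
    (∀ x ∈ Metric.ball (0 : Eu k) r, christoffel
      (metricInCoords (E := Eu k) (pullback ι g) (sliceChart hι.isEmbedding φ hS p)) x x x = 0) ∧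
    (∀ x ∈ Metric.ball (0 : Eu k) r, ∀ a, tangentMapAt (Eu (k + m)) (Eu k × Eu m) φ
      (ι ((sliceChart hι.isEmbedding φ hS p).symm x))
      (N a ((sliceChart hι.isEmbedding φ hS p).symm x)) = coordVector (Sum.inr a)) ∧
    (∀ z ∈ Metric.ball (0 : Eu k × Eu m) r,
      christoffel (metricInCoords g φ) z (0, z.2) (0, z.2) = 0) := by
  have : T2Space S := hι.isEmbedding.t2Space
  set ψ := sliceChart hι.isEmbedding φ hS p with hψ_def
  have hψ : IsCoordinateSystem (E := Eu k) ψ := isCoordinateSystem_sliceChart hι hφ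
  have hmem : ∀ x ∈ Metric.ball (0 : Eu k) r, (x, (0 : Eu m)) ∈ Metric.ball 0 r :=
    fun x hx ↦ prodMk_zero_mem_ball hx
  have htarS : Metric.ball (0 : Eu k) r ⊆ ψ.target := fun x hx ↦ htar (hmem x hx)
  have hrad : ∀ x ∈ Metric.ball (0 : Eu k) r,
      tangentMapAt (Eu k) (Eu k) ψ p (∑ a, x a • e a) = x ∧
        christoffel (metricInCoords (E := Eu k) (pullback ι g) ψ) x x x = 0 := by
    intro x hx
    have h := christoffel_eq_zero_of_isExp hgS hψ (z := 0) (w := x) (q := p)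
      (v := ∑ a, x a • e a) Metric.isOpen_ball htarS (Metric.mem_ball_self hr) (by simpa using hx)
      (by
        intro s hs
        rw [zero_add] at hs ⊢
        have e1 : s • ∑ a, x a • e a = ∑ a, (s • x) a • e a := by
          simp [Finset.smul_sum, smul_smul]
        rw [e1]
        exact (hexp _ (hmem _ hs)).1)
    rw [zero_add] at h
    exact h.2
  have hvert : ∀ z ∈ Metric.ball (0 : Eu k × Eu m) r,
      tangentMapAt (Eu (k + m)) (Eu k × Eu m) φ (ι (ψ.symm z.1))
        (∑ a, z.2 a • N a (ψ.symm z.1)) = (0, z.2) ∧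
        christoffel (metricInCoords g φ) z (0, z.2) (0, z.2) = 0 := by
    intro z hz
    have hzz : (z.1, (0 : Eu m)) + ((0 : Eu k), z.2) = z := by simp
    have h := christoffel_eq_zero_of_isExp hg hφ (z := (z.1, 0)) (w := (0, z.2))
      (q := ι (ψ.symm z.1)) (v := ∑ a, z.2 a • N a (ψ.symm z.1)) Metric.isOpen_ball htar
      (mem_ball_of_fst hz) (by rwa [hzz])
      (by
        intro s hs
        have hzs : (z.1, (0 : Eu m)) + s • ((0 : Eu k), z.2) = (z.1, s • z.2) := by simp
        rw [hzs] at hs ⊢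
        have e1 : s • ∑ a, z.2 a • N a (ψ.symm z.1) = ∑ a, (s • z.2) a • N a (ψ.symm z.1) := by
          simp [Finset.smul_sum, smul_smul]
        rw [e1]
        exact (hexp _ hs).2)
    rw [hzz] at h
    exact h.2
  refine ⟨fun a ↦ ?_, fun x hx ↦ (hrad x hx).2, fun x hx a ↦ ?_, fun z hz ↦ (hvert z hz).2⟩
  · exact apply_frame_eq (tangentMapAt (Eu k) (Eu k) ψ p).toLinearMap (V := Eu k) e
      LinearMap.id hr (fun x hx ↦ (hrad x (by simpa using hx)).1) a
  · refine apply_frame_eq (V := Eu (k + m))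
      (tangentMapAt (Eu (k + m)) (Eu k × Eu m) φ (ι (ψ.symm x))).toLinearMap
      (fun a ↦ N a (ψ.symm x)) (LinearMap.inr ℝ (Eu k) (Eu m)) hr (fun u hu ↦ ?_) a
    refine (hvert (x, u) ?_).1
    rw [mem_ball_zero_iff] at hx ⊢
    simpa [Prod.norm_def] using ⟨hx, hu⟩

end Characterization

/-! ### Radial geodesics and the parallel normal frame. -/

section Characterization

set_option maxSynthPendingDepth 3

variable {k m : ℕ} {M : Type*} [TopologicalSpace M] [ChartedSpace (Eu (k + m)) M]
  [IsManifold 𝓘(ℝ, Eu (k + m)) ∞ M]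
  {S : Type*} [TopologicalSpace S] [ChartedSpace (Eu k) S] [IsManifold 𝓘(ℝ, Eu k) ∞ S]
  {g : BilinField (Eu (k + m)) M} {ι : S → M} {p : S}
  {φ : OpenPartialHomeomorph M (Eu k × Eu m)}

/-- Geodesics must exist on an open interval around [0, 1]. Choosing (-1, 2) costs a factor 2 in the
radius, whence the balls of radius r / 2. -/
lemma smul_mem_ball_of_mem_Ioo {F : Type*} [NormedAddCommGroup F] [NormedSpace ℝ F] {r : ℝ} {x : F}
    (hx : x ∈ Metric.ball (0 : F) (r / 2)) {t : ℝ} (ht : t ∈ Ioo (-1 : ℝ) 2) :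
    t • x ∈ Metric.ball (0 : F) r := by
  rw [mem_ball_zero_iff] at hx ⊢
  have h1 : |t| ≤ 2 := abs_le.2 ⟨by linarith [ht.1], ht.2.le⟩
  rw [norm_smul, Real.norm_eq_abs]
  nlinarith [norm_nonneg x, abs_nonneg t]

lemma map_sum_smul_frame {V W : Type*} [AddCommGroup V] [Module ℝ V] [AddCommGroup W] [Module ℝ W]
    {n : ℕ} (T : V →ₗ[ℝ] W) {f : Fin n → V} {b : Fin n → W} (h : ∀ a, T (f a) = b a) (x : Eu n) :
    T (∑ a, x a • f a) = ∑ a, x a • b a := by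
  simp [h]

lemma isGeodesicFrom_radial {N : Type*} [TopologicalSpace N] [ChartedSpace (Eu k) N]
    [IsManifold 𝓘(ℝ, Eu k) ∞ N] {g : BilinField (Eu k) N} (hg : IsRegularMetric g)
    {ψ : OpenPartialHomeomorph N (Eu k)} (hψ : IsCoordinateSystem (E := Eu k) ψ) {p : N}
    (hp : p ∈ ψ.source) (hp0 : ψ p = 0) {e : Fin k → TangentSpace 𝓘(ℝ, Eu k) p} {r : ℝ}
    (htar : Metric.ball (0 : Eu k) r ⊆ ψ.target)
    (he : ∀ a, tangentMapAt (Eu k) (Eu k) ψ p (e a) = EuclideanSpace.single a 1)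
    (hgeo : ∀ x ∈ Metric.ball (0 : Eu k) r, christoffel (metricInCoords g ψ) x x x = 0)
    {x : Eu k} (hx : x ∈ Metric.ball (0 : Eu k) (r / 2)) :
    IsGeodesicFrom g p (∑ a, x a • e a) (fun t ↦ ψ.symm (0 + t • x)) := by
  have hmem : ∀ t ∈ Ioo (-1 : ℝ) 2, 0 + t • x ∈ Metric.ball (0 : Eu k) r := fun t ht ↦ by
    rw [zero_add]
    exact smul_mem_ball_of_mem_Ioo hx ht
  refine hg.isGeodesicFrom hψ hp hp0 ?_ (fun t ht ↦ htar (hmem t ht)) fun t ht ↦ ?_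
  · refine (map_sum_smul_frame (tangentMapAt (Eu k) (Eu k) ψ p).toLinearMap (V := Eu k) he
      x).trans ?_
    exact sum_smul_single x
  · refine christoffel_line_eq_zero Metric.isOpen_ball (fun z hz ↦ hg.contDiffAt hψ (htar hz))
      (fun z hz ↦ hψ.metricInCoords_nondegenerate hg.nondegenerate (htar hz)) (fun t ht ↦ ?_)
      (hmem t ht)
    rw [zero_add] at ht ⊢
    exact hgeo _ ht

/-- Parallelism is assumed along every radial geodesic, in particular along the coordinate line,
where the frame has constant components. Linearity of Γ in its last argument passes from the frame
to all u. -/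
lemma christoffel_mixed_of_parallel (hg : IsRegularMetric g)
    (hι : IsEmbeddedSubmanifold (E := Eu (k + m)) (E' := Eu k) ι)
    (hgS : IsRegularMetric (pullback ι g : BilinField (Eu k) S))
    (hφ : IsCoordinateSystem (E := Eu (k + m)) φ)
    (hS : ∀ q ∈ φ.source, q ∈ range ι ↔ (φ q).2 = 0)
    (hp : ι p ∈ φ.source) (hp0 : φ (ι p) = 0)
    {e : Fin k → TangentSpace 𝓘(ℝ, Eu k) p}
    {N : Fin m → (y : S) → TangentSpace 𝓘(ℝ, Eu (k + m)) (ι y)} {r : ℝ}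
    (htar : Metric.ball (0 : Eu k × Eu m) r ⊆ φ.target)
    (he : ∀ a, tangentMapAt (Eu k) (Eu k) (sliceChart hι.isEmbedding φ hS p) p (e a)
      = EuclideanSpace.single a 1)
    (hgeo : ∀ x ∈ Metric.ball (0 : Eu k) r, christoffel
      (metricInCoords (E := Eu k) (pullback ι g) (sliceChart hι.isEmbedding φ hS p)) x x x = 0)
    (hN : ∀ x ∈ Metric.ball (0 : Eu k) r, ∀ a, tangentMapAt (Eu (k + m)) (Eu k × Eu m) φ
      (ι ((sliceChart hι.isEmbedding φ hS p).symm x))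
      (N a ((sliceChart hι.isEmbedding φ hS p).symm x)) = coordVector (Sum.inr a))
    {x : Eu k} (hx : x ∈ Metric.ball (0 : Eu k) (r / 2))
    (hpar : ∀ γ : ℝ → S, IsGeodesicFrom (pullback ι g) p (∑ b, x b • e b) γ →
      ∀ a, ∀ t ∈ Icc (0 : ℝ) 1, IsNormalParallelAt (E' := Eu k) g ι (N a) γ t)
    (u : Eu m) {s : ℝ} (hs : s ∈ Icc (0 : ℝ) 1) :
    (christoffel (metricInCoords g φ) (s • x, 0) (x, 0) (0, u)).2 = 0 := by
  set ψ := sliceChart hι.isEmbedding φ hS p with hψ_def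
  have hψ : IsCoordinateSystem (E := Eu k) ψ := isCoordinateSystem_sliceChart hι hφ
  have htar' : ∀ x ∈ Metric.ball (0 : Eu k) r, (x, (0 : Eu m)) ∈ φ.target :=
    fun x hx ↦ htar (prodMk_zero_mem_ball hx)
  have hψp : ψ p = 0 := congrArg Prod.fst hp0
  have hγ := isGeodesicFrom_radial hgS hψ (p := p) hp hψp htar' he hgeo hx
  have hs' : s ∈ Ioo (-1 : ℝ) 2 := ⟨by linarith [hs.1], by linarith [hs.2]⟩
  have hmem : ∀ t ∈ Ioo (-1 : ℝ) 2, 0 + t • x ∈ Metric.ball (0 : Eu k) r := fun t ht ↦ by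
    rw [zero_add]
    exact smul_mem_ball_of_mem_Ioo hx ht
  have hlift : ∀ t ∈ Ioo (-1 : ℝ) 2, ι (ψ.symm (0 + t • x)) = φ.symm (0 + t • x, 0) :=
    fun t ht ↦ apply_sliceChart_symm (htar' _ (hmem t ht))
  have hline : ContMDiff 𝓘(ℝ, ℝ) 𝓘(ℝ, Eu k) ∞ (fun t : ℝ ↦ 0 + t • x) :=
    contMDiff_iff_contDiff.2 (by fun_prop)
  have hγd : MDifferentiableAt 𝓘(ℝ, ℝ) 𝓘(ℝ, Eu k) (fun t : ℝ ↦ ψ.symm (0 + t • x)) s :=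
    (hψ.mdifferentiableAt_symm (htar' _ (hmem s hs'))).comp s
      (hline.contMDiffAt.mdifferentiableAt (by simp))
  have hsrc : ι (ψ.symm (0 + s • x)) ∈ φ.source := by
    rw [hlift s hs']
    exact φ.map_target (htar' _ (hmem s hs'))
  have key : ∀ a, (christoffel (metricInCoords g φ) (s • x, 0) (x, 0)
      (coordVector (Sum.inr a))).2 = 0 := by
    intro a
    refine (isNormalParallelAt_iff hι hφ hS hg (N := N a) hγd hsrc ?_ ?_).1 (hpar _ hγ a s hs)
    · filter_upwards [isOpen_Ioo.mem_nhds hs'] with t ht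
      rw [hlift t ht, φ.right_inv (htar' _ (hmem t ht)), zero_add]
    · filter_upwards [isOpen_Ioo.mem_nhds hs'] with t ht using hN _ (hmem t ht) a
  rw [← sum_smul_coordVector_inr, christoffel_sum_right, Prod.snd_sum]
  exact Finset.sum_eq_zero fun a _ ↦ by rw [Prod.smul_snd, key, smul_zero]

end Characterization

/-! ### Normal coordinates imply the metric identities. -/

section Characterization

set_option maxSynthPendingDepth 3

variable {k m : ℕ} {M : Type*} [TopologicalSpace M] [T2Space M] [ChartedSpace (Eu (k + m)) M]
  [IsManifold 𝓘(ℝ, Eu (k + m)) ∞ M]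
  {S : Type*} [TopologicalSpace S] [ChartedSpace (Eu k) S] [IsManifold 𝓘(ℝ, Eu k) ∞ S]
  {g : BilinField (Eu (k + m)) M} {ι : S → M} {p : S}
  {φ : OpenPartialHomeomorph M (Eu k × Eu m)}

/-- The metric in submanifold geodesic normal coordinates. -/
lemma metric_of_isSubmanifoldGeodesicNormal (hg : IsRegularMetric g)
    (hι : IsEmbeddedSubmanifold (E := Eu (k + m)) (E' := Eu k) ι)
    (hgS : IsRegularMetric (pullback ι g : BilinField (Eu k) S))
    (hφ : IsCoordinateSystem (E := Eu (k + m)) φ)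
    (hS : ∀ q ∈ φ.source, q ∈ range ι ↔ (φ q).2 = 0)
    (hp : ι p ∈ φ.source) (hp0 : φ (ι p) = 0)
    {e : Fin k → TangentSpace 𝓘(ℝ, Eu k) p}
    {e' : Fin m → TangentSpace 𝓘(ℝ, Eu (k + m)) (ι p)}
    (h : IsSubmanifoldGeodesicNormal g ι p e e' φ) :
    (∀ a, tangentMapAt (Eu k) (Eu k) (sliceChart hι.isEmbedding φ hS p) p (e a)
      = EuclideanSpace.single a 1) ∧
    (∀ a, tangentMapAt (Eu (k + m)) (Eu k × Eu m) φ (ι p) (e' a) = coordVector (Sum.inr a)) ∧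
    ∃ r > 0, Metric.ball (0 : Eu k × Eu m) r ⊆ φ.target ∧
      (∀ u w, metricInCoords g φ 0 (0, u) (w, 0) = 0) ∧
      (∀ z ∈ Metric.ball (0 : Eu k × Eu m) r, ∀ v, metricInCoords g φ (z.1, 0) (z.1, 0) (v, 0) =
        metricInCoords g φ 0 (z.1, 0) (v, 0)) ∧
      (∀ z ∈ Metric.ball (0 : Eu k × Eu m) r, ∀ w,
        metricInCoords g φ z (0, z.2) w = metricInCoords g φ 0 (0, z.2) w) ∧
      ∀ z ∈ Metric.ball (0 : Eu k × Eu m) r, ∀ u u',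
        fderiv ℝ (metricInCoords g φ) (z.1, 0) (0, u) (z.1, 0) (0, u') = 0 := by
  obtain ⟨N, hN, hexp⟩ := h
  have h0 : (0 : Eu k × Eu m) ∈ φ.target := hp0 ▸ φ.map_source hp
  obtain ⟨r, hr, htar, hexp⟩ := exists_ball_isExp hg hι hgS hS h0 hexp
  obtain ⟨he, hgeoS, hNφ, hgeo⟩ := geodesic_lines hg hι hgS hφ hS hr htar hexp
  set ψ := sliceChart hι.isEmbedding φ hS p with hψ_def
  have hψ : IsCoordinateSystem (E := Eu k) ψ := isCoordinateSystem_sliceChart hι hφ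
  have hψp : ψ p = 0 := congrArg Prod.fst hp0
  have hψ0 : ψ.symm 0 = p := by rw [← hψp]; exact ψ.left_inv hp
  have h0S : (0 : Eu k) ∈ ψ.target := h0
  have hev1 : ∀ᶠ x : Eu k in 𝓝 0, ∀ a, IsNormal (E' := Eu k) g ι (ψ.symm x) (N a (ψ.symm x)) := by
    have hc : Tendsto ψ.symm (𝓝 0) (𝓝 p) := by
      have := (ψ.continuousAt_symm h0S).tendsto
      rwa [hψ0] at this
    exact hc.eventually (eventually_all.2 hN.normal)
  obtain ⟨r', hr', hball⟩ := Metric.eventually_nhds_iff_ball.1 (hev1.and hN.parallel)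
  -- r' is the radius on which the frame is normal and radially parallel; r / 2 keeps radial lines
  -- inside the ball of radius r for times in (-1, 2).
  set ρ := min (r / 2) r' with hρ
  have hρ0 : 0 < ρ := lt_min (by positivity) hr'
  have hρr2 : ρ ≤ r / 2 := min_le_left _ _
  have hρr : ρ ≤ r := hρr2.trans (by linarith)
  have hfst : ∀ z ∈ Metric.ball (0 : Eu k × Eu m) ρ, z.1 ∈ Metric.ball (0 : Eu k) ρ := by
    intro z hz
    rw [mem_ball_zero_iff] at hz ⊢
    exact (norm_fst_le z).trans_lt hz
  have hsub : Metric.ball (0 : Eu k × Eu m) ρ ⊆ Metric.ball 0 r := Metric.ball_subset_ball hρr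
  have hsubS : Metric.ball (0 : Eu k) ρ ⊆ Metric.ball 0 r := Metric.ball_subset_ball hρr
  have hlift : ∀ x ∈ Metric.ball (0 : Eu k) ρ, (x, (0 : Eu m)) ∈ φ.target :=
    fun x hx ↦ htar (hsub (prodMk_zero_mem_ball hx))
  have hperp : ∀ z ∈ Metric.ball (0 : Eu k × Eu m) ρ, z.2 = 0 → ∀ u a,
      metricInCoords g φ z (0, u) (a, 0) = 0 := by
    intro z hz hz2 u w
    have hx := hfst z hz
    have hιx : ι (ψ.symm z.1) = φ.symm (z.1, 0) := apply_sliceChart_symm (hlift _ hx)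
    have hsrc : ι (ψ.symm z.1) ∈ φ.source := hιx ▸ φ.map_target (hlift _ hx)
    have hφx : φ (ι (ψ.symm z.1)) = z := by
      rw [hιx, φ.right_inv (hlift _ hx)]
      exact Prod.ext rfl hz2.symm
    refine forall_coordVector_inr (L := (metricInCoords g φ z).flip (w, 0)).1 (fun a ↦ ?_) u
    have h := (metricInCoords_normal (g := g) hι hφ hS hsrc _).1
      ((hball z.1 (Metric.ball_subset_ball (min_le_right _ _) hx)).1 a) w
    rw [hφx] at h
    rw [← hNφ z.1 (hsubS hx) a]
    exact h
  have hpar : ∀ z ∈ Metric.ball (0 : Eu k × Eu m) ρ, ∀ u, ∀ s ∈ Icc (0 : ℝ) 1,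
      (christoffel (metricInCoords g φ) (s • z.1, 0) (z.1, 0) (0, u)).2 = 0 := by
    intro z hz u s hs
    have hx := hfst z hz
    exact christoffel_mixed_of_parallel hg hι hgS hφ hS hp hp0 htar he hgeoS hNφ
      (Metric.ball_subset_ball hρr2 hx)
      (hball z.1 (Metric.ball_subset_ball (min_le_right _ _) hx)).2 u hs
  have hG : ∀ z ∈ Metric.ball (0 : Eu k × Eu m) ρ, DifferentiableAt ℝ (metricInCoords g φ) z :=
    fun z hz ↦ (hg.contDiffAt hφ (htar (hsub hz))).differentiableAt (by simp)
  have hsymm : ∀ z v w, metricInCoords g φ z v w = metricInCoords g φ z w v :=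
    metricInCoords_symm hg.symm
  have hnd : ∀ z ∈ Metric.ball (0 : Eu k × Eu m) ρ, ∀ v,
      (∀ w, metricInCoords g φ z v w = 0) → v = 0 :=
    fun z hz ↦ hφ.metricInCoords_nondegenerate hg.nondegenerate (htar (hsub hz))
  have hvert := apply_vertical_eq hG hsymm hnd (fun z hz ↦ hgeo z (hsub hz)) hperp hpar
  have hz0 : (0 : Eu k × Eu m) ∈ Metric.ball 0 ρ := Metric.mem_ball_self hρ0
  have hrad := apply_radial_eq (r := ρ)
    (fun x hx ↦ (hgS.contDiffAt hψ (hlift x hx)).differentiableAt (by simp))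
    (metricInCoords_symm hgS.symm)
    (fun x hx ↦ hψ.metricInCoords_nondegenerate hgS.nondegenerate (hlift x hx))
    (fun x hx ↦ hgeoS x (hsubS hx))
  refine ⟨he, fun a ↦ ?_, ρ, hρ0, hsub.trans htar, hperp 0 hz0 rfl, fun z hz v ↦ ?_, hvert,
    fun z hz u u' ↦ fderiv_mixed_eq_zero hG hsymm hnd hperp hpar hvert (mem_ball_of_fst hz) u u'⟩
  · have h := hNφ 0 (Metric.mem_ball_self hr) a
    rw [hψ0, hN.eq_at] at h
    exact h
  · have h := hrad z.1 (hfst z hz) v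
    rw [metricInCoords_sliceChart hι hφ g (hlift _ (hfst z hz)),
      metricInCoords_sliceChart hι hφ g (hlift _ (Metric.mem_ball_self hρ0))] at h
    exact h

end Characterization

/-! ### The metric identities imply normal coordinates. -/

section Converse

set_option maxSynthPendingDepth 3

variable {k m : ℕ} {M : Type*} [TopologicalSpace M] [ChartedSpace (Eu (k + m)) M]
  {S : Type*}
  {g : BilinField (Eu (k + m)) M} {ι : S → M} {p : S}
  {φ : OpenPartialHomeomorph M (Eu k × Eu m)}

lemma linearIndependent_single {n : ℕ} :
    LinearIndependent ℝ (fun a : Fin n ↦ (EuclideanSpace.single a 1 : Eu n)) := by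
  have h : (fun a : Fin n ↦ (EuclideanSpace.single a 1 : Eu n)) =
      (EuclideanSpace.basisFun (Fin n) ℝ).toBasis := by
    ext1 a
    simp
  rw [h]
  exact Module.Basis.linearIndependent _

lemma isAdaptedFrame_of_metricInCoords
    [TopologicalSpace S] [ChartedSpace (Eu k) S] [IsManifold 𝓘(ℝ, Eu k) ∞ S]
    (hι : IsEmbeddedSubmanifold (E := Eu (k + m)) (E' := Eu k) ι)
    (hφ : IsCoordinateSystem (E := Eu (k + m)) φ)
    (hS : ∀ q ∈ φ.source, q ∈ range ι ↔ (φ q).2 = 0)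
    (hp : ι p ∈ φ.source) (hp0 : φ (ι p) = 0)
    {h : Matrix (Fin k ⊕ Fin m) (Fin k ⊕ Fin m) ℝ}
    (hG0 : ∀ i j, metricInCoords g φ 0 (coordVector i) (coordVector j) = h i j)
    (hperp : ∀ u w, metricInCoords g φ 0 (0, u) (w, 0) = 0)
    {e : Fin k → TangentSpace 𝓘(ℝ, Eu k) p}
    {e' : Fin m → TangentSpace 𝓘(ℝ, Eu (k + m)) (ι p)}
    (he : ∀ a, tangentMapAt (Eu (k + m)) (Eu k × Eu m) φ (ι p)
      (tangentMapAt (Eu k) (Eu (k + m)) ι p (e a)) = coordVector (Sum.inl a))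
    (he' : ∀ a, tangentMapAt (Eu (k + m)) (Eu k × Eu m) φ (ι p) (e' a) = coordVector (Sum.inr a)) :
    IsAdaptedFrame g ι p h e e' := by
  have hinner : ∀ v w : Eu (k + m), g.at (ι p) v w = metricInCoords g φ 0
      (tangentMapAt (Eu (k + m)) (Eu k × Eu m) φ (ι p) v)
      (tangentMapAt (Eu (k + m)) (Eu k × Eu m) φ (ι p) w) := fun v w ↦ by
    rw [← hp0]
    exact (hφ.metricInCoords_tangentMapAt g hp v w).symm
  refine ⟨?_, ?_, fun a ↦ ?_, fun a b ↦ ?_, fun a b ↦ ?_⟩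
  · refine LinearIndependent.of_comp (M := Eu k) (ContinuousLinearMap.fst ℝ (Eu k) (Eu m) ∘L
      tangentMapAt (Eu (k + m)) (Eu k × Eu m) φ (ι p) ∘L
      tangentMapAt (Eu k) (Eu (k + m)) ι p).toLinearMap ?_
    convert linearIndependent_single (n := k) with a
    exact congrArg Prod.fst (he a)
  · refine LinearIndependent.of_comp (M := Eu (k + m)) (ContinuousLinearMap.snd ℝ (Eu k) (Eu m) ∘L
      tangentMapAt (Eu (k + m)) (Eu k × Eu m) φ (ι p)).toLinearMap ?_
    convert linearIndependent_single (n := m) with a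
    exact congrArg Prod.snd (he' a)
  · refine (metricInCoords_normal (g := g) hι hφ hS hp (e' a)).2 fun w ↦ ?_
    rw [he', hp0]
    exact hperp _ w
  · exact ((hinner _ _).trans
      (congrArg₂ (fun v w ↦ metricInCoords g φ 0 v w) (he a) (he b))).trans (hG0 _ _)
  · exact ((hinner _ _).trans
      (congrArg₂ (fun v w ↦ metricInCoords g φ 0 v w) (he' a) (he' b))).trans (hG0 _ _)

variable (φ ι) in
/-- The coordinate vector field `∂_α'` along the submanifold. -/
def verticalField (a : Fin m) (y : S) : TangentSpace 𝓘(ℝ, Eu (k + m)) (ι y) :=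
  tangentMapAt (Eu k × Eu m) (Eu (k + m)) φ.symm (φ (ι y)) (coordVector (Sum.inr a))

lemma tangentMapAt_verticalField (hφ : IsCoordinateSystem (E := Eu (k + m)) φ) {y : S}
    (hy : ι y ∈ φ.source) (a : Fin m) :
    tangentMapAt (Eu (k + m)) (Eu k × Eu m) φ (ι y) (verticalField ι φ a y) =
      coordVector (Sum.inr a) := by
  have h := hφ.tangentMapAt_symm_right (φ.map_source hy) (coordVector (Sum.inr a))
  rwa [φ.left_inv hy] at h

lemma contMDiffAt_verticalField [IsManifold 𝓘(ℝ, Eu (k + m)) ∞ M]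
    [TopologicalSpace S] [ChartedSpace (Eu k) S]
    (hι : IsEmbeddedSubmanifold (E := Eu (k + m)) (E' := Eu k) ι)
    (hφ : IsCoordinateSystem (E := Eu (k + m)) φ) {y : S} (hy : ι y ∈ φ.source) (a : Fin m) :
    ContMDiffAt 𝓘(ℝ, Eu k) 𝓘(ℝ, Eu (k + m)).tangent ∞
      (fun y ↦ (⟨ι y, verticalField ι φ a y⟩ : TangentBundle 𝓘(ℝ, Eu (k + m)) M)) y := by
  have h := ((contMDiffOn_tangentMapAt φ.open_target hφ.contMDiffOn_symm
    (coordVector (Sum.inr a))).contMDiffAt (φ.open_target.mem_nhds (φ.map_source hy))).comp y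
    ((hφ.contMDiffAt hy).comp y hι.contMDiff.contMDiffAt)
  refine h.congr_of_eventuallyEq ?_
  filter_upwards [(φ.open_source.preimage hι.contMDiff.continuous).mem_nhds hy] with y' hy'
  exact congrArg (fun q ↦ (⟨q, tangentMapAt (Eu k × Eu m) (Eu (k + m)) φ.symm (φ (ι y'))
    (coordVector (Sum.inr a))⟩ : TangentBundle 𝓘(ℝ, Eu (k + m)) M)) (φ.left_inv hy').symm

/-- Converse of `metric_of_isSubmanifoldGeodesicNormal`. -/
lemma isSubmanifoldGeodesicNormal_of_metric [T2Space M] [IsManifold 𝓘(ℝ, Eu (k + m)) ∞ M]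
    [TopologicalSpace S] [ChartedSpace (Eu k) S] [IsManifold 𝓘(ℝ, Eu k) ∞ S]
    (hg : IsRegularMetric g)
    (hι : IsEmbeddedSubmanifold (E := Eu (k + m)) (E' := Eu k) ι)
    (hgS : IsRegularMetric (pullback ι g : BilinField (Eu k) S))
    (hφ : IsCoordinateSystem (E := Eu (k + m)) φ)
    (hS : ∀ q ∈ φ.source, q ∈ range ι ↔ (φ q).2 = 0)
    (hp : ι p ∈ φ.source) (hp0 : φ (ι p) = 0)
    {e : Fin k → TangentSpace 𝓘(ℝ, Eu k) p}
    {e' : Fin m → TangentSpace 𝓘(ℝ, Eu (k + m)) (ι p)}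
    (he : ∀ a, tangentMapAt (Eu k) (Eu k) (sliceChart hι.isEmbedding φ hS p) p (e a)
      = EuclideanSpace.single a 1)
    (he' : ∀ a, tangentMapAt (Eu (k + m)) (Eu k × Eu m) φ (ι p) (e' a) = coordVector (Sum.inr a))
    {r : ℝ} (hr : 0 < r) (htar : Metric.ball (0 : Eu k × Eu m) r ⊆ φ.target)
    (hperp : ∀ u w, metricInCoords g φ 0 (0, u) (w, 0) = 0)
    (hrad : ∀ z ∈ Metric.ball (0 : Eu k × Eu m) r, ∀ v,
      metricInCoords g φ (z.1, 0) (z.1, 0) (v, 0) = metricInCoords g φ 0 (z.1, 0) (v, 0))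
    (hvert : ∀ z ∈ Metric.ball (0 : Eu k × Eu m) r, ∀ w,
      metricInCoords g φ z (0, z.2) w = metricInCoords g φ 0 (0, z.2) w)
    (hmix : ∀ z ∈ Metric.ball (0 : Eu k × Eu m) r, ∀ u u',
      fderiv ℝ (metricInCoords g φ) (z.1, 0) (0, u) (z.1, 0) (0, u') = 0) :
    IsSubmanifoldGeodesicNormal g ι p e e' φ := by
  have : T2Space S := hι.isEmbedding.t2Space
  set ψ := sliceChart hι.isEmbedding φ hS p with hψ_def
  have hψ : IsCoordinateSystem (E := Eu k) ψ := isCoordinateSystem_sliceChart hι hφ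
  have hψp : ψ p = 0 := congrArg Prod.fst hp0
  have hfst : ∀ {ρ : ℝ}, ∀ z ∈ Metric.ball (0 : Eu k × Eu m) ρ, z.1 ∈ Metric.ball (0 : Eu k) ρ := by
    intro ρ z hz
    rw [mem_ball_zero_iff] at hz ⊢
    exact (norm_fst_le z).trans_lt hz
  have hball : ∀ x ∈ Metric.ball (0 : Eu k) r, (x, (0 : Eu m)) ∈ Metric.ball 0 r :=
    fun x hx ↦ prodMk_zero_mem_ball hx
  have hlift : ∀ x ∈ Metric.ball (0 : Eu k) r, (x, (0 : Eu m)) ∈ φ.target :=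
    fun x hx ↦ htar (hball x hx)
  have hιψ : ∀ x ∈ Metric.ball (0 : Eu k) r, ι (ψ.symm x) = φ.symm (x, 0) :=
    fun x hx ↦ apply_sliceChart_symm (hlift x hx)
  have hGs : ∀ z ∈ Metric.ball (0 : Eu k × Eu m) r, ContDiffAt ℝ ∞ (metricInCoords g φ) z :=
    fun z hz ↦ hg.contDiffAt hφ (htar hz)
  have hG : ∀ z ∈ Metric.ball (0 : Eu k × Eu m) r, DifferentiableAt ℝ (metricInCoords g φ) z :=
    fun z hz ↦ (hGs z hz).differentiableAt (by simp)
  have hsymm : ∀ z v w, metricInCoords g φ z v w = metricInCoords g φ z w v :=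
    metricInCoords_symm hg.symm
  have hnd : ∀ z ∈ Metric.ball (0 : Eu k × Eu m) r, ∀ v,
      (∀ w, metricInCoords g φ z v w = 0) → v = 0 :=
    fun z hz ↦ hφ.metricInCoords_nondegenerate hg.nondegenerate (htar hz)
  have hgeoS := christoffel_radial_eq_zero (r := r)
    (G' := metricInCoords (E := Eu k) (pullback ι g) ψ)
    (fun x hx ↦ (hgS.contDiffAt hψ (hlift x hx)).differentiableAt (by simp))
    (metricInCoords_symm hgS.symm)
    (fun x hx ↦ hψ.metricInCoords_nondegenerate hgS.nondegenerate (hlift x hx))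
    (fun x hx w ↦ by
      rw [metricInCoords_sliceChart hι hφ g (hlift x hx),
        metricInCoords_sliceChart hι hφ g (hlift 0 (Metric.mem_ball_self hr))]
      exact hrad _ (hball x hx) w)
  have hgeo := christoffel_vertical_eq_zero hG hsymm hnd hvert
  have hγ : ∀ x ∈ Metric.ball (0 : Eu k) (r / 2),
      IsGeodesicFrom (pullback ι g) p (∑ a, x a • e a) (fun t ↦ ψ.symm (0 + t • x)) :=
    fun x hx ↦ isGeodesicFrom_radial hgS hψ hp hψp hlift he hgeoS hx
  -- The parallel extension is the coordinate frame ∂_α' itself; its normality and parallelism have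
  -- to be read off from the metric identities.
  refine ⟨verticalField ι φ, ⟨fun a ↦ ?_, fun a ↦ ?_, fun a ↦ ?_, ?_⟩, ?_⟩
  · have h := hφ.tangentMapAt_symm_left hp (e' a)
    rwa [he'] at h
  · filter_upwards [(φ.open_source.preimage hι.contMDiff.continuous).mem_nhds hp] with y hy
    exact contMDiffAt_verticalField hι hφ hy a
  · have h1 : ∀ᶠ y in 𝓝 p, φ (ι y) ∈ Metric.ball (0 : Eu k × Eu m) r := by
      have hc : ContinuousAt (fun y ↦ φ (ι y)) p :=
        (φ.continuousAt hp).comp hι.contMDiff.continuous.continuousAt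
      exact hc.eventually_mem (Metric.isOpen_ball.mem_nhds (hp0 ▸ Metric.mem_ball_self hr))
    filter_upwards [(φ.open_source.preimage hι.contMDiff.continuous).mem_nhds hp, h1] with y hy hy'
    refine (metricInCoords_normal (g := g) hι hφ hS hy _).2 fun w ↦ ?_
    rw [apply_eq_sliceChart (hι := hι.isEmbedding) (hS := hS) (p := p) hy] at hy' ⊢
    rw [tangentMapAt_verticalField hφ hy a]
    exact (apply_vertical_eq_of_snd_eq_zero hG hvert hy' _ _).trans (hperp _ _)
  · filter_upwards [Metric.ball_mem_nhds (0 : Eu k) (half_pos hr)] with x hx γ hγx a t ht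
    -- γ is an arbitrary geodesic with the given initial velocity; uniqueness makes it the
    -- coordinate line on a neighbourhood of [0, 1].
    obtain ⟨ε, hε, heq⟩ := hγx.exists_eqOn hgS (hγ x hx)
    obtain ⟨⟨δ, hδ, hγδ⟩, -⟩ := hγx
    have hγt : MDifferentiableAt 𝓘(ℝ, ℝ) 𝓘(ℝ, Eu k) γ t :=
      (hγδ.1.contMDiffAt (isOpen_Ioo.mem_nhds ⟨by linarith [ht.1], by linarith [ht.2]⟩)
        ).mdifferentiableAt (by simp)
    have hev : ∀ᶠ s in 𝓝 t, s • x ∈ Metric.ball 0 r ∧ γ s = ψ.symm (s • x) := by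
      filter_upwards [isOpen_Ioo.mem_nhds (show t ∈ Ioo (-1 : ℝ) 2 from
        ⟨by linarith [ht.1], by linarith [ht.2]⟩), isOpen_Ioo.mem_nhds
        (show t ∈ Ioo (-ε) (1 + ε) from ⟨by linarith [ht.1], by linarith [ht.2]⟩)] with s hs hs'
      refine ⟨smul_mem_ball_of_mem_Ioo hx hs, ?_⟩
      simpa using heq hs'
    have hsrc : ∀ s, s • x ∈ Metric.ball 0 r ∧ γ s = ψ.symm (s • x) →
        ι (γ s) = φ.symm (s • x, 0) ∧ ι (γ s) ∈ φ.source := by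
      rintro s ⟨hs, hγs⟩
      rw [hγs, hιψ _ hs]
      exact ⟨rfl, φ.map_target (hlift _ hs)⟩
    refine (isNormalParallelAt_iff hι hφ hS hg hγt (hsrc t hev.self_of_nhds).2 (x := x)
      (u := EuclideanSpace.single a 1) ?_ ?_).2 (christoffel_mixed_snd_eq_zero hGs hsymm hnd hvert
        hperp (fun z hz hz2 u u' ↦ ?_)
        (hball x (Metric.ball_subset_ball (by linarith) hx)) ht _)
    · filter_upwards [hev] with s hs
      rw [(hsrc s hs).1, φ.right_inv (hlift _ hs.1)]
    · filter_upwards [hev] with s hs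
      exact tangentMapAt_verticalField hφ (hsrc s hs).2 a
    · obtain ⟨x, u₀⟩ := z
      obtain rfl : u₀ = 0 := hz2
      exact hmix _ hz u u'
  · filter_upwards [Metric.ball_mem_nhds (0 : Eu k × Eu m) (half_pos hr)] with z hz
    have hx : z.1 ∈ Metric.ball (0 : Eu k) r := Metric.ball_subset_ball (by linarith) (hfst z hz)
    have hsrc : ι (ψ.symm z.1) ∈ φ.source := hιψ _ hx ▸ φ.map_target (hlift _ hx)
    refine ⟨ψ.symm z.1, ⟨_, hγ z.1 (hfst z hz), by simp⟩,
      fun t ↦ φ.symm ((z.1, 0) + t • (0, z.2)), ?_, by simp⟩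
    have hmem : ∀ t ∈ Ioo (-1 : ℝ) 2,
        (z.1, 0) + t • (0, z.2) ∈ Metric.ball (0 : Eu k × Eu m) r := by
      intro t ht
      have h2 : z.2 ∈ Metric.ball (0 : Eu m) (r / 2) := by
        rw [mem_ball_zero_iff] at hz ⊢
        exact (norm_snd_le z).trans_lt hz
      have h3 := smul_mem_ball_of_mem_Ioo h2 ht
      rw [mem_ball_zero_iff] at hx h3 ⊢
      simpa [Prod.norm_def] using And.intro hx h3
    refine hg.isGeodesicFrom hφ hsrc ?_ ?_ (fun t ht ↦ htar (hmem t ht)) fun t ht ↦ ?_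
    · rw [hιψ _ hx, φ.right_inv (hlift _ hx)]
    · refine (map_sum_smul_frame (tangentMapAt (Eu (k + m)) (Eu k × Eu m) φ
        (ι (ψ.symm z.1))).toLinearMap (V := Eu (k + m))
        (fun a ↦ tangentMapAt_verticalField hφ hsrc a) z.2).trans ?_
      exact sum_smul_coordVector_inr z.2
    · refine christoffel_line_eq_zero Metric.isOpen_ball hGs hnd (fun t ht ↦ ?_) (hmem t ht)
      have h := hgeo _ ht
      simpa using h

end Converse

/-! ### The metric at the origin. -/

section Components

variable {k m : ℕ} {G : Eu k × Eu m → Eu k × Eu m →L[ℝ] Eu k × Eu m →L[ℝ] ℝ}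
  {h : Matrix (Fin k ⊕ Fin m) (Fin k ⊕ Fin m) ℝ}

/-- To first order at 0, (A) gives the tangential block, (B) the normal block and (D) the vanishing
mixed block; symmetry supplies the remaining one. -/
lemma apply_zero_coordVector_of_eventually (hh : IsReferenceForm h)
    (hsymm : ∀ z v w, G z v w = G z w v) (hcont : ContinuousAt G 0)
    (hA : ∀ᶠ x : Eu k in 𝓝 0, ∀ a, ∑ b, G (x, 0) (coordVector (Sum.inl a)) (coordVector (Sum.inl b))
      * x b = ∑ b, h (Sum.inl a) (Sum.inl b) * x b)
    (hB : ∀ᶠ z in 𝓝 0, ∀ a, ∑ b, G z (coordVector (Sum.inr a)) (coordVector (Sum.inr b)) * z.2 b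
      = ∑ b, h (Sum.inr a) (Sum.inr b) * z.2 b)
    (hD : ∀ᶠ z in 𝓝 0, ∀ c, ∑ a, G z (coordVector (Sum.inl c)) (coordVector (Sum.inr a)) * z.2 a
      = 0) (i j : Fin k ⊕ Fin m) : G 0 (coordVector i) (coordVector j) = h i j := by
  have hinl : ContinuousAt (fun x : Eu k ↦ (x, (0 : Eu m))) 0 := by fun_prop
  have hlin : ∀ {n : ℕ} (f : Fin n → ℝ) (t : ℝ) (y : Eu n),
      ∑ b, f b * (t • y) b = t * ∑ b, f b * y b := fun f t y ↦ by
    rw [Finset.mul_sum]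
    exact Finset.sum_congr rfl fun b _ ↦ by simp; ring
  have hll : ∀ a b, G 0 (coordVector (Sum.inl a)) (coordVector (Sum.inl b)) =
      h (Sum.inl a) (Sum.inl b) := by
    intro a b
    have h1 := apply_zero_eq_of_eventually (G := fun x : Eu k ↦ G (x, 0))
      (ContinuousAt.comp_of_eq hcont hinl rfl) (ContinuousLinearMap.inl ℝ (Eu k) (Eu m))
      (fun x ↦ ∑ b, h (Sum.inl a) (Sum.inl b) * x b) (hlin _) (coordVector (Sum.inl a))
      (by filter_upwards [hA] with x hx using (sum_apply_mul_inl _ x).symm.trans (hx a))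
      (EuclideanSpace.single b 1)
    refine Eq.trans h1 ?_
    simp
  have hrr : ∀ a b, G 0 (coordVector (Sum.inr a)) (coordVector (Sum.inr b)) =
      h (Sum.inr a) (Sum.inr b) := by
    intro a b
    have h1 := apply_zero_eq_of_eventually hcont (verticalProj (Eu k) (Eu m))
      (fun z ↦ ∑ b, h (Sum.inr a) (Sum.inr b) * z.2 b) (fun t z ↦ hlin _ t z.2)
      (coordVector (Sum.inr a))
      (by filter_upwards [hB] with z hz using (sum_apply_mul_inr _ z.2).symm.trans (hz a))
      (0, EuclideanSpace.single b 1)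
    refine Eq.trans h1 ?_
    simp
  have hlr : ∀ a b, G 0 (coordVector (Sum.inl a)) (coordVector (Sum.inr b)) =
      h (Sum.inl a) (Sum.inr b) := by
    intro a b
    rw [hh.orthogonal]
    exact apply_zero_eq_of_eventually hcont (verticalProj (Eu k) (Eu m))
      (fun _ ↦ 0) (fun t z ↦ (mul_zero t).symm) (coordVector (Sum.inl a))
      (by filter_upwards [hD] with z hz using (sum_apply_mul_inr _ z.2).symm.trans (hz a))
      (0, EuclideanSpace.single b 1)
  rcases i with a | a <;> rcases j with b | b
  · exact hll a b
  · exact hlr a b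
  · rw [hsymm, hlr, hh.isSymm.apply]
  · exact hrr a b

lemma apply_zero_vertical_horizontal (hh : IsReferenceForm h) (hsymm : ∀ z v w, G z v w = G z w v)
    (hG0 : ∀ i j, G 0 (coordVector i) (coordVector j) = h i j) (u : Eu m) (w : Eu k) :
    G 0 (0, u) (w, 0) = 0 := by
  refine forall_coordVector_inr (L := (G 0).flip (w, 0)).1 (fun a ↦ ?_) u
  refine forall_coordVector_inl (L := G 0 (coordVector (Sum.inr a))).1 (fun b ↦ ?_) w
  rw [hsymm, hG0, hh.orthogonal]

end Components

section Components

variable {k m : ℕ} {M : Type*} [TopologicalSpace M] [ChartedSpace (Eu (k + m)) M]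
  {S : Type*} [TopologicalSpace S] [ChartedSpace (Eu k) S]
  {g : BilinField (Eu (k + m)) M} {ι : S → M} {p : S}
  {φ : OpenPartialHomeomorph M (Eu k × Eu m)} {h : Matrix (Fin k ⊕ Fin m) (Fin k ⊕ Fin m) ℝ}

lemma IsAdaptedFrame.metricInCoords_zero (hg : ∀ q v w, g q v w = g q w v)
    (hφ : IsCoordinateSystem (E := Eu (k + m)) φ)
    (hp : ι p ∈ φ.source) (hp0 : φ (ι p) = 0) (hh : IsReferenceForm h)
    (hperp : ∀ u w, metricInCoords g φ 0 (0, u) (w, 0) = 0)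
    {e : Fin k → TangentSpace 𝓘(ℝ, Eu k) p}
    {e' : Fin m → TangentSpace 𝓘(ℝ, Eu (k + m)) (ι p)}
    (he : ∀ a, tangentMapAt (Eu (k + m)) (Eu k × Eu m) φ (ι p)
      (tangentMapAt (Eu k) (Eu (k + m)) ι p (e a)) = coordVector (Sum.inl a))
    (he' : ∀ a, tangentMapAt (Eu (k + m)) (Eu k × Eu m) φ (ι p) (e' a) = coordVector (Sum.inr a))
    (hframe : IsAdaptedFrame g ι p h e e') (i j : Fin k ⊕ Fin m) :
    metricInCoords g φ 0 (coordVector i) (coordVector j) = h i j := by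
  have hinner : ∀ {v w : Eu (k + m)} {v' w' : Eu k × Eu m},
      tangentMapAt (Eu (k + m)) (Eu k × Eu m) φ (ι p) v = v' →
      tangentMapAt (Eu (k + m)) (Eu k × Eu m) φ (ι p) w = w' →
      metricInCoords g φ 0 v' w' = g.at (ι p) v w := fun hv hw ↦ by
    rw [← hv, ← hw, ← hp0]
    exact hφ.metricInCoords_tangentMapAt g hp _ _
  have hsymm : ∀ z v w, metricInCoords g φ z v w = metricInCoords g φ z w v :=
    metricInCoords_symm hg
  have hlr : ∀ a b, metricInCoords g φ 0 (coordVector (Sum.inr a)) (coordVector (Sum.inl b)) = 0 :=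
    fun a b ↦ hperp _ _
  rcases i with a | a <;> rcases j with b | b
  · exact (hinner (he a) (he b)).trans (hframe.inner_eq a b)
  · rw [hsymm, hlr, hh.orthogonal]
  · rw [hlr, ← hh.isSymm.apply, hh.orthogonal]
  · exact (hinner (he' a) (he' b)).trans (hframe.inner_eq' a b)

end Components

end SubmanifoldNormal

end

open SubmanifoldNormal in
theorem proposition2p1 {k m : ℕ} (hk : 1 ≤ k) (hm : 1 ≤ m)
    {M : Type*} [TopologicalSpace M] [T2Space M] [ChartedSpace (Eu (k + m)) M]
    [IsManifold 𝓘(ℝ, Eu (k + m)) ∞ M]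
    {S : Type*} [TopologicalSpace S] [ChartedSpace (Eu k) S] [IsManifold 𝓘(ℝ, Eu k) ∞ S]
    (g : BilinField (Eu (k + m)) M) (hg : IsPseudoRiemannianMetric g)
    (ι : S → M) (hι : IsEmbeddedSubmanifold (E := Eu (k + m)) (E' := Eu k) ι)
    (hnd : IsNondegenerate (pullback ι g : BilinField (Eu k) S))
    (h : Matrix (Fin k ⊕ Fin m) (Fin k ⊕ Fin m) ℝ) (hh : IsReferenceForm h)
    (p : S)
    (e : Fin k → TangentSpace 𝓘(ℝ, Eu k) p)
    (e' : Fin m → TangentSpace 𝓘(ℝ, Eu (k + m)) (ι p))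
    (φ : OpenPartialHomeomorph M (Eu k × Eu m)) (hφ : IsCoordinateSystem (E := Eu (k + m)) φ)
    (hp : ι p ∈ φ.source) (hp0 : φ (ι p) = 0)
    (hS : ∀ q ∈ φ.source, q ∈ Set.range ι ↔ (φ q).2 = 0) :
    (IsAdaptedFrame g ι p h e e' ∧ IsSubmanifoldGeodesicNormal g ι p e e' φ) ↔
    -- the frames are the coordinate vectors at the origin
    ((∀ a, mfderiv 𝓘(ℝ, Eu (k + m)) 𝓘(ℝ, Eu k × Eu m) φ (ι p)
        (mfderiv 𝓘(ℝ, Eu k) 𝓘(ℝ, Eu (k + m)) ι p (e a)) = coordVector (Sum.inl a)) ∧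
     (∀ a, mfderiv 𝓘(ℝ, Eu (k + m)) 𝓘(ℝ, Eu k × Eu m) φ (ι p) (e' a)
        = coordVector (Sum.inr a)) ∧
     -- (A)
     (∀ᶠ x : Eu k in 𝓝 0, ∀ a : Fin k,
        ∑ b, metricCoeff g φ (Sum.inl a) (Sum.inl b) (x, 0) * x b
          = ∑ b, h (Sum.inl a) (Sum.inl b) * x b) ∧
     -- (B)
     (∀ᶠ z : Eu k × Eu m in 𝓝 0, ∀ a : Fin m,
        ∑ b, metricCoeff g φ (Sum.inr a) (Sum.inr b) z * z.2 b
          = ∑ b, h (Sum.inr a) (Sum.inr b) * z.2 b) ∧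
     -- (C)
     (∀ᶠ x : Eu k in 𝓝 0, ∀ a b : Fin m,
        ∑ c, fderiv ℝ (metricCoeff g φ (Sum.inl c) (Sum.inr a)) (x, 0)
          (coordVector (Sum.inr b)) * x c = 0) ∧
     -- (D)
     (∀ᶠ z : Eu k × Eu m in 𝓝 0, ∀ c : Fin k,
        ∑ a, metricCoeff g φ (Sum.inl c) (Sum.inr a) z * z.2 a = 0)) := by
  have hgr := hg.isRegularMetric
  have hgS := hgr.pullback hι.contMDiff hnd
  have h0 : (0 : Eu k × Eu m) ∈ φ.target := hp0 ▸ φ.map_source hp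
  have hsymm : ∀ z v w, metricInCoords g φ z v w = metricInCoords g φ z w v :=
    metricInCoords_symm hg.symm
  have hdiff : ∀ z ∈ φ.target, DifferentiableAt ℝ (metricInCoords g φ) z :=
    fun z hz ↦ (hgr.contDiffAt hφ hz).differentiableAt (by simp)
  have hframe : ∀ a, tangentMapAt (Eu (k + m)) (Eu k × Eu m) φ (ι p)
      (tangentMapAt (Eu k) (Eu (k + m)) ι p (e a)) =
      (tangentMapAt (Eu k) (Eu k) (sliceChart hι.isEmbedding φ hS p) p (e a), 0) :=
    fun a ↦ tangentMapAt_tangentMapAt_eq hι.contMDiff hφ hp (e a)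
  constructor
  · rintro ⟨hadapted, hnormal⟩
    obtain ⟨he, he', r, hr, htar, hperp, hrad, hvert, hmix⟩ :=
      metric_of_isSubmanifoldGeodesicNormal hgr hι hgS hφ hS hp hp0 hnormal
    have hee : ∀ a, tangentMapAt (Eu (k + m)) (Eu k × Eu m) φ (ι p)
        (tangentMapAt (Eu k) (Eu (k + m)) ι p (e a)) = coordVector (Sum.inl a) :=
      fun a ↦ (hframe a).trans (Prod.ext (he a) rfl)
    have hG0 := hadapted.metricInCoords_zero hg.symm hφ hp hp0 hh hperp hee he'
    have hball : ∀ᶠ z : Eu k × Eu m in 𝓝 0, z ∈ Metric.ball 0 r := Metric.ball_mem_nhds 0 hr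
    have hballS : ∀ᶠ x : Eu k in 𝓝 0, x ∈ Metric.ball 0 r := Metric.ball_mem_nhds 0 hr
    refine ⟨hee, he', hballS.mono fun x hx ↦ ?_, hball.mono fun z hz ↦ ?_,
      hballS.mono fun x hx ↦ ?_, hball.mono fun z hz ↦ ?_⟩
    · exact (tangential_condition_iff hsymm hG0 x).2 (hrad (x, 0) (prodMk_zero_mem_ball hx))
    · exact ((normal_condition_iff hh hsymm hG0 z).2 (hvert z hz)).1
    · exact (mixed_condition_iff hsymm (hdiff _ (htar (prodMk_zero_mem_ball hx)))).2
        (hmix (x, 0) (prodMk_zero_mem_ball hx))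
    · exact ((normal_condition_iff hh hsymm hG0 z).2 (hvert z hz)).2
  · rintro ⟨hee, he', hA, hB, hC, hD⟩
    have he : ∀ a, tangentMapAt (Eu k) (Eu k) (sliceChart hι.isEmbedding φ hS p) p (e a)
        = EuclideanSpace.single a 1 := fun a ↦
      congrArg Prod.fst ((hframe a).symm.trans (hee a))
    -- Needed first: the Gauss identities compare `G` with its value at 0, so `h` must be identified
    -- with that value before (A), (B) and (D) can be translated.
    have hG0 := apply_zero_coordVector_of_eventually hh hsymm (hdiff 0 h0).continuousAt hA hB hD
    have hperp := apply_zero_vertical_horizontal hh hsymm hG0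
    obtain ⟨r, hr, hball⟩ := Metric.eventually_nhds_iff_ball.1
      ((hB.and hD).and (φ.open_target.mem_nhds h0))
    obtain ⟨r', hr', hball'⟩ := Metric.eventually_nhds_iff_ball.1 (hA.and hC)
    have hfst : ∀ z ∈ Metric.ball (0 : Eu k × Eu m) (min r r'), z.1 ∈ Metric.ball (0 : Eu k) r' ∧
        (z.1, (0 : Eu m)) ∈ φ.target := by
      intro z hz
      rw [mem_ball_zero_iff] at hz
      have hz1 := (norm_fst_le z).trans_lt hz
      exact ⟨mem_ball_zero_iff.2 (hz1.trans_le (min_le_right _ _)), (hball _ (prodMk_zero_mem_ball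
        (mem_ball_zero_iff.2 (hz1.trans_le (min_le_left _ _))))).2⟩
    have hsub : Metric.ball (0 : Eu k × Eu m) (min r r') ⊆ Metric.ball 0 r :=
      Metric.ball_subset_ball (min_le_left _ _)
    exact ⟨isAdaptedFrame_of_metricInCoords hι hφ hS hp hp0 hG0 hperp hee he',
      isSubmanifoldGeodesicNormal_of_metric hgr hι hgS hφ hS hp hp0 he he' (lt_min hr hr')
        (fun z hz ↦ (hball z (hsub hz)).2) hperp
        (fun z hz ↦ (tangential_condition_iff hsymm hG0 z.1).1 (hball' _ (hfst z hz).1).1)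
        (fun z hz ↦ (normal_condition_iff hh hsymm hG0 z).1 (hball z (hsub hz)).1)
        (fun z hz ↦ (mixed_condition_iff hsymm
          (hdiff _ (hfst z hz).2)).1
          (hball' _ (hfst z hz).1).2)⟩
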